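/- \textbf{Theorem 1.} Let $F=\mathbb{F}_q$ be a finite field of even order $q$. A conic of $\mathrm{PG}(2,q)$ is the zero locus of a nonzero quadratic form $\sum_{0\le i\le j\le 2}a_{ij}X_iX_j$ (taken up to scalars), and a pencil of conics is a $2$-dimensional vector space of quadratic forms. A point $P=(y_0,\dots,y_5)$ of $\mathrm{PG}(5,q)$ is represented by the symmetric matrix $$M_P=\begin{bmatrix}y_0&y_1&y_2\\y_1&y_3&y_4\\y_2&y_4&y_5\end{bmatrix},$$ and a solid is a $4$-dimensional vector subspace of $F^6$. For $A\in\mathrm{GL}(3,q)$ let $\alpha(A)\in\mathrm{PGL}(6,q)$ be the projectivity that sends $P$ to the point $Q$ with $M_Q=AM_PA^{T}$; this induces a homomorphism $\alpha:\mathrm{PGL}(3,q)\to\mathrm{PGL}(6,q)$ with image $K$. Let $\delta$ send the conic with coefficients $a_{ij}$ to the hyperplane $a_{00}Y_0+a_{01}Y_1+a_{02}Y_2+a_{11}Y_3+a_{12}Y_4+a_{22}Y_5=0$, and a pencil to the intersection of the hyperplanes of its conics. Let $\operatorname{Tr}$ denote the trace map $F\to\mathbb{F}_2$. (i) There are exactly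 $15$ orbits of pencils of conics in $\mathrm{PG}(2,q)$ under the natural action of $\mathrm{PGL}(3,q)$. (ii) Equivalently, there are exactly $15$ orbits of solids of $\mathrm{PG}(5,q)$ under $K$. Here $\alpha$ is injective, so $K\cong\mathrm{PGL}(3,q)$, and $\delta$ is a bijection from pencils to solids with $\delta(g\mathcal{P})=\alpha(g)\,\delta(\mathcal{P})$ for all $g\in\mathrm{PGL}(3,q)$ and all pencils $\mathcal{P}$. (iii) The following solids, respectively the pencils generated by the following pairs of quadratic forms, are representatives of the $15$ orbits $\Omega_1,\dots,\Omega_{15}$: every solid (pencil) lies in the orbit of exactly one of them, and for each $i$ the map $\delta$ sends the pencil listed for $\Omega_i$ into the $K$-orbit of the solid listed for $\Omega_i$. A matrix stands for the set of points whose matrix has this form with $x,y,z,t\in F$ (not all zero), and $\cdot$ stands for $0$. $$\begin{array}{lll} \Omega_1 & \begin{bmatrix}x&y&z\\y&t&\cdot\\z&\cdot&t\end{bmatrix} & (X_1+X_2)^2,\ X_1X_2\\ \Omega_2 & \begin{bmatrix}x&y&z\\y&t&\cdot\\z&\cdot&\cdot\end{bmatrix} & X_2^2,\ X_1X_2\\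 \Omega_3 & \begin{bmatrix}x&y&z\\y&\cdot&t\\z&t&\cdot\end{bmatrix} & X_1^2,\ X_2^2\\ \Omega_4 & \begin{bmatrix}x&\cdot&y\\\cdot&z&\cdot\\y&\cdot&t\end{bmatrix} & X_0X_1,\ X_1X_2\\ \Omega_5 & \begin{bmatrix}\cdot&x&y\\x&z&t\\y&t&x\end{bmatrix} & X_0X_1+X_2^2,\ X_0^2\\ \Omega_6 & \begin{bmatrix}x&\cdot&y\\\cdot&z&t\\y&t&\cdot\end{bmatrix} & X_0X_1+X_2^2,\ X_2^2\\ \Omega_7 & \begin{bmatrix}x&y&z\\y&x+\gamma y&t\\z&t&y\end{bmatrix} & X_0X_1+X_2^2,\ (X_0+X_1+\gamma X_2)^2\quad(\operatorname{Tr}(\gamma^{-1})=1)\\ \Omega_8 & \begin{bmatrix}x&y&z\\y&t&z\\z&z&y\end{bmatrix} & X_0X_1+X_2^2,\ (X_0+X_2)(X_1+X_2)\\ \Omega_9 & \begin{bmatrix}x&x&y\\x&z&t\\y&t&t\end{bmatrix} & X_0(X_0+X_1),\ X_2(X_1+X_2)\\ \Omega_{10} & \begin{bmatrix}x&y&z\\y&y+\gamma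 t&t\\z&t&y\end{bmatrix} & X_0X_1+X_2^2,\ X_1(X_0+X_1+\gamma X_2)\quad(\operatorname{Tr}(\gamma^{-1})=1)\\ \Omega_{11} & \begin{bmatrix}x&y&z\\y&t&\cdot\\z&\cdot&y\end{bmatrix} & X_0X_1+X_2^2,\ X_1X_2\\ \Omega_{12} & \begin{bmatrix}x&y&z\\y&t&\gamma y+z\\z&\gamma y+z&y\end{bmatrix} & X_0X_1+X_2^2,\ X_2(X_0+X_1+\gamma X_2)\quad(\operatorname{Tr}(\gamma^{-1})=1)\\ \Omega_{13} & \begin{bmatrix}x&y&z\\y&\gamma x+y&t\\z&t&\gamma x+z\end{bmatrix} & \gamma X_0^2+X_0X_1+X_1^2,\ \gamma X_0^2+X_0X_2+X_2^2\quad(\operatorname{Tr}(\gamma)=1)\\ \Omega_{14} & \begin{bmatrix}x&y&\gamma x+y+\gamma t\\y&\gamma x+y&z\\\gamma x+y+\gamma t&z&t\end{bmatrix} & X_1^2+X_0X_2+\gamma X_2^2,\ \gamma X_0^2+X_0X_1+X_1^2\quad(\operatorname{Tr}(\gamma)=1)\\ \Omega_{15} & \begin{bmatrix}x&y&bz+cy\\y&z&t\\bz+cy&t&y\end{bmatrix}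 & X_0X_1+X_2^2,\ X_0X_2+bX_1^2+cX_2^2\quad(b\ne 0,\ b\lambda^3+c\lambda+1\text{ irreducible over }F) \end{array}$$ Elements $\gamma$, $b$, $c$ as required exist for every even $q$, and the statement holds for every choice of them, made separately in each row. -/

import Mathlib

open MvPolynomial Matrix

noncomputable section

/-- The projectivity group `PGL(n, F)`: invertible matrices modulo the scalar ones. -/
abbrev PGL (n : ℕ) (F : Type*) [Field F] : Type _ :=
  GL (Fin n) F ⧸ Subgroup.center (GL (Fin n) F)

/-! ### Pencils of conics in the projective plane -/

/-- A pencil of conics in `PG(2, F)`: a `2`-dimensional space of quadratic forms in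
`X 0, X 1, X 2`. Its conics are the zero loci of its nonzero members. -/
def Pencil (F : Type*) [Field F] : Type _ :=
  {P : Submodule F (MvPolynomial (Fin 3) F) //
    P ≤ homogeneousSubmodule (Fin 3) F 2 ∧ Module.finrank F P = 2}

section PencilAction

variable {F : Type*} [Field F]

/-- Linear substitution: `subst A f` is the polynomial `f (A X)`. -/
def subst (A : Matrix (Fin 3) (Fin 3) F) :
    MvPolynomial (Fin 3) F →ₗ[F] MvPolynomial (Fin 3) F :=
  (bind₁ A.toMvPolynomial).toLinearMap

theorem subst_one (f : MvPolynomial (Fin 3) F) : subst 1 f = f := by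
  simp [subst, toMvPolynomial_one, bind₁_X_left]

theorem subst_subst (A B : Matrix (Fin 3) (Fin 3) F) (f : MvPolynomial (Fin 3) F) :
    subst A (subst B f) = subst (B * A) f := by
  simp only [subst, AlgHom.toLinearMap_apply, bind₁_bind₁, ← toMvPolynomial_mul]

theorem subst_injective (A : GL (Fin 3) F) : Function.Injective (subst A.1) := by
  intro f g h
  have := congrArg (subst (A⁻¹).1) h
  rwa [subst_subst, subst_subst, ← Units.val_mul, mul_inv_cancel, Units.val_one,
    subst_one, subst_one] at this

theorem subst_homogeneous (A : Matrix (Fin 3) (Fin 3) F) {f : MvPolynomial (Fin 3) F} {n : ℕ}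
    (hf : f.IsHomogeneous n) : (subst A f).IsHomogeneous n := by
  have := hf.aeval A.toMvPolynomial (fun i => toMvPolynomial_isHomogeneous A i)
  rwa [one_mul] at this

/-- The natural action of `GL(3, F)`: the conic `Z(f)` is sent to its image under `x ↦ A x`,
that is, to `Z(f (A⁻¹ X))`. -/
instance : MulAction (GL (Fin 3) F) (Pencil F) where
  smul A P := ⟨P.1.map (subst (A⁻¹).1), by
    rintro _ ⟨f, hf, rfl⟩
    exact subst_homogeneous _ (P.2.1 hf), by
    rw [← (Submodule.equivMapOfInjective _ (subst_injective A⁻¹) P.1).finrank_eq, P.2.2]⟩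
  one_smul P := Subtype.ext (by
    change P.1.map (subst ((1 : GL (Fin 3) F)⁻¹).1) = P.1
    have : subst ((1 : GL (Fin 3) F)⁻¹).1 = LinearMap.id := by
      refine LinearMap.ext fun f => ?_
      rw [inv_one, Units.val_one, subst_one, LinearMap.id_apply]
    rw [this, Submodule.map_id])
  mul_smul A B P := Subtype.ext (by
    change P.1.map (subst ((A * B)⁻¹).1) = (P.1.map (subst (B⁻¹).1)).map (subst (A⁻¹).1)
    rw [← Submodule.map_comp]
    congr 1
    refine LinearMap.ext fun f => ?_
    rw [LinearMap.comp_apply, subst_subst, _root_.mul_inv_rev, Units.val_mul])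

theorem Pencil.smul_val (A : GL (Fin 3) F) (P : Pencil F) :
    (A • P).1 = P.1.map (subst (A⁻¹).1) := rfl

theorem subst_scalar (c : F) {f : MvPolynomial (Fin 3) F} {n : ℕ} (hf : f.IsHomogeneous n) :
    subst (Matrix.scalar (Fin 3) c) f = c ^ n • f := by
  have h : (Matrix.scalar (Fin 3) c).toMvPolynomial = fun i => C c * X i := by
    funext i
    simp only [Matrix.toMvPolynomial, Matrix.scalar_apply, Matrix.diagonal_apply]
    rw [Finset.sum_eq_single i]
    · simp [C_mul_X_eq_monomial]
    · intro j _ hj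
      simp [Ne.symm hj]
    · simp
  rw [subst, AlgHom.toLinearMap_apply, h]
  conv_lhs => rw [f.as_sum]
  conv_rhs => rw [f.as_sum]
  rw [map_sum, Finset.smul_sum]
  refine Finset.sum_congr rfl fun d hd => ?_
  have hdn : ∑ i ∈ d.support, d i = n := by
    have := hf (mem_support_iff.mp hd)
    rwa [show Finsupp.weight (1 : Fin 3 → ℕ) d = Finsupp.degree d from
      (DFunLike.congr_fun (Finsupp.degree_eq_weight_one (R := ℕ)) d).symm,
      Finsupp.degree_apply] at this
  rw [bind₁_monomial, smul_monomial, monomial_eq]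
  simp only [mul_pow, Finset.prod_mul_distrib, ← map_pow, ← map_prod]
  rw [Finset.prod_pow_eq_pow_sum]
  rw [hdn, Finsupp.prod, smul_eq_mul, map_mul]
  ring

theorem Pencil.center_smul (A : GL (Fin 3) F) (hA : A ∈ Subgroup.center (GL (Fin 3) F))
    (P : Pencil F) : A • P = P := by
  obtain ⟨c, hc⟩ := Matrix.GeneralLinearGroup.mem_center_iff_val_mem_range_scalar.mp
    (Subgroup.inv_mem _ hA)
  have hc0 : c ≠ 0 := by
    rintro rfl
    have h1 : (A⁻¹).1 * A.1 = 1 := by rw [← Units.val_mul]; simp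
    rw [← hc] at h1
    simpa using congrFun (congrFun h1 0) 0
  refine Subtype.ext ?_
  rw [Pencil.smul_val, ← hc]
  ext f
  constructor
  · rintro ⟨g, hg, rfl⟩
    rw [subst_scalar c (P.2.1 hg)]
    exact P.1.smul_mem _ hg
  · intro hf
    refine ⟨(c ^ 2)⁻¹ • f, P.1.smul_mem _ hf, ?_⟩
    rw [subst_scalar c (P.2.1 (P.1.smul_mem _ hf)), smul_smul,
      mul_inv_cancel₀ (pow_ne_zero 2 hc0), one_smul]

/-- The natural action of `PGL(3, F)` on pencils of conics, induced by that of `GL(3, F)`. -/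
instance : MulAction (PGL 3 F) (Pencil F) :=
  MulAction.compHom (Pencil F)
    (QuotientGroup.lift (Subgroup.center (GL (Fin 3) F))
      (MulAction.toPermHom (GL (Fin 3) F) (Pencil F))
      (fun A hA => Equiv.ext fun P => Pencil.center_smul A hA P))

theorem Pencil.mk_smul (A : GL (Fin 3) F) (P : Pencil F) :
    (QuotientGroup.mk A : PGL 3 F) • P = A • P := rfl

end PencilAction

/-! ### Solids in five-dimensional projective space -/

/-- A solid of `PG(5, F)`: a `4`-dimensional subspace of the coordinate space `F ^ 6`. -/
def Solid (F : Type*) [Field F] : Type _ :=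
  {S : Submodule F (Fin 6 → F) // Module.finrank F S = 4}

section SolidAction

variable {F : Type*} [Field F]

theorem mulVecLin_injective (A : GL (Fin 6) F) : Function.Injective (Matrix.mulVecLin A.1) := by
  intro v w h
  have := congrArg (Matrix.mulVecLin (A⁻¹).1) h
  simpa only [Matrix.mulVecLin_apply, Matrix.mulVec_mulVec, ← Units.val_mul, inv_mul_cancel,
    Units.val_one, Matrix.one_mulVec] using this

/-- The natural action of `GL(6, F)` on solids. -/
instance : MulAction (GL (Fin 6) F) (Solid F) where
  smul A S := ⟨S.1.map (Matrix.mulVecLin A.1), by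
    rw [← (Submodule.equivMapOfInjective _ (mulVecLin_injective A) S.1).finrank_eq, S.2]⟩
  one_smul S := Subtype.ext (by
    change S.1.map (Matrix.mulVecLin (1 : GL (Fin 6) F).1) = S.1
    rw [Units.val_one, Matrix.mulVecLin_one, Submodule.map_id])
  mul_smul A B S := Subtype.ext (by
    change S.1.map (Matrix.mulVecLin (A * B).1) =
      (S.1.map (Matrix.mulVecLin B.1)).map (Matrix.mulVecLin A.1)
    rw [← Submodule.map_comp, Units.val_mul, Matrix.mulVecLin_mul])

theorem Solid.smul_val (A : GL (Fin 6) F) (S : Solid F) :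
    (A • S).1 = S.1.map (Matrix.mulVecLin A.1) := rfl

theorem Solid.center_smul (A : GL (Fin 6) F) (hA : A ∈ Subgroup.center (GL (Fin 6) F))
    (S : Solid F) : A • S = S := by
  obtain ⟨c, hc⟩ := Matrix.GeneralLinearGroup.mem_center_iff_val_mem_range_scalar.mp hA
  have hc0 : c ≠ 0 := by
    rintro rfl
    have h1 : A.1 * (A⁻¹).1 = 1 := by rw [← Units.val_mul]; simp
    rw [← hc] at h1
    simpa using congrFun (congrFun h1 0) 0
  have hv : ∀ v : Fin 6 → F, Matrix.mulVecLin (Matrix.scalar (Fin 6) c) v = c • v := by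
    intro v
    funext i
    simp [Matrix.mulVec_diagonal]
  refine Subtype.ext ?_
  rw [Solid.smul_val, ← hc]
  ext v
  constructor
  · rintro ⟨w, hw, rfl⟩
    rw [hv]
    exact S.1.smul_mem _ hw
  · intro h
    exact ⟨c⁻¹ • v, S.1.smul_mem _ h, by rw [hv, smul_smul, mul_inv_cancel₀ hc0, one_smul]⟩

/-- The natural action of `PGL(6, F)` on solids, induced by that of `GL(6, F)`. -/
instance : MulAction (PGL 6 F) (Solid F) :=
  MulAction.compHom (Solid F)
    (QuotientGroup.lift (Subgroup.center (GL (Fin 6) F))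
      (MulAction.toPermHom (GL (Fin 6) F) (Solid F))
      (fun A hA => Equiv.ext fun S => Solid.center_smul A hA S))

theorem Solid.mk_smul (A : GL (Fin 6) F) (S : Solid F) :
    (QuotientGroup.mk A : PGL 6 F) • S = A • S := rfl

end SolidAction

/-! ### The lift of `PGL(3, F)` through the Veronese map -/

section Veronese

variable {F : Type*} [Field F]

/-- The symmetric matrix `M_P` of the point `P` with coordinates `y`. -/
def symMatrix (y : Fin 6 → F) : Matrix (Fin 3) (Fin 3) F :=
  !![y 0, y 1, y 2; y 1, y 3, y 4; y 2, y 4, y 5]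

/-- The coordinates of a point, read off from its symmetric matrix. -/
def coords (M : Matrix (Fin 3) (Fin 3) F) : Fin 6 → F :=
  ![M 0 0, M 0 1, M 0 2, M 1 1, M 1 2, M 2 2]

theorem coords_symMatrix (y : Fin 6 → F) : coords (symMatrix y) = y := by
  funext i
  fin_cases i <;> rfl

theorem symMatrix_coords {M : Matrix (Fin 3) (Fin 3) F} (hM : Mᵀ = M) :
    symMatrix (coords M) = M := by
  have h : ∀ i j, M i j = M j i := fun i j => congrFun (congrFun hM j) i
  ext i j
  fin_cases i <;> fin_cases j <;> simp [symMatrix, coords, h 1 0, h 2 0, h 2 1]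

theorem symMatrix_transpose (y : Fin 6 → F) : (symMatrix y)ᵀ = symMatrix y := by
  ext i j
  fin_cases i <;> fin_cases j <;> rfl

/-- The linear map of `F ^ 6` which is `M ↦ A M Aᵀ` on symmetric matrices. -/
def veroneseLin (A : Matrix (Fin 3) (Fin 3) F) : (Fin 6 → F) →ₗ[F] (Fin 6 → F) where
  toFun y := coords (A * symMatrix y * Aᵀ)
  map_add' y z := by
    have : symMatrix (y + z) = symMatrix y + symMatrix z := by
      ext i j
      fin_cases i <;> fin_cases j <;> rfl
    rw [this, Matrix.mul_add, Matrix.add_mul]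
    funext i
    fin_cases i <;> rfl
  map_smul' c y := by
    have : symMatrix (c • y) = c • symMatrix y := by
      ext i j
      fin_cases i <;> fin_cases j <;> rfl
    rw [this, Matrix.mul_smul, Matrix.smul_mul]
    funext i
    fin_cases i <;> rfl

theorem symMatrix_veroneseLin (A : Matrix (Fin 3) (Fin 3) F) (y : Fin 6 → F) :
    symMatrix (veroneseLin A y) = A * symMatrix y * Aᵀ := by
  refine symMatrix_coords ?_
  rw [Matrix.transpose_mul, Matrix.transpose_mul, Matrix.transpose_transpose,
    symMatrix_transpose, Matrix.mul_assoc]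

/-- The matrix of `veroneseLin A`, as a monoid homomorphism. -/
def veroneseMatrix : Matrix (Fin 3) (Fin 3) F →* Matrix (Fin 6) (Fin 6) F where
  toFun A := LinearMap.toMatrix' (veroneseLin A)
  map_one' := by
    have : veroneseLin (1 : Matrix (Fin 3) (Fin 3) F) = LinearMap.id := by
      refine LinearMap.ext fun y => ?_
      change coords (1 * symMatrix y * 1ᵀ) = y
      rw [Matrix.transpose_one, Matrix.one_mul, Matrix.mul_one, coords_symMatrix]
    rw [this, LinearMap.toMatrix'_id]
  map_mul' A B := by
    have : veroneseLin (A * B) = veroneseLin A ∘ₗ veroneseLin B := by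
      refine LinearMap.ext fun y => ?_
      change coords (A * B * symMatrix y * (A * B)ᵀ) =
        coords (A * symMatrix (veroneseLin B y) * Aᵀ)
      rw [symMatrix_veroneseLin, Matrix.transpose_mul]
      simp only [Matrix.mul_assoc]
    rw [this, LinearMap.toMatrix'_comp]

theorem veroneseMatrix_mulVec (A : Matrix (Fin 3) (Fin 3) F) (y : Fin 6 → F) :
    veroneseMatrix A *ᵥ y = veroneseLin A y :=
  LinearMap.toMatrix'_mulVec _ _

/-- The lift `PGL(3, F) → PGL(6, F)` through the Veronese map: the class of `A` goes to the
projectivity which sends the point with matrix `M` to the point with matrix `A M Aᵀ`. -/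
def veroneseLift (F : Type*) [Field F] : PGL 3 F →* PGL 6 F :=
  QuotientGroup.map _ _ (Units.map (veroneseMatrix (F := F))) (by
    intro A hA
    obtain ⟨c, hc⟩ := Matrix.GeneralLinearGroup.mem_center_iff_val_mem_range_scalar.mp hA
    refine Matrix.GeneralLinearGroup.mem_center_iff_val_mem_range_scalar.mpr ⟨c ^ 2, ?_⟩
    rw [Units.coe_map, ← hc]
    refine Matrix.toLin'.injective (LinearMap.ext fun y => ?_)
    rw [Matrix.toLin'_apply, Matrix.toLin'_apply]
    refine Eq.trans ?_ (veroneseMatrix_mulVec _ y).symm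
    rw [← coords_symMatrix (veroneseLin _ y), symMatrix_veroneseLin]
    funext i
    fin_cases i <;>
      simp [coords, symMatrix, Matrix.mulVec_diagonal, Matrix.diagonal_transpose,
        Matrix.diagonal_mul, Matrix.mul_diagonal] <;> ring)

/-- The group `K ≤ PGL(6, F)`, the image of `PGL(3, F)` under the lift. -/
def veroneseGroup (F : Type*) [Field F] : Subgroup (PGL 6 F) :=
  (veroneseLift F).range

end Veronese

/-! ### The correspondence between pencils and solids -/

section Correspondence

variable {F : Type*} [Field F]

/-- The coefficients `(a₀₀, a₀₁, a₀₂, a₁₁, a₁₂, a₂₂)` of a quadratic form `∑ aᵢⱼ Xᵢ Xⱼ`. -/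
def conicCoeffs : MvPolynomial (Fin 3) F →ₗ[F] (Fin 6 → F) :=
  LinearMap.pi fun k => lcoeff F
    ((![Finsupp.single 0 1 + Finsupp.single 0 1, Finsupp.single 0 1 + Finsupp.single 1 1,
        Finsupp.single 0 1 + Finsupp.single 2 1, Finsupp.single 1 1 + Finsupp.single 1 1,
        Finsupp.single 1 1 + Finsupp.single 2 1, Finsupp.single 2 1 + Finsupp.single 2 1] :
      Fin 6 → (Fin 3 →₀ ℕ)) k)

theorem conicCoeffs_eq_zero {f : MvPolynomial (Fin 3) F} (hf : f.IsHomogeneous 2)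
    (h : conicCoeffs f = 0) : f = 0 := by
  ext d
  rw [coeff_zero]
  by_contra hd
  have hdeg : d 0 + d 1 + d 2 = 2 := by
    have := hf hd
    rw [show Finsupp.weight (1 : Fin 3 → ℕ) d = Finsupp.degree d from
      (DFunLike.congr_fun (Finsupp.degree_eq_weight_one (R := ℕ)) d).symm,
      Finsupp.degree_eq_sum, Fin.sum_univ_three] at this
    exact this
  have key : ∀ k : Fin 6, ∀ e : Fin 3 →₀ ℕ,
      conicCoeffs f k = coeff e f → d 0 = e 0 → d 1 = e 1 → d 2 = e 2 → False := by
    intro k e hk h0 h1 h2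
    apply hd
    have : d = e := by
      ext i
      fin_cases i
      · exact h0
      · exact h1
      · exact h2
    rw [this, ← hk, h]
    rfl
  have k0 := key 0 _ rfl
  have k1 := key 1 _ rfl
  have k2 := key 2 _ rfl
  have k3 := key 3 _ rfl
  have k4 := key 4 _ rfl
  have k5 := key 5 _ rfl
  simp at k0 k1 k2 k3 k4 k5
  omega

/-- The map `δ`: the conic with coefficients `aᵢⱼ` corresponds to the hyperplane
`a₀₀ Y₀ + a₀₁ Y₁ + a₀₂ Y₂ + a₁₁ Y₃ + a₁₂ Y₄ + a₂₂ Y₅ = 0`, and a linear system to the intersection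
of the hyperplanes of its conics. -/
def hyperplaneInter (P : Submodule F (MvPolynomial (Fin 3) F)) : Submodule F (Fin 6 → F) where
  carrier := {y | ∀ f ∈ P, conicCoeffs f ⬝ᵥ y = 0}
  add_mem' := fun {y z} hy hz f hf => by rw [dotProduct_add, hy f hf, hz f hf, add_zero]
  zero_mem' := fun f _ => dotProduct_zero _
  smul_mem' := fun c y hy f hf => by rw [dotProduct_smul, hy f hf, smul_zero]

/-- The solid `δ(P)` of a pencil `P`. -/
def Pencil.toSolid (P : Pencil F) : Solid F :=
  ⟨hyperplaneInter P.1, by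
    have hinj : Function.Injective (conicCoeffs.domRestrict P.1) := by
      refine (injective_iff_map_eq_zero _).mpr fun f hf => ?_
      exact Subtype.ext (conicCoeffs_eq_zero (P.2.1 f.2) hf)
    have h2 : Module.finrank F (LinearMap.range (conicCoeffs.domRestrict P.1)) = 2 := by
      rw [LinearMap.finrank_range_of_inj hinj, P.2.2]
    set W : Subspace F (Module.Dual F (Fin 6 → F)) :=
      (LinearMap.range (conicCoeffs.domRestrict P.1)).map
        (dotProductEquiv F (Fin 6)).toLinearMap with hW
    have h2' : Module.finrank F W = 2 := by
      rw [hW, LinearEquiv.finrank_map_eq, h2]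
    have h6 := Subspace.finrank_add_finrank_dualCoannihilator_eq W
    rw [h2', Module.finrank_fin_fun] at h6
    have heq : W.dualCoannihilator = hyperplaneInter P.1 := by
      ext y
      rw [Submodule.mem_dualCoannihilator]
      constructor
      · intro h f hf
        exact h _ ⟨conicCoeffs f, ⟨⟨f, hf⟩, rfl⟩, rfl⟩
      · rintro h _ ⟨_, ⟨f, rfl⟩, rfl⟩
        exact h f.1 f.2
    rw [← heq]
    omega⟩

end Correspondence

/-! ### The representatives -/

/-- The absolute trace from a finite field of characteristic `2` to its prime field. -/
def absTrace {F : Type*} [Field F] [CharP F 2] (x : F) : ZMod 2 :=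
  letI := ZMod.algebra F 2
  Algebra.trace (ZMod 2) F x

/-- Admissible choices of the field elements that occur in the representatives. The element `γ`
may be chosen separately for each of the five orbits that involve it. -/
structure Parameters (F : Type*) [Field F] [CharP F 2] where
  γ₇ : F
  γ₁₀ : F
  γ₁₂ : F
  γ₁₃ : F
  γ₁₄ : F
  b : F
  c : F
  trace_γ₇ : absTrace γ₇⁻¹ = 1
  trace_γ₁₀ : absTrace γ₁₀⁻¹ = 1
  trace_γ₁₂ : absTrace γ₁₂⁻¹ = 1
  trace_γ₁₃ : absTrace γ₁₃ = 1
  trace_γ₁₄ : absTrace γ₁₄ = 1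
  b_ne_zero : b ≠ 0
  irreducible_cubic : Irreducible
    (Polynomial.C b * Polynomial.X ^ 3 + Polynomial.C c * Polynomial.X + 1 : Polynomial F)

section Representatives

variable {F : Type*} [Field F] [CharP F 2]

/-- The pairs of conics that generate the representatives; index `i` stands for `Ω_{i+1}`. -/
def generatingConics (p : Parameters F) :
    Fin 15 → MvPolynomial (Fin 3) F × MvPolynomial (Fin 3) F :=
  ![((X 1 + X 2) ^ 2, X 1 * X 2),
    (X 2 ^ 2, X 1 * X 2),
    (X 1 ^ 2, X 2 ^ 2),
    (X 0 * X 1, X 1 * X 2),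
    (X 0 * X 1 + X 2 ^ 2, X 0 ^ 2),
    (X 0 * X 1 + X 2 ^ 2, X 2 ^ 2),
    (X 0 * X 1 + X 2 ^ 2, (X 0 + X 1 + C p.γ₇ * X 2) ^ 2),
    (X 0 * X 1 + X 2 ^ 2, (X 0 + X 2) * (X 1 + X 2)),
    (X 0 * (X 0 + X 1), X 2 * (X 1 + X 2)),
    (X 0 * X 1 + X 2 ^ 2, X 1 * (X 0 + X 1 + C p.γ₁₀ * X 2)),
    (X 0 * X 1 + X 2 ^ 2, X 1 * X 2),
    (X 0 * X 1 + X 2 ^ 2, X 2 * (X 0 + X 1 + C p.γ₁₂ * X 2)),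
    (C p.γ₁₃ * X 0 ^ 2 + X 0 * X 1 + X 1 ^ 2, C p.γ₁₃ * X 0 ^ 2 + X 0 * X 2 + X 2 ^ 2),
    (X 1 ^ 2 + X 0 * X 2 + C p.γ₁₄ * X 2 ^ 2, C p.γ₁₄ * X 0 ^ 2 + X 0 * X 1 + X 1 ^ 2),
    (X 0 * X 1 + X 2 ^ 2, X 0 * X 2 + C p.b * X 1 ^ 2 + C p.c * X 2 ^ 2)]

/-- The symmetric matrices that represent the solids; index `i` stands for `Ω_{i+1}`. -/
def solidMatrix (p : Parameters F) (i : Fin 15) (x y z t : F) : Matrix (Fin 3) (Fin 3) F :=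
  (![!![x, y, z; y, t, 0; z, 0, t],
     !![x, y, z; y, t, 0; z, 0, 0],
     !![x, y, z; y, 0, t; z, t, 0],
     !![x, 0, y; 0, z, 0; y, 0, t],
     !![0, x, y; x, z, t; y, t, x],
     !![x, 0, y; 0, z, t; y, t, 0],
     !![x, y, z; y, x + p.γ₇ * y, t; z, t, y],
     !![x, y, z; y, t, z; z, z, y],
     !![x, x, y; x, z, t; y, t, t],
     !![x, y, z; y, y + p.γ₁₀ * t, t; z, t, y],
     !![x, y, z; y, t, 0; z, 0, y],
     !![x, y, z; y, t, p.γ₁₂ * y + z; z, p.γ₁₂ * y + z, y],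
     !![x, y, z; y, p.γ₁₃ * x + y, t; z, t, p.γ₁₃ * x + z],
     !![x, y, p.γ₁₄ * x + y + p.γ₁₄ * t; y, p.γ₁₄ * x + y, z;
        p.γ₁₄ * x + y + p.γ₁₄ * t, z, t],
     !![x, y, p.b * z + p.c * y; y, z, t; p.b * z + p.c * y, t, y]] :
    Fin 15 → Matrix (Fin 3) (Fin 3) F) i

theorem generatingConics_homogeneous (p : Parameters F) (i : Fin 15) :
    (generatingConics p i).1.IsHomogeneous 2 ∧ (generatingConics p i).2.IsHomogeneous 2 := by
  have hX : ∀ j : Fin 3, (X j : MvPolynomial (Fin 3) F).IsHomogeneous 1 := isHomogeneous_X F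
  have hC : ∀ (c : F) (j : Fin 3), (C c * X j : MvPolynomial (Fin 3) F).IsHomogeneous 1 :=
    fun c j => by simpa using (isHomogeneous_C (Fin 3) c).mul (hX j)
  have hS : ∀ f : MvPolynomial (Fin 3) F, f.IsHomogeneous 1 → (f ^ 2).IsHomogeneous 2 :=
    fun f hf => by simpa using hf.pow 2
  have hCS : ∀ (c : F) (j : Fin 3), (C c * X j ^ 2 : MvPolynomial (Fin 3) F).IsHomogeneous 2 :=
    fun c j => by simpa using (isHomogeneous_C (Fin 3) c).mul (hS _ (hX j))
  have hM : ∀ f g : MvPolynomial (Fin 3) F, f.IsHomogeneous 1 → g.IsHomogeneous 1 →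
      (f * g).IsHomogeneous 2 := fun f g hf hg => hf.mul hg
  fin_cases i <;> constructor <;>
    dsimp [generatingConics] <;>
    repeat' first
      | with_reducible exact hX _
      | with_reducible exact hC _ _
      | with_reducible exact hCS _ _
      | with_reducible apply IsHomogeneous.add
      | with_reducible apply hS
      | with_reducible apply hM

theorem generatingConics_independent (p : Parameters F) (i : Fin 15) (s t : F)
    (h : s • (generatingConics p i).1 + t • (generatingConics p i).2 = 0) : s = 0 ∧ t = 0 := by
  have e : ∀ v : Fin 3 → F, s * eval v (generatingConics p i).1 +
      t * eval v (generatingConics p i).2 = 0 := fun v => by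
    simpa only [map_add, smul_eval, map_zero] using congrArg (eval v) h
  have e1 := e ![1, 0, 0]
  have e2 := e ![0, 1, 0]
  have e3 := e ![0, 0, 1]
  have e4 := e ![1, 1, 0]
  have e5 := e ![1, 0, 1]
  have e6 := e ![0, 1, 1]
  fin_cases i <;> simp [generatingConics] at e1 e2 e3 e4 e5 e6 <;> grind

/-- The pencil generated by the two listed conics. -/
def pencilRep (p : Parameters F) (i : Fin 15) : Pencil F :=
  ⟨Submodule.span F {(generatingConics p i).1, (generatingConics p i).2}, by
    rw [Submodule.span_le]
    rintro f (rfl | rfl)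
    · exact (generatingConics_homogeneous p i).1
    · exact (generatingConics_homogeneous p i).2, by
    have hli : LinearIndependent F ![(generatingConics p i).1, (generatingConics p i).2] :=
      LinearIndependent.pair_iff.mpr (generatingConics_independent p i)
    have := finrank_span_eq_card hli
    rwa [Matrix.range_cons, Matrix.range_cons, Matrix.range_empty, Set.union_empty,
      Set.singleton_union, Fintype.card_fin] at this⟩

set_option maxHeartbeats 2000000 in
/-- The parametrization of the listed solid. -/
def solidParam (p : Parameters F) (i : Fin 15) : (Fin 4 → F) →ₗ[F] (Fin 6 → F) where
  toFun w := coords (solidMatrix p i (w 0) (w 1) (w 2) (w 3))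
  map_add' v w := by
    fin_cases i <;> simp [solidMatrix, coords] <;> grind
  map_smul' c w := by
    fin_cases i <;> simp [solidMatrix, coords] <;> grind

theorem solidMatrix_transpose (p : Parameters F) (i : Fin 15) (x y z t : F) :
    (solidMatrix p i x y z t)ᵀ = solidMatrix p i x y z t := by
  ext j k
  fin_cases i <;> fin_cases j <;> fin_cases k <;> rfl

theorem solidParam_injective (p : Parameters F) (i : Fin 15) :
    Function.Injective (solidParam p i) := by
  refine (injective_iff_map_eq_zero _).mpr fun w hw => ?_
  have h : ∀ k, coords (solidMatrix p i (w 0) (w 1) (w 2) (w 3)) k = 0 := fun k => congrFun hw k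
  have h0 := h 0
  have h1 := h 1
  have h2 := h 2
  have h3 := h 3
  have h4 := h 4
  have h5 := h 5
  have : w 0 = 0 ∧ w 1 = 0 ∧ w 2 = 0 ∧ w 3 = 0 := by
    clear h hw
    fin_cases i <;> simp [solidMatrix, coords] at h0 h1 h2 h3 h4 h5 <;> grind
  funext k
  fin_cases k
  · exact this.1
  · exact this.2.1
  · exact this.2.2.1
  · exact this.2.2.2

/-- The subspace of the points whose symmetric matrix has the listed shape. -/
def solidSubmodule (p : Parameters F) (i : Fin 15) : Submodule F (Fin 6 → F) :=
  (LinearMap.range (solidParam p i)).copy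
    {v | ∃ x y z t : F, symMatrix v = solidMatrix p i x y z t} (by
      ext v
      constructor
      · rintro ⟨x, y, z, t, h⟩
        refine ⟨![x, y, z, t], ?_⟩
        change coords (solidMatrix p i x y z t) = v
        rw [← h, coords_symMatrix]
      · rintro ⟨w, rfl⟩
        exact ⟨w 0, w 1, w 2, w 3, symMatrix_coords (solidMatrix_transpose p i _ _ _ _)⟩)

/-- The solid of the points whose symmetric matrix has the listed shape. -/
def solidRep (p : Parameters F) (i : Fin 15) : Solid F :=
  ⟨solidSubmodule p i, by
    rw [solidSubmodule, Submodule.copy_eq,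
      LinearMap.finrank_range_of_inj (solidParam_injective p i), Module.finrank_fin_fun]⟩

end Representatives

end

set_option linter.unusedSectionVars false

noncomputable section

/-! The proof is a count made of two independent halves. Every pencil is brought to one of fifteen
normal forms (`normalPair`, `hasNormalForm_quad`), and the fifteen listed pencils are told apart by
invariants (`orbitIndex_pencilRep`). Sending a listed pencil to a normal form equivalent to it is
therefore an injection of a fifteen-element set into another, hence a bijection, and every normal
form is equivalent to a listed pencil (`existsUnique_pencilRep`). No normal form is ever matched
explicitly with a representative, and the inequivalence of the normal forms is not proved
separately.

Normal forms. In characteristic two, the off-diagonal coefficients of a quadratic form f make up its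
nucleus n, which depends linearly on f and satisfies f(v + w) = f(v) + f(w) + det(n, v, w). If the
nuclei of two generators are dependent, the pencil contains the square of a linear form; the
position of the other nucleus relative to that double line leads to six normal forms.

If the nuclei are independent, they serve as the first two basis vectors, and the generators become
f = yz + ax² + cy² + uz² and g = xz + bx² + dy² + vz². The value of sf + tg at its nucleus (s, t, 0)
is the binary cubic as³ + bs²t + cst² + dt³, whose zeros are the singular conics of the pencil.
Changes of basis in the plane of nuclei bring the cubic to one of six shapes: zero, triple root,
double root, three roots, one root, no root. That all rootless cubics are equivalent up to a scalar
is `Rootless.equiv`. Adding multiples of z to x and y then changes (u, v) by a map of Artin-Schreier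
type (`HasNormalForm.of_translate`), and 1, 1, 2, 2, 2, 1 choices of (u, v) suffice for the six
shapes: nine more normal forms.

Invariants. `orbitIndex` is a decision tree on geometric properties: double lines, base points over
F, members singular at a base point, and the presence of two singular conics.

Solids. The map δ is annihilator duality between planes of quadratic forms and four-dimensional
subspaces (`toSolid_bijective`), and it is equivariant (`toSolid_smul`), so the classification of
pencils carries over. -/

namespace ConicPencil

/-! ### Artin-Schreier classes, square roots and the absolute trace. -/

section ArtinSchreier

variable {F : Type*} [Field F] [Finite F] [CharP F 2]

/-- The additive map `a ↦ a + a ^ 2` in characteristic two. -/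
def artinSchreier (F : Type*) [Field F] [CharP F 2] : F →+ F where
  toFun a := a + a ^ 2
  map_zero' := by simp
  map_add' a b := by grind

/-- For an endomorphism of a finite group the index of the image is the order of the kernel, and
here the kernel consists of 0 and 1. -/
theorem artinSchreier_index : (artinSchreier F).range.index = 2 := by
  rw [AddSubgroup.index_range]
  have : ((artinSchreier F).ker : Set F) = {0, 1} := by
    ext a
    change a + a ^ 2 = 0 ↔ a = 0 ∨ a = 1
    constructor <;> grind
  rw [← SetLike.coe_sort_coe, this, Nat.card_coe_set_eq, Set.ncard_pair zero_ne_one]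

theorem exists_artinSchreier_ne (F : Type*) [Field F] [Finite F] [CharP F 2] :
    ∃ δ : F, ∀ a, a + a ^ 2 ≠ δ := by
  by_contra! h
  have : (artinSchreier F).range = ⊤ := by
    rw [eq_top_iff]
    intro x _
    exact h x
  have h2 := artinSchreier_index (F := F)
  rw [this, AddSubgroup.index_top] at h2
  omega

/-- The image has index two, so two elements outside it have their sum inside it. -/
theorem exists_artinSchreier {δ : F} (hδ : ∀ a, a + a ^ 2 ≠ δ) (c : F) :
    ∃ a, c = a + a ^ 2 ∨ c = δ + (a + a ^ 2) := by
  by_cases hc : c ∈ (artinSchreier F).range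
  · obtain ⟨a, ha⟩ := hc
    exact ⟨a, Or.inl ha.symm⟩
  · have h1 : δ ∉ (artinSchreier F).range := fun ⟨a, ha⟩ => hδ a ha
    have := (AddSubgroup.add_mem_iff_of_index_two (artinSchreier_index (F := F))
      (a := c) (b := δ)).mpr (by tauto)
    obtain ⟨a, ha⟩ := this
    refine ⟨a, Or.inr ?_⟩
    change a + a ^ 2 = c + δ at ha
    grind

theorem exists_sq_eq (c : F) : ∃ a, a ^ 2 = c := by
  have hinj : Function.Injective (fun a : F => a ^ 2) := by
    intro a b h
    have : (a - b) ^ 2 = 0 := by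
      simp only at h
      grind
    exact sub_eq_zero.mp (pow_eq_zero_iff two_ne_zero |>.mp this)
  exact Finite.surjective_of_injective hinj c

theorem absTrace_sq (x : F) : absTrace (x ^ 2) = absTrace x := by
  let := ZMod.algebra F 2
  have := Algebra.trace_eq_of_algEquiv (FiniteField.frobeniusAlgEquiv (ZMod 2) F 2) x
  unfold absTrace
  rw [← this]
  rfl

theorem absTrace_add (x y : F) : absTrace (x + y) = absTrace x + absTrace y := by
  unfold absTrace
  exact map_add _ _ _

/-- The trace is invariant under squaring, so it vanishes on a + a². Only this easy half of the
additive Hilbert 90 theorem is used. -/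
theorem add_sq_ne_of_absTrace {γ : F} (h : absTrace γ = 1) (a : F) : a + a ^ 2 ≠ γ := by
  rintro rfl
  rw [absTrace_add, absTrace_sq, CharTwo.add_self_eq_zero] at h
  exact zero_ne_one h

theorem exists_absTrace_eq_one (F : Type*) [Field F] [Finite F] [CharP F 2] :
    ∃ γ : F, absTrace γ = 1 := by
  let := ZMod.algebra F 2
  exact Algebra.trace_surjective (ZMod 2) F 1

end ArtinSchreier

/-! ### Binary cubic forms without zeros over a finite field. -/

section Cubic

variable {F : Type*} [Field F]

/-- The binary cubic form with the given coefficients has no nontrivial zero. -/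
def Rootless (k₀ k₁ k₂ k₃ : F) : Prop :=
  ∀ s t, k₀ * s ^ 3 + k₁ * s ^ 2 * t + k₂ * s * t ^ 2 + k₃ * t ^ 3 = 0 → s = 0 ∧ t = 0

/-- The dehomogenization of a binary cubic form. -/
def cubicPoly (k₀ k₁ k₂ k₃ : F) : Polynomial F :=
  Polynomial.C k₀ * Polynomial.X ^ 3 + Polynomial.C k₁ * Polynomial.X ^ 2 +
    Polynomial.C k₂ * Polynomial.X + Polynomial.C k₃

theorem Rootless.leading_ne_zero {k₀ k₁ k₂ k₃ : F} (h : Rootless k₀ k₁ k₂ k₃) : k₀ ≠ 0 := by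
  rintro rfl
  exact one_ne_zero (h 1 0 (by simp)).1

theorem Rootless.natDegree {k₀ k₁ k₂ k₃ : F} (h : Rootless k₀ k₁ k₂ k₃) :
    (cubicPoly k₀ k₁ k₂ k₃).natDegree = 3 :=
  Polynomial.natDegree_cubic h.leading_ne_zero

theorem Rootless.irreducible {k₀ k₁ k₂ k₃ : F} (h : Rootless k₀ k₁ k₂ k₃) :
    Irreducible (cubicPoly k₀ k₁ k₂ k₃) := by
  rw [Polynomial.irreducible_iff_roots_eq_zero_of_degree_le_three (by rw [h.natDegree]; norm_num)
    h.natDegree.le, Multiset.eq_zero_iff_forall_notMem]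
  intro x hx
  have := Polynomial.isRoot_of_mem_roots hx
  simp only [cubicPoly, Polynomial.IsRoot, Polynomial.eval_add, Polynomial.eval_mul,
    Polynomial.eval_C, Polynomial.eval_pow, Polynomial.eval_X] at this
  exact one_ne_zero (h x 1 (by simpa using this)).2

theorem rootless_of_irreducible {k₀ k₁ k₂ k₃ : F} (h₀ : k₀ ≠ 0)
    (h : Irreducible (cubicPoly k₀ k₁ k₂ k₃)) : Rootless k₀ k₁ k₂ k₃ := by
  have hd : (cubicPoly k₀ k₁ k₂ k₃).natDegree = 3 := Polynomial.natDegree_cubic h₀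
  rw [Polynomial.irreducible_iff_roots_eq_zero_of_degree_le_three (by rw [hd]; norm_num)
    hd.le, Multiset.eq_zero_iff_forall_notMem] at h
  have hne : cubicPoly k₀ k₁ k₂ k₃ ≠ 0 := by
    intro h0
    rw [h0, Polynomial.natDegree_zero] at hd
    omega
  intro s t hst
  by_cases ht : t = 0
  · subst ht
    simp [h₀] at hst
    exact ⟨hst, rfl⟩
  · refine absurd ((Polynomial.mem_roots hne).mpr ?_) (h (s / t))
    simp only [cubicPoly, Polynomial.IsRoot, Polynomial.eval_add, Polynomial.eval_mul,
      Polynomial.eval_C, Polynomial.eval_pow, Polynomial.eval_X]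
    field_simp
    linear_combination hst

/-- Finite extensions of F of equal degree embed in one another, so the field obtained by adjoining
a root of one irreducible cubic also contains a root of the other. -/
theorem Rootless.exists_field.{u} {F : Type u} [Field F] [Finite F] {k₀ k₁ k₂ k₃ p₀ p₁ p₂ p₃ : F}
    (hk : Rootless k₀ k₁ k₂ k₃) (hp : Rootless p₀ p₁ p₂ p₃) :
    ∃ (K : Type u) (_ : Field K) (_ : Algebra F K) (θ η : K), Module.Finite F K ∧
      Module.finrank F K = 3 ∧
      (∀ f : Polynomial F, Polynomial.aeval θ f = 0 → cubicPoly p₀ p₁ p₂ p₃ ∣ f) ∧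
      Polynomial.aeval θ (cubicPoly p₀ p₁ p₂ p₃) = 0 ∧
      Polynomial.aeval η (cubicPoly k₀ k₁ k₂ k₃) = 0 := by
  have := Fact.mk hp.irreducible
  have := Fact.mk hk.irreducible
  have pne := hp.irreducible.ne_zero
  have kne := hk.irreducible.ne_zero
  have hK : Module.finrank F (AdjoinRoot (cubicPoly p₀ p₁ p₂ p₃)) = 3 := by
    rw [(AdjoinRoot.powerBasis pne).finrank, AdjoinRoot.powerBasis_dim, hp.natDegree]
  have hK' : Module.finrank F (AdjoinRoot (cubicPoly k₀ k₁ k₂ k₃)) = 3 := by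
    rw [(AdjoinRoot.powerBasis kne).finrank, AdjoinRoot.powerBasis_dim, hk.natDegree]
  have := (AdjoinRoot.powerBasis pne).finite
  have : Finite (AdjoinRoot (cubicPoly p₀ p₁ p₂ p₃)) := Module.finite_of_finite F
  obtain ⟨φ⟩ := FiniteField.nonempty_algHom_of_finrank_dvd (F := F)
    (K := AdjoinRoot (cubicPoly k₀ k₁ k₂ k₃)) (L := AdjoinRoot (cubicPoly p₀ p₁ p₂ p₃))
    (by rw [hK, hK'])
  refine ⟨AdjoinRoot (cubicPoly p₀ p₁ p₂ p₃), AdjoinRoot.instField, AdjoinRoot.instAlgebra _,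
    AdjoinRoot.root _, φ (AdjoinRoot.root _), ‹_›, hK, ?_, ?_, ?_⟩
  · intro f hf
    rwa [AdjoinRoot.aeval_eq, AdjoinRoot.mk_eq_zero] at hf
  · rw [AdjoinRoot.aeval_eq, AdjoinRoot.mk_self]
  · rw [Polynomial.aeval_algHom_apply, AdjoinRoot.aeval_eq, AdjoinRoot.mk_self, map_zero]

/-- Two binary cubic forms without zeros over a finite field are equivalent up to a scalar. -/
theorem Rootless.equiv [Finite F] {k₀ k₁ k₂ k₃ p₀ p₁ p₂ p₃ : F} (hk : Rootless k₀ k₁ k₂ k₃)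
    (hp : Rootless p₀ p₁ p₂ p₃) : ∃ a b c d μ : F, a * d - b * c ≠ 0 ∧ μ ≠ 0 ∧
      μ * p₀ = k₀ * a ^ 3 + k₁ * a ^ 2 * c + k₂ * a * c ^ 2 + k₃ * c ^ 3 ∧
      μ * p₁ = 3 * k₀ * a ^ 2 * b + k₁ * (a ^ 2 * d + 2 * a * b * c) +
        k₂ * (b * c ^ 2 + 2 * a * c * d) + 3 * k₃ * c ^ 2 * d ∧
      μ * p₂ = 3 * k₀ * a * b ^ 2 + k₁ * (b ^ 2 * c + 2 * a * b * d) +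
        k₂ * (a * d ^ 2 + 2 * b * c * d) + 3 * k₃ * c * d ^ 2 ∧
      μ * p₃ = k₀ * b ^ 3 + k₁ * b ^ 2 * d + k₂ * b * d ^ 2 + k₃ * d ^ 3 := by
  obtain ⟨K, _, _, θ, η, _, hK, hmin, hθp, hηk⟩ := hk.exists_field hp
  simp only [cubicPoly, map_add, map_mul, map_pow, Polynomial.aeval_C, Polynomial.aeval_X]
    at hθp hηk
  have hquad : ∀ x y z : F,
      algebraMap F K x * θ ^ 2 + algebraMap F K y * θ + algebraMap F K z = 0 →
      x = 0 ∧ y = 0 ∧ z = 0 := by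
    intro x y z h
    have h0 := hmin
      (Polynomial.C x * Polynomial.X ^ 2 + Polynomial.C y * Polynomial.X + Polynomial.C z)
      (by simpa using h)
    have h1 := Polynomial.eq_zero_of_dvd_of_natDegree_lt h0 (by
      rw [hp.natDegree]
      exact lt_of_le_of_lt Polynomial.natDegree_quadratic_le (by norm_num))
    refine ⟨?_, ?_, ?_⟩
    · simpa [Polynomial.coeff_X, Polynomial.coeff_C]
        using congrArg (fun f => Polynomial.coeff f 2) h1
    · simpa [Polynomial.coeff_X, Polynomial.coeff_C]
        using congrArg (fun f => Polynomial.coeff f 1) h1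
    · simpa [Polynomial.coeff_X, Polynomial.coeff_C]
        using congrArg (fun f => Polynomial.coeff f 0) h1
  have hηF : ∀ x : F, η ≠ algebraMap F K x := by
    intro x hx
    rw [hx] at hηk
    have : k₀ * x ^ 3 + k₁ * x ^ 2 + k₂ * x + k₃ = 0 := by
      apply (algebraMap F K).injective
      simpa using hηk
    exact one_ne_zero (hk x 1 (by linear_combination this)).2
  have hθ0 : ∀ x y : F, algebraMap F K x * θ + algebraMap F K y = 0 → x = 0 ∧ y = 0 := by
    intro x y h
    exact (hquad 0 x y (by simpa using h)).2
  obtain ⟨a, b, c, d, hrel, hne⟩ : ∃ a b c d : F,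
      algebraMap F K a * θ + algebraMap F K b = (algebraMap F K c * θ + algebraMap F K d) * η ∧
      ¬ (a = 0 ∧ b = 0 ∧ c = 0 ∧ d = 0) := by
    -- Four elements of a three-dimensional space are dependent; this relation writes η as a
    -- fractional linear function of θ with coefficients in F.
    have hdep : ¬ LinearIndependent F ![θ, 1, θ * η, η] := by
      intro h
      have := h.fintype_card_le_finrank
      rw [hK, Fintype.card_fin] at this
      omega
    rw [Fintype.not_linearIndependent_iff] at hdep
    obtain ⟨g, hg, i, hi⟩ := hdep
    refine ⟨g 0, g 1, - g 2, - g 3, ?_, ?_⟩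
    · simp [Fin.sum_univ_four, Algebra.smul_def] at hg
      simp only [map_neg]
      linear_combination hg
    · rintro ⟨h0, h1, h2, h3⟩
      apply hi
      fin_cases i
      · exact h0
      · exact h1
      · exact neg_eq_zero.mp h2
      · exact neg_eq_zero.mp h3
  have hden : algebraMap F K c * θ + algebraMap F K d ≠ 0 := by
    intro h
    have h1 := hθ0 _ _ h
    rw [h, zero_mul] at hrel
    have h2 := hθ0 _ _ hrel
    exact hne ⟨h2.1, h2.2, h1.1, h1.2⟩
  -- A degenerate fractional linear function is constant, which would put η in F.
  have hdet : a * d - b * c ≠ 0 := by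
    intro h0
    have h0' : algebraMap F K a * algebraMap F K d = algebraMap F K b * algebraMap F K c := by
      rw [← map_mul, ← map_mul]
      congr 1
      linear_combination h0
    by_cases hc : c = 0
    · have hd : d ≠ 0 := by
        rintro rfl
        simp [hc] at hden
      have ha : a = 0 := by
        rw [hc, mul_zero, sub_zero] at h0
        exact (mul_eq_zero.mp h0).resolve_right hd
      apply hηF (b / d)
      have hd' : algebraMap F K d ≠ 0 := by simpa using hd
      rw [map_div₀]
      field_simp
      simp only [hc, ha, map_zero] at hrel
      linear_combination -hrel
    · apply hηF (a / c)
      have hc' : algebraMap F K c ≠ 0 := by simpa using hc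
      rw [map_div₀]
      field_simp
      apply mul_left_cancel₀ hden
      linear_combination - algebraMap F K c * hrel - h0'
  -- The eᵢ are the coefficients of the first cubic after the substitution (s, t) ↦ (as + bt, cs +
  -- dt). The new cubic vanishes at θ.
  set e₀ := k₀ * a ^ 3 + k₁ * a ^ 2 * c + k₂ * a * c ^ 2 + k₃ * c ^ 3 with he₀
  set e₁ := 3 * k₀ * a ^ 2 * b + k₁ * (a ^ 2 * d + 2 * a * b * c) +
        k₂ * (b * c ^ 2 + 2 * a * c * d) + 3 * k₃ * c ^ 2 * d with he₁
  set e₂ := 3 * k₀ * a * b ^ 2 + k₁ * (b ^ 2 * c + 2 * a * b * d) +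
        k₂ * (a * d ^ 2 + 2 * b * c * d) + 3 * k₃ * c * d ^ 2 with he₂
  set e₃ := k₀ * b ^ 3 + k₁ * b ^ 2 * d + k₂ * b * d ^ 2 + k₃ * d ^ 3 with he₃
  have he : algebraMap F K e₀ * θ ^ 3 + algebraMap F K e₁ * θ ^ 2 + algebraMap F K e₂ * θ +
      algebraMap F K e₃ = 0 := by
    have h1 : algebraMap F K k₀ * (algebraMap F K a * θ + algebraMap F K b) ^ 3 +
        algebraMap F K k₁ * (algebraMap F K a * θ + algebraMap F K b) ^ 2 *
          (algebraMap F K c * θ + algebraMap F K d) +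
        algebraMap F K k₂ * (algebraMap F K a * θ + algebraMap F K b) *
          (algebraMap F K c * θ + algebraMap F K d) ^ 2 +
        algebraMap F K k₃ * (algebraMap F K c * θ + algebraMap F K d) ^ 3 = 0 := by
      rw [hrel]
      linear_combination (algebraMap F K c * θ + algebraMap F K d) ^ 3 * hηk
    simp only [he₀, he₁, he₂, he₃, map_add, map_mul, map_pow, map_ofNat]
    linear_combination h1
  -- Two cubics vanish at θ. Cancelling their leading terms leaves a relation of degree at most two,
  -- which must be trivial, so the cubics are proportional.
  obtain ⟨h1, h2, h3⟩ := hquad (p₀ * e₁ - e₀ * p₁) (p₀ * e₂ - e₀ * p₂) (p₀ * e₃ - e₀ * p₃) (by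
    simp only [map_sub, map_mul]
    linear_combination algebraMap F K p₀ * he - algebraMap F K e₀ * hθp)
  have hp0 := hp.leading_ne_zero
  refine ⟨a, b, c, d, e₀ / p₀, hdet, ?_, div_mul_cancel₀ _ hp0, ?_, ?_, ?_⟩
  · refine div_ne_zero ?_ hp0
    intro h0
    have := hk a c h0
    simp [this] at hdet
  · field_simp
    linear_combination -h1
  · field_simp
    linear_combination -h2
  · field_simp
    linear_combination -h3

/-- Over every finite field of characteristic two there is an irreducible cubic without quadratic
term. -/
theorem exists_rootless_depressed (F : Type*) [Field F] [Finite F] [CharP F 2] :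
    ∃ b c : F, Rootless b 0 c 1 := by
  -- In characteristic two (X + r)(X² + rX + s) = X³ + (s + r²)X + rs, so the image of this map
  -- contains every pair (a, b) for which X³ + aX + b has a root. The cubic X(X + 1)² arises from
  -- two pairs (r, s), so the map is not injective, hence not surjective.
  let f : F × F → F × F := fun p => (p.2 + p.1 ^ 2, p.1 * p.2)
  have hninj : ¬ Function.Injective f := by
    intro h
    have : f (0, 1) = f (1, 0) := by simp [f]
    simpa using h this
  have hnsurj : ¬ Function.Surjective f := fun h => hninj (Finite.injective_iff_surjective.mpr h)
  rw [Function.Surjective] at hnsurj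
  push Not at hnsurj
  obtain ⟨⟨a, b⟩, hab⟩ := hnsurj
  have key : ∀ r : F, r ^ 3 + a * r + b ≠ 0 := by
    intro r hr
    refine hab (r, a + r ^ 2) (Prod.ext ?_ ?_)
    · simp only [f]
      grind
    · simp only [f]
      grind
  have hb : b ≠ 0 := by simpa using key 0
  refine ⟨b⁻¹, a * b⁻¹, fun s t h => ?_⟩
  have h' : s ^ 3 + a * s * t ^ 2 + b * t ^ 3 = 0 := by
    field_simp at h
    linear_combination h
  by_cases ht : t = 0
  · subst ht
    simpa using h'
  · exfalso
    apply key (s / t)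
    field_simp
    linear_combination h'

end Cubic

/-! ### Linear systems of ternary functions, equivalence and normal forms. -/

section Reduction

variable {F : Type*} [Field F]

/-- Ternary functions, acted on by linear substitution of the variables. -/
abbrev Ternary (F : Type*) : Type _ := F → F → F → F

/-- Linear substitution of the variables of a ternary function. -/
def precomp (M : Matrix (Fin 3) (Fin 3) F) : Ternary F →ₗ[F] Ternary F where
  toFun f x y z := f (M 0 0 * x + M 0 1 * y + M 0 2 * z) (M 1 0 * x + M 1 1 * y + M 1 2 * z)
    (M 2 0 * x + M 2 1 * y + M 2 2 * z)
  map_add' _ _ := rfl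
  map_smul' _ _ := rfl

theorem precomp_apply (M : Matrix (Fin 3) (Fin 3) F) (f : Ternary F) (x y z : F) :
    precomp M f x y z =
      f (M 0 0 * x + M 0 1 * y + M 0 2 * z) (M 1 0 * x + M 1 1 * y + M 1 2 * z)
        (M 2 0 * x + M 2 1 * y + M 2 2 * z) := rfl

theorem precomp_one : precomp (1 : Matrix (Fin 3) (Fin 3) F) = LinearMap.id := by
  refine LinearMap.ext fun f => ?_
  funext x y z
  simp [precomp_apply]

theorem precomp_comp (M N : Matrix (Fin 3) (Fin 3) F) :
    precomp M ∘ₗ precomp N = precomp (N * M) := by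
  refine LinearMap.ext fun f => ?_
  funext x y z
  simp only [LinearMap.comp_apply, precomp_apply, Matrix.mul_apply, Fin.sum_univ_three]
  congr 1 <;> ring

/-- Equivalence of linear systems of ternary functions under invertible linear substitutions. -/
def Equivalent (W W' : Submodule F (Ternary F)) : Prop :=
  ∃ M : GL (Fin 3) F, W' = W.map (precomp M.1)

theorem Equivalent.refl (W : Submodule F (Ternary F)) : Equivalent W W :=
  ⟨1, by rw [Units.val_one, precomp_one, Submodule.map_id]⟩

theorem Equivalent.trans {W W' W'' : Submodule F (Ternary F)} (h : Equivalent W W')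
    (h' : Equivalent W' W'') : Equivalent W W'' := by
  obtain ⟨M, rfl⟩ := h
  obtain ⟨N, rfl⟩ := h'
  exact ⟨M * N, by rw [← Submodule.map_comp, precomp_comp, Units.val_mul]⟩

theorem Equivalent.symm {W W' : Submodule F (Ternary F)} (h : Equivalent W W') :
    Equivalent W' W := by
  obtain ⟨M, rfl⟩ := h
  refine ⟨M⁻¹, ?_⟩
  rw [← Submodule.map_comp, precomp_comp, ← Units.val_mul, mul_inv_cancel, Units.val_one,
    precomp_one, Submodule.map_id]

theorem span_pair_eq_of_combination {V : Type*} [AddCommGroup V] [Module F V] {f g f' g' : V}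
    {p q r s : F} (h : p * s - q * r ≠ 0) (hf : f' = p • f + q • g) (hg : g' = r • f + s • g) :
    Submodule.span F {f', g'} = Submodule.span F {f, g} := by
  subst hf hg
  refine le_antisymm (Submodule.span_le.mpr ?_) (Submodule.span_le.mpr ?_)
  · rintro _ (rfl | rfl)
    · exact Submodule.mem_span_pair.mpr ⟨p, q, rfl⟩
    · exact Submodule.mem_span_pair.mpr ⟨r, s, rfl⟩
  · obtain ⟨e, he⟩ : ∃ e, (p * s - q * r) * e = 1 := ⟨_, mul_inv_cancel₀ h⟩
    rintro _ (rfl | rfl)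
    · refine Submodule.mem_span_pair.mpr ⟨s * e, -q * e, ?_⟩
      match_scalars
      · linear_combination he
      · ring
    · refine Submodule.mem_span_pair.mpr ⟨-r * e, p * e, ?_⟩
      match_scalars
      · ring
      · linear_combination he

/-- The quadratic form with off-diagonal coefficients `n₀, n₁, n₂` and diagonal coefficients
`d₀, d₁, d₂`; in characteristic two `(n₀, n₁, n₂)` is the nucleus. -/
def quad (n₀ n₁ n₂ d₀ d₁ d₂ : F) : Ternary F := fun x y z =>
  n₀ * y * z + n₁ * x * z + n₂ * x * y + d₀ * x ^ 2 + d₁ * y ^ 2 + d₂ * z ^ 2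

/-- Normal forms for pencils of conics in even characteristic, depending on an element `δ` outside
the image of the Artin-Schreier map and on a binary cubic without zeros. -/
def normalPair (δ k₀ k₁ k₂ k₃ : F) : Fin 15 → Ternary F × Ternary F :=
  ![(fun _ y _ => y ^ 2, fun _ _ z => z ^ 2),
    (fun x y _ => x * y, fun _ _ z => z ^ 2),
    (fun x y _ => x ^ 2 + x * y + δ * y ^ 2, fun _ _ z => z ^ 2),
    (fun x y z => y * z + x ^ 2, fun _ _ z => z ^ 2),
    (fun _ y z => y * z, fun _ _ z => z ^ 2),
    (fun _ y z => y * z + y ^ 2, fun _ _ z => z ^ 2),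
    (quad 1 0 0 0 0 0, quad 0 1 0 0 0 0),
    (quad 1 0 0 1 0 0, quad 0 1 0 0 0 0),
    (quad 1 0 0 0 0 0, quad 0 1 0 1 0 0),
    (quad 1 0 0 0 0 0, quad 0 1 0 1 0 δ),
    (quad 1 0 0 0 1 0, quad 0 1 0 1 0 0),
    (quad 1 0 0 0 1 δ, quad 0 1 0 1 0 δ),
    (quad 1 0 0 δ 1 0, quad 0 1 0 1 0 0),
    (quad 1 0 0 δ 1 0, quad 0 1 0 1 0 δ),
    (quad 1 0 0 k₀ k₂ 0, quad 0 1 0 k₁ k₃ 0)]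

/-- The pencil spanned by `f` and `g` is equivalent to one of the normal forms. -/
def HasNormalForm (δ k₀ k₁ k₂ k₃ : F) (f g : Ternary F) : Prop :=
  ∃ j, Equivalent (Submodule.span F {f, g}) (Submodule.span F
    {(normalPair δ k₀ k₁ k₂ k₃ j).1, (normalPair δ k₀ k₁ k₂ k₃ j).2})

variable {δ k₀ k₁ k₂ k₃ : F}

theorem HasNormalForm.of_index {f g : Ternary F} (j : Fin 15)
    (hf : f = (normalPair δ k₀ k₁ k₂ k₃ j).1) (hg : g = (normalPair δ k₀ k₁ k₂ k₃ j).2) :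
    HasNormalForm δ k₀ k₁ k₂ k₃ f g :=
  ⟨j, by rw [hf, hg]; exact Equivalent.refl _⟩

/-- Reduction along a linear substitution and a change of generators. -/
theorem HasNormalForm.of_subst {f g f' g' : Ternary F} {M : Matrix (Fin 3) (Fin 3) F} {p q r s : F}
    (h : HasNormalForm δ k₀ k₁ k₂ k₃ f' g') (hM : M.det ≠ 0) (hp : p * s - q * r ≠ 0)
    (hf : ∀ x y z, f' x y z = p * precomp M f x y z + q * precomp M g x y z)
    (hg : ∀ x y z, g' x y z = r * precomp M f x y z + s * precomp M g x y z) :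
    HasNormalForm δ k₀ k₁ k₂ k₃ f g := by
  obtain ⟨j, hj⟩ := h
  refine ⟨j, Equivalent.trans ⟨Matrix.GeneralLinearGroup.mkOfDetNeZero M hM, ?_⟩ hj⟩
  rw [Submodule.map_span, Set.image_pair]
  refine span_pair_eq_of_combination hp ?_ ?_
  · funext x y z
    exact hf x y z
  · funext x y z
    exact hg x y z

theorem HasNormalForm.of_combination {f g f' g' : Ternary F} {p q r s : F}
    (h : HasNormalForm δ k₀ k₁ k₂ k₃ f' g') (hp : p * s - q * r ≠ 0)
    (hf : ∀ x y z, f' x y z = p * f x y z + q * g x y z)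
    (hg : ∀ x y z, g' x y z = r * f x y z + s * g x y z) :
    HasNormalForm δ k₀ k₁ k₂ k₃ f g :=
  h.of_subst (M := 1) (by simp) hp (by simpa [precomp_one] using hf)
    (by simpa [precomp_one] using hg)

theorem HasNormalForm.of_subst_eq {f g f' g' : Ternary F} {M : Matrix (Fin 3) (Fin 3) F}
    (h : HasNormalForm δ k₀ k₁ k₂ k₃ f' g') (hM : M.det ≠ 0)
    (hf : ∀ x y z, f' x y z = precomp M f x y z)
    (hg : ∀ x y z, g' x y z = precomp M g x y z) :
    HasNormalForm δ k₀ k₁ k₂ k₃ f g :=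
  h.of_subst (p := 1) (q := 0) (r := 0) (s := 1) hM (by simp) (by simpa using hf)
    (by simpa using hg)

/-- The substitution may be given in the opposite direction. -/
theorem HasNormalForm.of_subst_symm {f g f' g' : Ternary F} {M : Matrix (Fin 3) (Fin 3) F}
    (h : HasNormalForm δ k₀ k₁ k₂ k₃ f' g') (hM : M.det ≠ 0)
    (hf : ∀ x y z, f x y z = precomp M f' x y z)
    (hg : ∀ x y z, g x y z = precomp M g' x y z) :
    HasNormalForm δ k₀ k₁ k₂ k₃ f g := by
  obtain ⟨j, hj⟩ := h
  refine ⟨j, Equivalent.trans (Equivalent.symm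
    ⟨Matrix.GeneralLinearGroup.mkOfDetNeZero M hM, ?_⟩) hj⟩
  rw [Submodule.map_span, Set.image_pair]
  congr 2
  · funext x y z
    exact hf x y z
  · congr 1
    funext x y z
    exact hg x y z

end Reduction

/-! ### Pencils with independent nuclei: reduction through the binary cubic. -/

section NetReduction

variable {F : Type*} [Field F] [CharP F 2] {δ k₀ k₁ k₂ k₃ : F}

/-- Translation by a multiple of the third variable. -/
theorem HasNormalForm.of_translate {a b c d u v u' v' : F} (α β : F)
    (hu : u' = u + β + a * α ^ 2 + c * β ^ 2) (hv : v' = v + α + b * α ^ 2 + d * β ^ 2)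
    (h : HasNormalForm δ k₀ k₁ k₂ k₃ (quad 1 0 0 a c u') (quad 0 1 0 b d v')) :
    HasNormalForm δ k₀ k₁ k₂ k₃ (quad 1 0 0 a c u) (quad 0 1 0 b d v) := by
  subst hu hv
  refine h.of_subst_eq (M := !![1, 0, α; 0, 1, β; 0, 0, 1]) (by simp [det_fin_three]) ?_ ?_ <;>
  · intro x y z
    simp [precomp_apply, quad]
    grind

/-- The normal form only depends on the binary cubic up to equivalence and scalars. -/
theorem HasNormalForm.of_cubic {p₀ p₁ p₂ p₃ e₀ e₁ e₂ e₃ u v : F}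
    (h : ∀ u v, HasNormalForm δ k₀ k₁ k₂ k₃ (quad 1 0 0 e₀ e₂ u) (quad 0 1 0 e₁ e₃ v))
    (a b c d μ : F) (hdet : a * d - b * c ≠ 0) (hμ : μ ≠ 0)
    (h₀ : μ * e₀ = p₀ * a ^ 3 + p₁ * a ^ 2 * c + p₂ * a * c ^ 2 + p₃ * c ^ 3)
    (h₁ : μ * e₁ = 3 * p₀ * a ^ 2 * b + p₁ * (a ^ 2 * d + 2 * a * b * c) +
        p₂ * (b * c ^ 2 + 2 * a * c * d) + 3 * p₃ * c ^ 2 * d)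
    (h₂ : μ * e₂ = 3 * p₀ * a * b ^ 2 + p₁ * (b ^ 2 * c + 2 * a * b * d) +
        p₂ * (a * d ^ 2 + 2 * b * c * d) + 3 * p₃ * c * d ^ 2)
    (h₃ : μ * e₃ = p₀ * b ^ 3 + p₁ * b ^ 2 * d + p₂ * b * d ^ 2 + p₃ * d ^ 3) :
    HasNormalForm δ k₀ k₁ k₂ k₃ (quad 1 0 0 p₀ p₂ u) (quad 0 1 0 p₁ p₃ v) := by
  obtain ⟨m, hm⟩ : ∃ m, μ * m = 1 := ⟨_, mul_inv_cancel₀ hμ⟩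
  obtain ⟨D, hD⟩ : ∃ D, (a * d - b * c) * D = 1 := ⟨_, mul_inv_cancel₀ hdet⟩
  have hD0 : D ≠ 0 := right_ne_zero_of_mul_eq_one hD
  have hm0 : m ≠ 0 := right_ne_zero_of_mul_eq_one hm
  -- The generators are recombined by the same 2 × 2 matrix that moves x and y, up to transposition
  -- and the factor m = 1/μ. Scaling z by μD restores the coefficients of yz and xz to 1 and 0. The
  -- z² coefficients are not controlled here, which is why `h` is required for all of them.
  refine (h ((m * a * u + m * c * v) * (μ * D) ^ 2)
    ((m * d * v + m * b * u) * (μ * D) ^ 2)).of_subst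
    (M := !![a, b, 0; c, d, 0; 0, 0, μ * D]) (p := m * a) (q := m * c) (r := m * b) (s := m * d)
    ?_ ?_ ?_ ?_
  · simp [det_fin_three]
    grind
  · grind
  · intro x y z
    have : e₀ = m * (p₀ * a ^ 3 + p₁ * a ^ 2 * c + p₂ * a * c ^ 2 + p₃ * c ^ 3) := by grind
    have : e₂ = m * (p₀ * a * b ^ 2 + p₁ * b ^ 2 * c + p₂ * a * d ^ 2 + p₃ * c * d ^ 2) := by grind
    clear h hdet hμ hD0 hm0 h₀ h₁ h₂ h₃
    simp [precomp_apply, quad]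
    grind
  · intro x y z
    have : e₁ = m * (p₀ * a ^ 2 * b + p₁ * a ^ 2 * d + p₂ * b * c ^ 2 + p₃ * c ^ 2 * d) := by grind
    have : e₃ = m * (p₀ * b ^ 3 + p₁ * b ^ 2 * d + p₂ * b * d ^ 2 + p₃ * d ^ 3) := by grind
    clear h hdet hμ hD0 hm0 h₀ h₁ h₂ h₃
    simp [precomp_apply, quad]
    grind

theorem hasNormalForm_cubic_zero (u v : F) :
    HasNormalForm δ k₀ k₁ k₂ k₃ (quad 1 0 0 0 0 u) (quad 0 1 0 0 0 v) := by
  exact .of_translate v u (by grind) (by grind) (.of_index 6 rfl rfl)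

theorem hasNormalForm_cubic_triple (u v : F) :
    HasNormalForm δ k₀ k₁ k₂ k₃ (quad 1 0 0 1 0 u) (quad 0 1 0 0 0 v) := by
  exact .of_translate v (u + v ^ 2) (by grind) (by grind) (.of_index 7 rfl rfl)

variable [Finite F] (hδ : ∀ a, a + a ^ 2 ≠ δ)

include hδ in
-- Translation changes u by β and v by α + α², so u can be cleared and only the Artin-Schreier class
-- of v survives.
theorem hasNormalForm_cubic_double (u v : F) :
    HasNormalForm δ k₀ k₁ k₂ k₃ (quad 1 0 0 0 0 u) (quad 0 1 0 1 0 v) := by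
  obtain ⟨α, hα | hα⟩ := exists_artinSchreier hδ v
  · exact .of_translate α u (by grind) (by grind) (.of_index 8 rfl rfl)
  · exact .of_translate α u (by grind) (by grind) (.of_index 9 rfl rfl)

include hδ in
-- Translations leave four pairs of Artin-Schreier classes of (u, v). The cubic is st(s + t), and
-- shears permuting its three roots carry the pairs (δ, 0) and (0, δ) to (δ, δ), so two normal forms
-- remain.
theorem hasNormalForm_cubic_split (u v : F) :
    HasNormalForm δ k₀ k₁ k₂ k₃ (quad 1 0 0 0 1 u) (quad 0 1 0 1 0 v) := by
  have h11 : HasNormalForm δ k₀ k₁ k₂ k₃ (quad 1 0 0 0 1 δ) (quad 0 1 0 1 0 δ) :=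
    .of_index 11 rfl rfl
  obtain ⟨α, hα⟩ := exists_artinSchreier hδ v
  obtain ⟨β, hβ⟩ := exists_artinSchreier hδ u
  rcases hα with hα | hα <;> rcases hβ with hβ | hβ
  · exact .of_translate α β (u' := 0) (v' := 0) (by grind) (by grind) (.of_index 10 rfl rfl)
  · apply HasNormalForm.of_translate α β (u' := δ) (v' := 0) (by grind) (by grind)
    refine h11.of_subst (M := !![1, 1, 0; 0, 1, 0; 0, 0, 1]) (p := 1) (q := 0) (r := 1) (s := 1)
      ?_ ?_ ?_ ?_
    · simp [det_fin_three]
    · simp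
    all_goals
      intro x y z
      clear hδ h11
      simp [precomp_apply, quad] <;> grind
  · apply HasNormalForm.of_translate α β (u' := 0) (v' := δ) (by grind) (by grind)
    refine h11.of_subst (M := !![1, 0, 0; 1, 1, 0; 0, 0, 1]) (p := 1) (q := 1) (r := 0) (s := 1)
      ?_ ?_ ?_ ?_
    · simp [det_fin_three]
    · simp
    all_goals
      intro x y z
      clear hδ h11
      simp [precomp_apply, quad] <;> grind
  · exact .of_translate α β (u' := δ) (v' := δ) (by grind) (by grind) h11

include hδ in
theorem hasNormalForm_cubic_mixed (u v : F) :
    HasNormalForm δ k₀ k₁ k₂ k₃ (quad 1 0 0 δ 1 u) (quad 0 1 0 1 0 v) := by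
  have key : ∀ v', (v' = 0 ∨ v' = δ) → ∀ u',
      HasNormalForm δ k₀ k₁ k₂ k₃ (quad 1 0 0 δ 1 u') (quad 0 1 0 1 0 v') := by
    intro v' hv' u'
    obtain ⟨β, hβ⟩ := exists_artinSchreier hδ u'
    -- Once v is reduced, α may still be 0 or 1. The choice α = 1 adds δ to u, which removes the
    -- nontrivial class of u as well.
    obtain ⟨α, hα, hu⟩ : ∃ α : F, α + α ^ 2 = 0 ∧ u' + β + δ * α ^ 2 + β ^ 2 = 0 := by
      rcases hβ with hβ | hβ
      · exact ⟨0, by simp, by grind⟩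
      · exact ⟨1, by grind, by grind⟩
    apply HasNormalForm.of_translate α β (u' := 0) (v' := v') (by grind) (by grind)
    rcases hv' with rfl | rfl
    · exact .of_index 12 rfl rfl
    · exact .of_index 13 rfl rfl
  obtain ⟨α, hα⟩ := exists_artinSchreier hδ v
  refine .of_translate α 0 rfl rfl (key _ ?_ _)
  grind

/-- If (α, β) is in the kernel of the translation map, then β = k₀α² + k₂β² and α = k₁α² + k₃β².
Multiplying by α and β and adding shows that the cubic vanishes at (α, β). Hence the map is
injective, so surjective by finiteness, and u and v can both be cleared. -/
theorem hasNormalForm_cubic_rootless (hk : Rootless k₀ k₁ k₂ k₃) (u v : F) :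
    HasNormalForm δ k₀ k₁ k₂ k₃ (quad 1 0 0 k₀ k₂ u) (quad 0 1 0 k₁ k₃ v) := by
  let φ : F × F →+ F × F :=
    { toFun := fun p => (p.2 + k₀ * p.1 ^ 2 + k₂ * p.2 ^ 2, p.1 + k₁ * p.1 ^ 2 + k₃ * p.2 ^ 2)
      map_zero' := by simp
      map_add' := by
        rintro ⟨a, b⟩ ⟨c, d⟩
        ext
        · simp only [Prod.fst_add, Prod.snd_add]
          grind
        · simp only [Prod.fst_add, Prod.snd_add]
          grind }
  have hinj : Function.Injective φ := by
    rw [injective_iff_map_eq_zero]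
    rintro ⟨α, β⟩ h
    have h1 : β + k₀ * α ^ 2 + k₂ * β ^ 2 = 0 := congrArg Prod.fst h
    have h2 : α + k₁ * α ^ 2 + k₃ * β ^ 2 = 0 := congrArg Prod.snd h
    have := hk α β (by grind)
    rw [this.1, this.2]
    rfl
  obtain ⟨⟨α, β⟩, h⟩ := Finite.surjective_of_injective hinj (u, v)
  have h1 : β + k₀ * α ^ 2 + k₂ * β ^ 2 = u := congrArg Prod.fst h
  have h2 : α + k₁ * α ^ 2 + k₃ * β ^ 2 = v := congrArg Prod.snd h
  exact .of_translate α β (by grind) (by grind) (.of_index 14 rfl rfl)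

include hδ in
-- The cubic is s(as² + bst + ct²). The vanishing of b and c decides which roots coincide; when
-- neither vanishes, the Artin-Schreier class of ac/b² decides whether the quadratic factor splits.
theorem hasNormalForm_of_root_infinity (a b c u v : F) :
    HasNormalForm δ k₀ k₁ k₂ k₃ (quad 1 0 0 a c u) (quad 0 1 0 b 0 v) := by
  by_cases hc : c = 0
  · subst hc
    by_cases hb : b = 0
    · subst hb
      by_cases ha : a = 0
      · subst ha
        exact hasNormalForm_cubic_zero u v
      · exact .of_cubic hasNormalForm_cubic_triple 1 0 0 1 a (by simp) ha (by ring) (by ring)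
          (by ring) (by ring)
    · exact .of_cubic (hasNormalForm_cubic_double hδ) b 0 a 1 (b ^ 3) (by simpa using hb)
        (by simpa using hb) (by grind) (by grind) (by grind) (by grind)
  · by_cases hb : b = 0
    · subst hb
      obtain ⟨r, rfl⟩ := exists_sq_eq a
      obtain ⟨s, rfl⟩ := exists_sq_eq c
      have hs : s ≠ 0 := by
        rintro rfl
        simp at hc
      -- With square roots r of `a` and s of `c`, the quadratic factor is the square of a linear
      -- form, which becomes the first variable of the new cubic.
      exact .of_cubic (hasNormalForm_cubic_double hδ) 0 s 1 r (s ^ 3) (by simpa using hs)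
        (by simpa using hs) (by grind) (by grind) (by grind) (by grind)
    · obtain ⟨m, hm⟩ : ∃ m, b * m = 1 := ⟨_, mul_inv_cancel₀ hb⟩
      obtain ⟨l, hl⟩ : ∃ l, c * l = 1 := ⟨_, mul_inv_cancel₀ hc⟩
      have hm0 : m ≠ 0 := right_ne_zero_of_mul_eq_one hm
      have hl0 : l ≠ 0 := right_ne_zero_of_mul_eq_one hl
      have hbl : b * l ≠ 0 := mul_ne_zero hb hl0
      have hbbl : b ^ 2 * l ≠ 0 := mul_ne_zero (pow_ne_zero 2 hb) hl0
      obtain ⟨α, hα | hα⟩ := exists_artinSchreier hδ (a * c * m ^ 2)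
      · exact .of_cubic (hasNormalForm_cubic_split hδ) 1 0 (b * l * α) (b * l) (b ^ 2 * l)
          (by simpa using hbl) hbbl (by grind) (by grind) (by grind) (by grind)
      · exact .of_cubic (hasNormalForm_cubic_mixed hδ) 1 0 (b * l * α) (b * l) (b ^ 2 * l)
          (by simpa using hbl) hbbl (by grind) (by grind) (by grind) (by grind)

include hδ in
theorem hasNormalForm_of_cubic (hk : Rootless k₀ k₁ k₂ k₃) (a b c d u v : F) :
    HasNormalForm δ k₀ k₁ k₂ k₃ (quad 1 0 0 a c u) (quad 0 1 0 b d v) := by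
  by_cases h : Rootless a b c d
  · obtain ⟨a', b', c', d', μ, hdet, hμ, h₀, h₁, h₂, h₃⟩ := h.equiv hk
    exact .of_cubic (hasNormalForm_cubic_rootless hk) a' b' c' d' μ hdet hμ h₀ h₁ h₂ h₃
  · unfold Rootless at h
    push Not at h
    obtain ⟨s, t, hst, hne⟩ := h
    have hroot : a * s ^ 3 + b * s ^ 2 * t + c * s * t ^ 2 + d * t ^ 3 = 0 := hst
    by_cases ht : t = 0
    · have hs : s ≠ 0 := fun hs => hne hs ht
      -- The second column of the substitution is the zero (s, t), so the last coefficient of the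
      -- new cubic vanishes.
      exact .of_cubic (hasNormalForm_of_root_infinity hδ _ _ _) 0 s 1 t 1 (by simpa using hs)
        one_ne_zero (one_mul _) (one_mul _) (one_mul _) (by rw [hroot, mul_zero])
    · exact .of_cubic (hasNormalForm_of_root_infinity hδ _ _ _) 1 s 0 t 1 (by simpa using ht)
        one_ne_zero (one_mul _) (one_mul _) (one_mul _) (by rw [hroot, mul_zero])

end NetReduction

/-! ### Nuclei, double lines and the normal form of an arbitrary pencil. -/

section QuadReduction

variable {F : Type*} [Field F] [CharP F 2]

/-- The new nucleus comes from the 2 × 2 minors of M, and the new diagonal coefficients are the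
values of the form at the columns of M. -/
theorem precomp_quad (M : Matrix (Fin 3) (Fin 3) F) (n₀ n₁ n₂ d₀ d₁ d₂ : F) :
    ∃ n₀' n₁' n₂' d₀' d₁' d₂',
      precomp M (quad n₀ n₁ n₂ d₀ d₁ d₂) = quad n₀' n₁' n₂' d₀' d₁' d₂' := by
  refine ⟨n₀ * (M 1 1 * M 2 2 + M 1 2 * M 2 1) + n₁ * (M 0 1 * M 2 2 + M 0 2 * M 2 1) +
      n₂ * (M 0 1 * M 1 2 + M 0 2 * M 1 1),
    n₀ * (M 1 0 * M 2 2 + M 1 2 * M 2 0) + n₁ * (M 0 0 * M 2 2 + M 0 2 * M 2 0) +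
      n₂ * (M 0 0 * M 1 2 + M 0 2 * M 1 0),
    n₀ * (M 1 0 * M 2 1 + M 1 1 * M 2 0) + n₁ * (M 0 0 * M 2 1 + M 0 1 * M 2 0) +
      n₂ * (M 0 0 * M 1 1 + M 0 1 * M 1 0),
    quad n₀ n₁ n₂ d₀ d₁ d₂ (M 0 0) (M 1 0) (M 2 0),
    quad n₀ n₁ n₂ d₀ d₁ d₂ (M 0 1) (M 1 1) (M 2 1),
    quad n₀ n₁ n₂ d₀ d₁ d₂ (M 0 2) (M 1 2) (M 2 2), ?_⟩
  funext x y z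
  simp only [precomp_apply, quad]
  grind

/-- A quadratic form in coordinates whose first basis vector is its nucleus. -/
theorem precomp_quad_nucleus_left (n₀ n₁ n₂ d₀ d₁ d₂ m₀ m₁ m₂ w₀ w₁ w₂ x y z : F) :
    precomp !![n₀, m₀, w₀; n₁, m₁, w₁; n₂, m₂, w₂] (quad n₀ n₁ n₂ d₀ d₁ d₂) x y z =
      quad (!![n₀, m₀, w₀; n₁, m₁, w₁; n₂, m₂, w₂].det) 0 0 (quad n₀ n₁ n₂ d₀ d₁ d₂ n₀ n₁ n₂)
        (quad n₀ n₁ n₂ d₀ d₁ d₂ m₀ m₁ m₂) (quad n₀ n₁ n₂ d₀ d₁ d₂ w₀ w₁ w₂) x y z := by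
  simp [precomp_apply, quad, det_fin_three]
  grind

/-- A quadratic form in coordinates whose second basis vector is its nucleus. -/
theorem precomp_quad_nucleus_right (n₀ n₁ n₂ d₀ d₁ d₂ m₀ m₁ m₂ w₀ w₁ w₂ x y z : F) :
    precomp !![m₀, n₀, w₀; m₁, n₁, w₁; m₂, n₂, w₂] (quad n₀ n₁ n₂ d₀ d₁ d₂) x y z =
      quad 0 (!![m₀, n₀, w₀; m₁, n₁, w₁; m₂, n₂, w₂].det) 0 (quad n₀ n₁ n₂ d₀ d₁ d₂ m₀ m₁ m₂)
        (quad n₀ n₁ n₂ d₀ d₁ d₂ n₀ n₁ n₂) (quad n₀ n₁ n₂ d₀ d₁ d₂ w₀ w₁ w₂) x y z := by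
  simp [precomp_apply, quad, det_fin_three]
  grind

/-- Two vectors with a nonzero cross product extend to a basis. -/
theorem exists_det_ne_zero {a₀ a₁ a₂ b₀ b₁ b₂ : F}
    (h : ¬ (a₁ * b₂ = a₂ * b₁ ∧ a₀ * b₂ = a₂ * b₀ ∧ a₀ * b₁ = a₁ * b₀)) :
    ∃ w₀ w₁ w₂, !![a₀, b₀, w₀; a₁, b₁, w₁; a₂, b₂, w₂].det ≠ 0 := by
  by_cases h₀ : a₁ * b₂ = a₂ * b₁
  · by_cases h₁ : a₀ * b₂ = a₂ * b₀
    · refine ⟨0, 0, 1, ?_⟩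
      simp [det_fin_three]
      grind
    · refine ⟨0, 1, 0, ?_⟩
      simp [det_fin_three]
      grind
  · refine ⟨1, 0, 0, ?_⟩
    simp [det_fin_three]
    grind

theorem quad_square (l₀ l₁ l₂ x y z : F) :
    quad 0 0 0 (l₀ ^ 2) (l₁ ^ 2) (l₂ ^ 2) x y z = (l₀ * x + l₁ * y + l₂ * z) ^ 2 := by
  simp only [quad]
  grind

variable [Finite F] {δ k₀ k₁ k₂ k₃ : F} (hδ : ∀ a, a + a ^ 2 ≠ δ)

include hδ in
-- In a basis beginning with the two nuclei, the only mixed term of the first form is yz and that of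
-- the second is xz, with the same determinant D as coefficient. Dividing by D gives the shape
-- governed by the binary cubic.
theorem hasNormalForm_of_independent_nuclei (hk : Rootless k₀ k₁ k₂ k₃)
    {n₀ n₁ n₂ d₀ d₁ d₂ m₀ m₁ m₂ e₀ e₁ e₂ : F}
    (h : ¬ (n₁ * m₂ = n₂ * m₁ ∧ n₀ * m₂ = n₂ * m₀ ∧ n₀ * m₁ = n₁ * m₀)) :
    HasNormalForm δ k₀ k₁ k₂ k₃ (quad n₀ n₁ n₂ d₀ d₁ d₂) (quad m₀ m₁ m₂ e₀ e₁ e₂) := by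
  obtain ⟨w₀, w₁, w₂, hw⟩ := exists_det_ne_zero h
  set D := !![n₀, m₀, w₀; n₁, m₁, w₁; n₂, m₂, w₂].det with hD
  obtain ⟨m, hm⟩ : ∃ m, D * m = 1 := ⟨_, mul_inv_cancel₀ hw⟩
  have hm0 : m ≠ 0 := right_ne_zero_of_mul_eq_one hm
  refine HasNormalForm.of_subst (M := !![n₀, m₀, w₀; n₁, m₁, w₁; n₂, m₂, w₂])
    (p := m) (q := 0) (r := 0) (s := m)
    (hasNormalForm_of_cubic hδ hk (m * quad n₀ n₁ n₂ d₀ d₁ d₂ n₀ n₁ n₂)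
      (m * quad m₀ m₁ m₂ e₀ e₁ e₂ n₀ n₁ n₂) (m * quad n₀ n₁ n₂ d₀ d₁ d₂ m₀ m₁ m₂)
      (m * quad m₀ m₁ m₂ e₀ e₁ e₂ m₀ m₁ m₂) (m * quad n₀ n₁ n₂ d₀ d₁ d₂ w₀ w₁ w₂)
      (m * quad m₀ m₁ m₂ e₀ e₁ e₂ w₀ w₁ w₂)) hw (by simpa using hm0) ?_ ?_
  · intro x y z
    rw [precomp_quad_nucleus_left, ← hD]
    generalize quad n₀ n₁ n₂ d₀ d₁ d₂ n₀ n₁ n₂ = A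
    generalize quad n₀ n₁ n₂ d₀ d₁ d₂ m₀ m₁ m₂ = B
    generalize quad n₀ n₁ n₂ d₀ d₁ d₂ w₀ w₁ w₂ = C
    simp only [quad]
    linear_combination -y * z * hm
  · intro x y z
    rw [precomp_quad_nucleus_right, ← hD]
    generalize quad m₀ m₁ m₂ e₀ e₁ e₂ n₀ n₁ n₂ = A
    generalize quad m₀ m₁ m₂ e₀ e₁ e₂ m₀ m₁ m₂ = B
    generalize quad m₀ m₁ m₂ e₀ e₁ e₂ w₀ w₁ w₂ = C
    simp only [quad]
    linear_combination -x * z * hm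

/-- Every coefficient is a square, so both generators are squares of linear forms. These two linear
forms are independent and become the coordinates y and z. -/
theorem hasNormalForm_of_squares {d₀ d₁ d₂ e₀ e₁ e₂ : F}
    (h : ¬ (d₁ * e₂ = d₂ * e₁ ∧ d₀ * e₂ = d₂ * e₀ ∧ d₀ * e₁ = d₁ * e₀)) :
    HasNormalForm δ k₀ k₁ k₂ k₃ (quad 0 0 0 d₀ d₁ d₂) (quad 0 0 0 e₀ e₁ e₂) := by
  obtain ⟨a₀, rfl⟩ := exists_sq_eq d₀
  obtain ⟨a₁, rfl⟩ := exists_sq_eq d₁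
  obtain ⟨a₂, rfl⟩ := exists_sq_eq d₂
  obtain ⟨b₀, rfl⟩ := exists_sq_eq e₀
  obtain ⟨b₁, rfl⟩ := exists_sq_eq e₁
  obtain ⟨b₂, rfl⟩ := exists_sq_eq e₂
  obtain ⟨w₀, w₁, w₂, hw⟩ := exists_det_ne_zero (a₀ := a₀) (a₁ := a₁) (a₂ := a₂) (b₀ := b₀)
    (b₁ := b₁) (b₂ := b₂) (by
      rintro ⟨h₀, h₁, h₂⟩
      exact h ⟨by linear_combination (a₁ * b₂ + a₂ * b₁) * h₀,
        by linear_combination (a₀ * b₂ + a₂ * b₀) * h₁,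
        by linear_combination (a₀ * b₁ + a₁ * b₀) * h₂⟩)
  refine HasNormalForm.of_subst_symm (M := !![w₀, w₁, w₂; a₀, a₁, a₂; b₀, b₁, b₂])
    (.of_index 0 rfl rfl) ?_ ?_ ?_
  · contrapose! hw
    simp [det_fin_three] at hw ⊢
    linear_combination hw
  · intro x y z
    rw [quad_square]
    simp [precomp_apply, normalPair]
  · intro x y z
    rw [quad_square]
    simp [precomp_apply, normalPair]

include hδ in
theorem hasNormalForm_binary {n d₀ d₁ : F} (hn : n ≠ 0) :
    HasNormalForm δ k₀ k₁ k₂ k₃ (quad 0 0 n d₀ d₁ 0) (quad 0 0 0 0 0 1) := by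
  obtain ⟨m, hm⟩ : ∃ m, n * m = 1 := ⟨_, mul_inv_cancel₀ hn⟩
  have hm0 : m ≠ 0 := right_ne_zero_of_mul_eq_one hm
  have h1 : HasNormalForm δ k₀ k₁ k₂ k₃ (fun x y _ => x * y) (fun _ _ z => z ^ 2) :=
    .of_index 1 rfl rfl
  have h2 : HasNormalForm δ k₀ k₁ k₂ k₃ (fun x y _ => x ^ 2 + x * y + δ * y ^ 2)
    (fun _ _ z => z ^ 2) := .of_index 2 rfl rfl
  by_cases h₀ : d₀ = 0
  · subst h₀
    refine h1.of_subst_symm (M := !![n, d₁, 0; 0, 1, 0; 0, 0, 1]) ?_ ?_ ?_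
    · simpa [det_fin_three] using hn
    · intro x y z
      simp [precomp_apply, quad]
      ring
    · intro x y z
      simp [precomp_apply, quad]
  · obtain ⟨l, hl⟩ : ∃ l, d₀ * l = 1 := ⟨_, mul_inv_cancel₀ h₀⟩
    have hl0 : l ≠ 0 := right_ne_zero_of_mul_eq_one hl
    obtain ⟨α, hα | hα⟩ := exists_artinSchreier hδ (d₀ * d₁ * m ^ 2)
    -- The first factor turns the form into a multiple of x(x + y), and the shear in the second
    -- factor turns x(x + y) into xy.
    · refine h1.of_subst (M := !![1, α, 0; 0, m * d₀, 0; 0, 0, 1] *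
        !![1, 0, 0; 1, 1, 0; 0, 0, 1])
        (p := l) (q := 0) (r := 0) (s := 1) ?_ ?_ ?_ ?_
      · rw [det_mul]
        simpa [det_fin_three] using ⟨hm0, h₀⟩
      · simpa using hl0
      · intro x y z
        clear h1 h2 hδ hn hm0 h₀ hl0
        simp [precomp_apply, quad]
        grind
      · intro x y z
        simp [precomp_apply, quad]
    · refine h2.of_subst (M := !![1, α, 0; 0, m * d₀, 0; 0, 0, 1])
        (p := l) (q := 0) (r := 0) (s := 1) ?_ ?_ ?_ ?_
      · simpa [det_fin_three] using ⟨hm0, h₀⟩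
      · simpa using hl0
      · intro x y z
        clear h1 h2 hδ hn hm0 h₀ hl0
        simp [precomp_apply, quad]
        grind
      · intro x y z
        simp [precomp_apply, quad]

/-- The nucleus (1, 0, 0) lies on the double line z = 0. The value d₀ at the nucleus decides whether
the conic is singular. If it is, d₁ tells whether z divides the form modulo z². The z² term is
absorbed by the other generator. -/
theorem hasNormalForm_nucleus_on_line {d₀ d₁ d₂ : F} :
    HasNormalForm δ k₀ k₁ k₂ k₃ (quad 1 0 0 d₀ d₁ d₂) (quad 0 0 0 0 0 1) := by
  have h3 : HasNormalForm δ k₀ k₁ k₂ k₃ (fun x y z => y * z + x ^ 2) (fun _ _ z => z ^ 2) :=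
    .of_index 3 rfl rfl
  have h4 : HasNormalForm δ k₀ k₁ k₂ k₃ (fun _ y z => y * z) (fun _ _ z => z ^ 2) :=
    .of_index 4 rfl rfl
  have h5 : HasNormalForm δ k₀ k₁ k₂ k₃ (fun _ y z => y * z + y ^ 2) (fun _ _ z => z ^ 2) :=
    .of_index 5 rfl rfl
  by_cases h₀ : d₀ = 0
  · subst h₀
    by_cases h₁ : d₁ = 0
    · subst h₁
      refine h4.of_combination (p := 1) (q := d₂) (r := 0) (s := 1) (by simp) ?_ ?_ <;>
      · intro x y z
        simp [quad] <;> grind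
    · obtain ⟨l, hl⟩ : ∃ l, d₁ * l = 1 := ⟨_, mul_inv_cancel₀ h₁⟩
      have hl0 : l ≠ 0 := right_ne_zero_of_mul_eq_one hl
      refine h5.of_subst (M := !![1, 0, 0; 0, l, 0; 0, 0, 1])
        (p := d₁) (q := d₁ * d₂) (r := 0) (s := 1) ?_ ?_ ?_ ?_
      · simpa [det_fin_three] using hl0
      · simpa using h₁
      all_goals
        intro x y z
        clear h3 h4 h5 h₁ hl0
        simp [precomp_apply, quad] <;> grind
  · obtain ⟨a, rfl⟩ := exists_sq_eq d₀
    obtain ⟨b, rfl⟩ := exists_sq_eq d₁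
    have ha : a ≠ 0 := by
      rintro rfl
      simp at h₀
    obtain ⟨m, hm⟩ : ∃ m, a * m = 1 := ⟨_, mul_inv_cancel₀ ha⟩
    have hm0 : m ≠ 0 := right_ne_zero_of_mul_eq_one hm
    refine h3.of_subst (M := !![m, m * b, 0; 0, 1, 0; 0, 0, 1])
      (p := 1) (q := d₂) (r := 0) (s := 1) ?_ ?_ ?_ ?_
    · simpa [det_fin_three] using hm0
    · simp
    all_goals
      intro x y z
      clear h3 h4 h5 ha h₀ hm0
      simp [precomp_apply, quad] <;> grind

include hδ in
-- The nucleus lies on the double line z = 0 exactly when n₂ = 0. Otherwise it can be moved to (0,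
-- 0, 1), and modulo z² the form becomes binary in x and y.
theorem hasNormalForm_line_last {n₀ n₁ n₂ d₀ d₁ d₂ : F} (h : ¬ (n₀ = 0 ∧ n₁ = 0 ∧ n₂ = 0)) :
    HasNormalForm δ k₀ k₁ k₂ k₃ (quad n₀ n₁ n₂ d₀ d₁ d₂) (quad 0 0 0 0 0 1) := by
  by_cases h₂ : n₂ = 0
  · subst h₂
    by_cases h₀ : n₀ = 0
    · subst h₀
      have h₁ : n₁ ≠ 0 := fun h₁ => h ⟨rfl, h₁, rfl⟩
      obtain ⟨m, hm⟩ : ∃ m, n₁ * m = 1 := ⟨_, mul_inv_cancel₀ h₁⟩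
      have hm0 : m ≠ 0 := right_ne_zero_of_mul_eq_one hm
      refine HasNormalForm.of_subst_eq (hasNormalForm_nucleus_on_line (d₀ := d₁)
        (d₁ := d₀ * m ^ 2) (d₂ := d₂)) (M := !![0, m, 0; 1, 0, 0; 0, 0, 1]) ?_ ?_ ?_
      · simpa [det_fin_three] using hm0
      all_goals
        intro x y z
        clear hδ h h₁ hm0
        simp [precomp_apply, quad] <;> grind
    · obtain ⟨m, hm⟩ : ∃ m, n₀ * m = 1 := ⟨_, mul_inv_cancel₀ h₀⟩
      have hm0 : m ≠ 0 := right_ne_zero_of_mul_eq_one hm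
      refine HasNormalForm.of_subst_eq (hasNormalForm_nucleus_on_line
        (d₀ := d₀ + d₁ * m ^ 2 * n₁ ^ 2) (d₁ := d₁ * m ^ 2) (d₂ := d₂))
        (M := !![1, 0, 0; m * n₁, m, 0; 0, 0, 1]) ?_ ?_ ?_
      · simpa [det_fin_three] using hm0
      all_goals
        intro x y z
        clear hδ h h₀ hm0
        simp [precomp_apply, quad] <;> grind
  · obtain ⟨m, hm⟩ : ∃ m, n₂ * m = 1 := ⟨_, mul_inv_cancel₀ h₂⟩
    refine HasNormalForm.of_subst (hasNormalForm_binary hδ h₂ (d₀ := d₀) (d₁ := d₁))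
      (M := !![1, 0, m * n₀; 0, 1, m * n₁; 0, 0, 1]) (p := 1)
      (q := m * n₀ * n₁ + d₀ * m ^ 2 * n₀ ^ 2 + d₁ * m ^ 2 * n₁ ^ 2 + d₂)
      (r := 0) (s := 1) ?_ ?_ ?_ ?_
    · simp [det_fin_three]
    · simp
    all_goals
      intro x y z
      clear hδ h h₂
      simp [precomp_apply, quad] <;> grind

include hδ in
theorem hasNormalForm_of_square {n₀ n₁ n₂ d₀ d₁ d₂ e₀ e₁ e₂ : F}
    (h : ¬ (n₀ = 0 ∧ n₁ = 0 ∧ n₂ = 0)) (he : ¬ (e₀ = 0 ∧ e₁ = 0 ∧ e₂ = 0)) :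
    HasNormalForm δ k₀ k₁ k₂ k₃ (quad n₀ n₁ n₂ d₀ d₁ d₂) (quad 0 0 0 e₀ e₁ e₂) := by
  obtain ⟨l₀, rfl⟩ := exists_sq_eq e₀
  obtain ⟨l₁, rfl⟩ := exists_sq_eq e₁
  obtain ⟨l₂, rfl⟩ := exists_sq_eq e₂
  obtain ⟨a₀, a₁, a₂, b₀, b₁, b₂, hdet⟩ : ∃ a₀ a₁ a₂ b₀ b₁ b₂,
      !![a₀, a₁, a₂; b₀, b₁, b₂; l₀, l₁, l₂].det ≠ 0 := by
    by_cases h₀ : l₀ = 0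
    · by_cases h₁ : l₁ = 0
      · exact ⟨1, 0, 0, 0, 1, 0, by simp [det_fin_three]; grind⟩
      · exact ⟨1, 0, 0, 0, 0, 1, by simp [det_fin_three]; grind⟩
    · exact ⟨0, 1, 0, 0, 0, 1, by simp [det_fin_three]; grind⟩
  set M := !![a₀, a₁, a₂; b₀, b₁, b₂; l₀, l₁, l₂] with hM
  obtain ⟨n₀', n₁', n₂', d₀', d₁', d₂', hq⟩ := precomp_quad M⁻¹ n₀ n₁ n₂ d₀ d₁ d₂
  have hunit : IsUnit M.det := isUnit_iff_ne_zero.mpr hdet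
  have hq' : precomp M (quad n₀' n₁' n₂' d₀' d₁' d₂') = quad n₀ n₁ n₂ d₀ d₁ d₂ := by
    rw [← hq, ← LinearMap.comp_apply, precomp_comp, nonsing_inv_mul M hunit, precomp_one,
      LinearMap.id_apply]
  by_cases hn : n₀' = 0 ∧ n₁' = 0 ∧ n₂' = 0
  -- A zero nucleus means that the form is additive. Substitution preserves this, so the original
  -- nucleus would vanish too, as pairs of basis vectors show.
  · exfalso
    obtain ⟨rfl, rfl, rfl⟩ := hn
    have key : ∀ x y z x' y' z', quad n₀ n₁ n₂ d₀ d₁ d₂ (x + x') (y + y') (z + z') =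
        quad n₀ n₁ n₂ d₀ d₁ d₂ x y z + quad n₀ n₁ n₂ d₀ d₁ d₂ x' y' z' := by
      intro x y z x' y' z'
      rw [← hq']
      simp only [precomp_apply, quad]
      grind
    have k1 := key 1 0 0 0 1 0
    have k2 := key 1 0 0 0 0 1
    have k3 := key 0 1 0 0 0 1
    simp [quad] at k1 k2 k3
    grind
  · refine (hasNormalForm_line_last hδ hn (d₀ := d₀') (d₁ := d₁') (d₂ := d₂')).of_subst_symm
      hdet ?_ ?_
    · intro x y z
      rw [hq']
    · intro x y z
      rw [quad_square]
      simp [precomp_apply, quad, hM]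

include hδ in
/-- Every pencil of conics over a finite field of even order has a normal form. -/
theorem hasNormalForm_quad (hk : Rootless k₀ k₁ k₂ k₃)
    {n₀ n₁ n₂ d₀ d₁ d₂ m₀ m₁ m₂ e₀ e₁ e₂ : F}
    (h : ∀ s t, (∀ x y z, s * quad n₀ n₁ n₂ d₀ d₁ d₂ x y z + t * quad m₀ m₁ m₂ e₀ e₁ e₂ x y z = 0) →
      s = 0 ∧ t = 0) :
    HasNormalForm δ k₀ k₁ k₂ k₃ (quad n₀ n₁ n₂ d₀ d₁ d₂) (quad m₀ m₁ m₂ e₀ e₁ e₂) := by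
  by_cases hnm : n₁ * m₂ = n₂ * m₁ ∧ n₀ * m₂ = n₂ * m₀ ∧ n₀ * m₁ = n₁ * m₀
  · have hsq : ∀ {n₀ n₁ n₂ d₀ d₁ d₂ e₀ e₁ e₂ : F}, (∀ s t, (∀ x y z,
        s * quad n₀ n₁ n₂ d₀ d₁ d₂ x y z + t * quad 0 0 0 e₀ e₁ e₂ x y z = 0) → s = 0 ∧ t = 0) →
        HasNormalForm δ k₀ k₁ k₂ k₃ (quad n₀ n₁ n₂ d₀ d₁ d₂) (quad 0 0 0 e₀ e₁ e₂) := by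
      intro n₀ n₁ n₂ d₀ d₁ d₂ e₀ e₁ e₂ h
      have he : ¬ (e₀ = 0 ∧ e₁ = 0 ∧ e₂ = 0) := by
        rintro ⟨rfl, rfl, rfl⟩
        exact one_ne_zero (h 0 1 (by simp [quad])).2
      by_cases hn : n₀ = 0 ∧ n₁ = 0 ∧ n₂ = 0
      · obtain ⟨rfl, rfl, rfl⟩ := hn
        apply hasNormalForm_of_squares
        rintro ⟨h₀, h₁, h₂⟩
        have k0 := (h e₀ (-d₀) (by intro x y z; simp [quad]; linear_combination -y ^ 2 * h₂ - z ^ 2 * h₁)).1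
        have k1 := (h e₁ (-d₁) (by intro x y z; simp [quad]; linear_combination x ^ 2 * h₂ - z ^ 2 * h₀)).1
        have k2 := (h e₂ (-d₂) (by intro x y z; simp [quad]; linear_combination x ^ 2 * h₁ + y ^ 2 * h₀)).1
        exact he ⟨k0, k1, k2⟩
      · exact hasNormalForm_of_square hδ hn he
    by_cases hm : m₀ = 0 ∧ m₁ = 0 ∧ m₂ = 0
    · obtain ⟨rfl, rfl, rfl⟩ := hm
      exact hsq h
    -- Proportional nuclei cancel in characteristic two: the first form plus c times the second is
    -- diagonal, so the pencil has a generator that is a square.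
    · obtain ⟨c, h₀, h₁, h₂⟩ : ∃ c, n₀ = c * m₀ ∧ n₁ = c * m₁ ∧ n₂ = c * m₂ := by
        by_cases hm₀ : m₀ = 0
        · by_cases hm₁ : m₁ = 0
          · have hm₂ : m₂ ≠ 0 := fun hm₂ => hm ⟨hm₀, hm₁, hm₂⟩
            exact ⟨n₂ / m₂, by grind, by grind, by grind⟩
          · exact ⟨n₁ / m₁, by grind, by grind, by grind⟩
        · exact ⟨n₀ / m₀, by grind, by grind, by grind⟩
      subst h₀ h₁ h₂
      have hcomb : ∀ x y z, quad 0 0 0 (d₀ + c * e₀) (d₁ + c * e₁) (d₂ + c * e₂) x y z =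
          quad (c * m₀) (c * m₁) (c * m₂) d₀ d₁ d₂ x y z + c * quad m₀ m₁ m₂ e₀ e₁ e₂ x y z := by
        intro x y z
        simp only [quad]
        grind
      refine HasNormalForm.of_combination (p := 0) (q := 1) (r := 1) (s := c)
        (hsq (n₀ := m₀) (n₁ := m₁) (n₂ := m₂) (d₀ := e₀) (d₁ := e₁) (d₂ := e₂)
        (e₀ := d₀ + c * e₀) (e₁ := d₁ + c * e₁) (e₂ := d₂ + c * e₂) ?_) (by simp)
        (by simp) (by simpa using hcomb)
      intro s t hst
      have := h t (s + t * c) (fun x y z => by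
        have := hst x y z
        rw [hcomb] at this
        linear_combination this)
      obtain ⟨rfl, h2⟩ := this
      simpa using h2
  · exact hasNormalForm_of_independent_nuclei hδ hk hnm

end QuadReduction

/-! ### Geometric invariants of linear systems. -/

section Invariants

variable {F : Type*} [Field F]

/-- The value of a ternary function at a vector. -/
def val (f : Ternary F) (v : Fin 3 → F) : F := f (v 0) (v 1) (v 2)

theorem val_precomp (M : Matrix (Fin 3) (Fin 3) F) (f : Ternary F) (v : Fin 3 → F) :
    val (precomp M f) v = val f (M *ᵥ v) := by
  simp [val, precomp_apply, Matrix.mulVec, dotProduct, Fin.sum_univ_three]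

/-- `f` is additive, that is, a double line if it is a quadratic form in characteristic two. -/
def IsDouble (f : Ternary F) : Prop := ∀ v w, val f (v + w) = val f v + val f w

/-- `v` is a singular point of the conic `f`. -/
def IsSingularPoint (f : Ternary F) (v : Fin 3 → F) : Prop :=
  val f v = 0 ∧ ∀ w, val f (v + w) = val f w

/-- `v` is a base point of the linear system `W`. -/
def IsBasePoint (W : Submodule F (Ternary F)) (v : Fin 3 → F) : Prop := ∀ f ∈ W, val f v = 0

def HasDoubleLine (W : Submodule F (Ternary F)) : Prop := ∃ f ∈ W, f ≠ 0 ∧ IsDouble f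

def AllDouble (W : Submodule F (Ternary F)) : Prop := ∀ f ∈ W, IsDouble f

/-- Three distinct base points on a line. -/
def HasBaseLine (W : Submodule F (Ternary F)) : Prop :=
  ∃ v w, LinearIndependent F ![v, w] ∧ IsBasePoint W v ∧ IsBasePoint W w ∧ IsBasePoint W (v + w)

def HasBasePoint (W : Submodule F (Ternary F)) : Prop := ∃ v, v ≠ 0 ∧ IsBasePoint W v

def HasTwoBasePoints (W : Submodule F (Ternary F)) : Prop :=
  ∃ v w, LinearIndependent F ![v, w] ∧ IsBasePoint W v ∧ IsBasePoint W w

/-- For a pencil, this detects a base point over F at which the generators meet with multiplicity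
greater than one: some nonzero member has vanishing gradient there. -/
def HasSingularBasePoint (W : Submodule F (Ternary F)) : Prop :=
  ∃ v, v ≠ 0 ∧ IsBasePoint W v ∧ ∃ f ∈ W, f ≠ 0 ∧ IsSingularPoint f v

/-- For independent nuclei this says that the binary cubic of the pencil has two distinct zeros over
F. -/
def HasTwoSingularConics (W : Submodule F (Ternary F)) : Prop :=
  ∃ f ∈ W, ∃ g ∈ W, LinearIndependent F ![f, g] ∧ (∃ v, v ≠ 0 ∧ IsSingularPoint f v) ∧
    ∃ v, v ≠ 0 ∧ IsSingularPoint g v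

variable {W W' : Submodule F (Ternary F)}

theorem precomp_injective (M : GL (Fin 3) F) : Function.Injective (precomp M.1) := by
  intro f g h
  have := congrArg (precomp (M⁻¹).1) h
  rwa [← LinearMap.comp_apply, ← LinearMap.comp_apply, precomp_comp, ← Units.val_mul,
    mul_inv_cancel, Units.val_one, precomp_one] at this

theorem mulVec_inv_cancel (M : GL (Fin 3) F) (v : Fin 3 → F) : M.1 *ᵥ ((M⁻¹).1 *ᵥ v) = v := by
  rw [mulVec_mulVec, ← Units.val_mul, mul_inv_cancel, Units.val_one, one_mulVec]

theorem inv_mulVec_cancel (M : GL (Fin 3) F) (v : Fin 3 → F) : (M⁻¹).1 *ᵥ (M.1 *ᵥ v) = v := by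
  rw [mulVec_mulVec, ← Units.val_mul, inv_mul_cancel, Units.val_one, one_mulVec]

theorem mulVec_ne_zero (M : GL (Fin 3) F) {v : Fin 3 → F} (h : v ≠ 0) : M.1 *ᵥ v ≠ 0 := by
  intro h0
  apply h
  rw [← inv_mulVec_cancel M v, h0, mulVec_zero]

theorem linearIndependent_mulVec (M : GL (Fin 3) F) {v w : Fin 3 → F}
    (h : LinearIndependent F ![v, w]) : LinearIndependent F ![M.1 *ᵥ v, M.1 *ᵥ w] := by
  rw [LinearIndependent.pair_iff] at h ⊢
  intro s t hst
  apply h s t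
  have := congrArg ((M⁻¹).1 *ᵥ ·) hst
  simpa only [mulVec_add, mulVec_smul, inv_mulVec_cancel, mulVec_zero] using this

theorem IsDouble.precomp {f : Ternary F} (h : IsDouble f) (M : Matrix (Fin 3) (Fin 3) F) :
    IsDouble (precomp M f) := by
  intro v w
  rw [val_precomp, val_precomp, val_precomp, mulVec_add, h]

theorem IsSingularPoint.precomp {f : Ternary F} {v : Fin 3 → F} (h : IsSingularPoint f v)
    (M : GL (Fin 3) F) : IsSingularPoint (precomp M.1 f) ((M⁻¹).1 *ᵥ v) := by
  refine ⟨?_, fun w => ?_⟩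
  · rw [val_precomp, mulVec_inv_cancel, h.1]
  · rw [val_precomp, val_precomp, mulVec_add, mulVec_inv_cancel, h.2]

theorem IsBasePoint.map {v : Fin 3 → F} (h : IsBasePoint W v) (M : GL (Fin 3) F) :
    IsBasePoint (W.map (precomp M.1)) ((M⁻¹).1 *ᵥ v) := by
  rintro _ ⟨f, hf, rfl⟩
  rw [val_precomp, mulVec_inv_cancel, h f hf]

theorem Equivalent.hasDoubleLine (e : Equivalent W W') (h : HasDoubleLine W) :
    HasDoubleLine W' := by
  obtain ⟨M, rfl⟩ := e
  obtain ⟨f, hf, h0, h⟩ := h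
  exact ⟨_, ⟨f, hf, rfl⟩, (map_ne_zero_iff _ (precomp_injective M)).mpr h0, h.precomp _⟩

theorem Equivalent.allDouble (e : Equivalent W W') (h : AllDouble W) : AllDouble W' := by
  obtain ⟨M, rfl⟩ := e
  rintro _ ⟨f, hf, rfl⟩
  exact (h f hf).precomp _

theorem Equivalent.hasBaseLine (e : Equivalent W W') (h : HasBaseLine W) : HasBaseLine W' := by
  obtain ⟨M, rfl⟩ := e
  obtain ⟨v, w, hvw, hv, hw, h⟩ := h
  exact ⟨_, _, linearIndependent_mulVec M⁻¹ hvw, hv.map M, hw.map M, by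
    rw [← mulVec_add]
    exact h.map M⟩

theorem Equivalent.hasBasePoint (e : Equivalent W W') (h : HasBasePoint W) :
    HasBasePoint W' := by
  obtain ⟨M, rfl⟩ := e
  obtain ⟨v, h0, hv⟩ := h
  exact ⟨_, mulVec_ne_zero M⁻¹ h0, hv.map M⟩

theorem Equivalent.hasTwoBasePoints (e : Equivalent W W') (h : HasTwoBasePoints W) :
    HasTwoBasePoints W' := by
  obtain ⟨M, rfl⟩ := e
  obtain ⟨v, w, hvw, hv, hw⟩ := h
  exact ⟨_, _, linearIndependent_mulVec M⁻¹ hvw, hv.map M, hw.map M⟩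

theorem Equivalent.hasSingularBasePoint (e : Equivalent W W') (h : HasSingularBasePoint W) :
    HasSingularBasePoint W' := by
  obtain ⟨M, rfl⟩ := e
  obtain ⟨v, h0, hv, f, hf, hf0, hs⟩ := h
  exact ⟨_, mulVec_ne_zero M⁻¹ h0, hv.map M, _, ⟨f, hf, rfl⟩,
    (map_ne_zero_iff _ (precomp_injective M)).mpr hf0, hs.precomp M⟩

theorem Equivalent.hasTwoSingularConics (e : Equivalent W W') (h : HasTwoSingularConics W) :
    HasTwoSingularConics W' := by
  obtain ⟨M, rfl⟩ := e
  obtain ⟨f, hf, g, hg, hfg, ⟨v, hv, hvf⟩, w, hw, hwg⟩ := h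
  refine ⟨_, ⟨f, hf, rfl⟩, _, ⟨g, hg, rfl⟩, ?_, ⟨_, mulVec_ne_zero M⁻¹ hv, hvf.precomp M⟩,
    _, mulVec_ne_zero M⁻¹ hw, hwg.precomp M⟩
  rw [LinearIndependent.pair_iff] at hfg ⊢
  intro s t hst
  apply hfg s t
  apply precomp_injective M
  rw [map_add, map_smul, map_smul, hst, map_zero]

open Classical in
/-- The index of the orbit of a pencil of conics in even characteristic. -/
def orbitIndex (W : Submodule F (Ternary F)) : Fin 15 :=
  if HasDoubleLine W then
    if AllDouble W then 2
    else if HasBaseLine W then 1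
    else if HasTwoBasePoints W then 5
    else if HasBasePoint W then if HasTwoSingularConics W then 0 else 4
    else 6
  else if HasBaseLine W then 3
  else if HasTwoBasePoints W then
    if HasSingularBasePoint W then if HasTwoSingularConics W then 7 else 10
    else if HasTwoSingularConics W then 8 else 11
  else if HasBasePoint W then if HasSingularBasePoint W then 9 else 14
  else if HasTwoSingularConics W then 12 else 13

theorem Equivalent.orbitIndex_eq (e : Equivalent W W') : orbitIndex W = orbitIndex W' := by
  have h1 : HasDoubleLine W = HasDoubleLine W' := propext ⟨e.hasDoubleLine, e.symm.hasDoubleLine⟩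
  have h2 : AllDouble W = AllDouble W' := propext ⟨e.allDouble, e.symm.allDouble⟩
  have h3 : HasBaseLine W = HasBaseLine W' := propext ⟨e.hasBaseLine, e.symm.hasBaseLine⟩
  have h4 : HasBasePoint W = HasBasePoint W' := propext ⟨e.hasBasePoint, e.symm.hasBasePoint⟩
  have h5 : HasTwoBasePoints W = HasTwoBasePoints W' :=
    propext ⟨e.hasTwoBasePoints, e.symm.hasTwoBasePoints⟩
  have h6 : HasSingularBasePoint W = HasSingularBasePoint W' :=
    propext ⟨e.hasSingularBasePoint, e.symm.hasSingularBasePoint⟩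
  have h7 : HasTwoSingularConics W = HasTwoSingularConics W' :=
    propext ⟨e.hasTwoSingularConics, e.symm.hasTwoSingularConics⟩
  unfold orbitIndex
  rw [h1, h2, h3, h4, h5, h6, h7]

end Invariants

/-! ### Criteria for the invariants in terms of coefficients. -/

section QuadInvariants

variable {F : Type*} [Field F] [CharP F 2] {n₀ n₁ n₂ d₀ d₁ d₂ m₀ m₁ m₂ e₀ e₁ e₂ : F}

theorem quad_combination (s t : F) :
    s • quad n₀ n₁ n₂ d₀ d₁ d₂ + t • quad m₀ m₁ m₂ e₀ e₁ e₂ =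
      quad (s * n₀ + t * m₀) (s * n₁ + t * m₁) (s * n₂ + t * m₂)
        (s * d₀ + t * e₀) (s * d₁ + t * e₁) (s * d₂ + t * e₂) := by
  funext x y z
  simp [quad]
  ring

/-- The values at the three basis vectors and their pairwise sums determine all six coefficients, so
forms may be treated as functions even over the field with two elements. -/
theorem quad_eq_zero (h : quad n₀ n₁ n₂ d₀ d₁ d₂ = 0) :
    n₀ = 0 ∧ n₁ = 0 ∧ n₂ = 0 ∧ d₀ = 0 ∧ d₁ = 0 ∧ d₂ = 0 := by
  have h' : ∀ x y z, quad n₀ n₁ n₂ d₀ d₁ d₂ x y z = 0 := fun x y z => by rw [h]; rfl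
  have h1 := h' 1 0 0
  have h2 := h' 0 1 0
  have h3 := h' 0 0 1
  have h4 := h' 1 1 0
  have h5 := h' 1 0 1
  have h6 := h' 0 1 1
  simp [quad] at h1 h2 h3 h4 h5 h6
  simp_all

theorem isDouble_quad : IsDouble (quad n₀ n₁ n₂ d₀ d₁ d₂) ↔ n₀ = 0 ∧ n₁ = 0 ∧ n₂ = 0 := by
  constructor
  · intro h
    have h1 := h ![1, 0, 0] ![0, 1, 0]
    have h2 := h ![1, 0, 0] ![0, 0, 1]
    have h3 := h ![0, 1, 0] ![0, 0, 1]
    simp [val, quad] at h1 h2 h3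
    grind
  · rintro ⟨rfl, rfl, rfl⟩ v w
    simp [val, quad]
    grind

/-- The polar form is w ↦ det(n, v, w), which vanishes identically exactly when v is dependent on
the nucleus n. -/
theorem isSingularPoint_quad {v : Fin 3 → F} :
    IsSingularPoint (quad n₀ n₁ n₂ d₀ d₁ d₂) v ↔
      quad n₀ n₁ n₂ d₀ d₁ d₂ (v 0) (v 1) (v 2) = 0 ∧
      n₁ * v 2 = n₂ * v 1 ∧ n₀ * v 2 = n₂ * v 0 ∧ n₀ * v 1 = n₁ * v 0 := by
  constructor
  · rintro ⟨h, hw⟩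
    refine ⟨h, ?_⟩
    have h1 := hw ![1, 0, 0]
    have h2 := hw ![0, 1, 0]
    have h3 := hw ![0, 0, 1]
    simp [val, quad] at h h1 h2 h3
    grind
  · rintro ⟨h, h1, h2, h3⟩
    refine ⟨h, fun w => ?_⟩
    simp only [val, quad, Pi.add_apply] at h ⊢
    grind

theorem linearIndependent_of_cross {v w : Fin 3 → F}
    (h : ¬ (v 1 * w 2 = v 2 * w 1 ∧ v 0 * w 2 = v 2 * w 0 ∧ v 0 * w 1 = v 1 * w 0)) :
    LinearIndependent F ![v, w] := by
  rw [LinearIndependent.pair_iff]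
  intro s t hst
  have h0 : s * v 0 + t * w 0 = 0 := congrFun hst 0
  have h1 : s * v 1 + t * w 1 = 0 := congrFun hst 1
  have h2 : s * v 2 + t * w 2 = 0 := congrFun hst 2
  by_contra hne
  apply h
  by_cases hs : s = 0
  · have ht : t ≠ 0 := fun ht => hne ⟨hs, ht⟩
    subst hs
    simp [ht] at h0 h1 h2
    simp [h0, h1, h2]
  · refine ⟨?_, ?_, ?_⟩ <;> apply mul_left_cancel₀ hs
    · linear_combination w 2 * h1 - w 1 * h2
    · linear_combination w 2 * h0 - w 0 * h2
    · linear_combination w 1 * h0 - w 0 * h1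

theorem not_linearIndependent_of_cross {v w : Fin 3 → F}
    (h : v 1 * w 2 = v 2 * w 1 ∧ v 0 * w 2 = v 2 * w 0 ∧ v 0 * w 1 = v 1 * w 0) :
    ¬ LinearIndependent F ![v, w] := by
  intro hli
  have hv := hli.ne_zero 0
  rw [LinearIndependent.pair_iff] at hli
  obtain ⟨h0, h1, h2⟩ := h
  apply hv
  have key : ∀ i, w i • v + (-v i) • w = 0 := by
    intro i
    funext j
    fin_cases i <;> fin_cases j <;> simp <;> grind
  funext i
  simpa using (hli _ _ (key i)).2

theorem vec_ne_zero {v : Fin 3 → F} : v ≠ 0 ↔ ¬ (v 0 = 0 ∧ v 1 = 0 ∧ v 2 = 0) := by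
  rw [Ne, funext_iff, Fin.forall_fin_succ, Fin.forall_fin_two]
  rfl

theorem isBasePoint_span {f g : Ternary F} {v : Fin 3 → F} :
    IsBasePoint (Submodule.span F {f, g}) v ↔
      f (v 0) (v 1) (v 2) = 0 ∧ g (v 0) (v 1) (v 2) = 0 := by
  constructor
  · intro h
    exact ⟨h f (Submodule.mem_span_of_mem (by simp)), h g (Submodule.mem_span_of_mem (by simp))⟩
  · rintro ⟨hf, hg⟩ h hh
    obtain ⟨s, t, rfl⟩ := Submodule.mem_span_pair.mp hh
    simp [val, hf, hg]

theorem not_hasDoubleLine (h : ∀ s t, s * n₀ + t * m₀ = 0 → s * n₁ + t * m₁ = 0 →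
    s * n₂ + t * m₂ = 0 → s = 0 ∧ t = 0) :
    ¬ HasDoubleLine (Submodule.span F {quad n₀ n₁ n₂ d₀ d₁ d₂, quad m₀ m₁ m₂ e₀ e₁ e₂}) := by
  rintro ⟨f, hf, hf0, hd⟩
  obtain ⟨s, t, rfl⟩ := Submodule.mem_span_pair.mp hf
  apply hf0
  rw [quad_combination, isDouble_quad] at hd
  obtain ⟨rfl, rfl⟩ := h s t hd.1 hd.2.1 hd.2.2
  simp

theorem hasDoubleLine_left (h : ¬ (d₀ = 0 ∧ d₁ = 0 ∧ d₂ = 0)) (f : Ternary F) :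
    HasDoubleLine (Submodule.span F {quad 0 0 0 d₀ d₁ d₂, f}) := by
  refine ⟨_, Submodule.mem_span_of_mem (Set.mem_insert _ _), ?_, isDouble_quad.mpr ⟨rfl, rfl, rfl⟩⟩
  intro h0
  exact h (quad_eq_zero h0).2.2.2

theorem hasDoubleLine_right (h : ¬ (d₀ = 0 ∧ d₁ = 0 ∧ d₂ = 0)) (f : Ternary F) :
    HasDoubleLine (Submodule.span F {f, quad 0 0 0 d₀ d₁ d₂}) := by
  rw [Set.pair_comm]
  exact hasDoubleLine_left h f

theorem allDouble_squares :
    AllDouble (Submodule.span F {quad 0 0 0 d₀ d₁ d₂, quad 0 0 0 e₀ e₁ e₂}) := by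
  intro f hf
  obtain ⟨s, t, rfl⟩ := Submodule.mem_span_pair.mp hf
  rw [quad_combination, isDouble_quad]
  simp

theorem not_allDouble_left (h : ¬ (n₀ = 0 ∧ n₁ = 0 ∧ n₂ = 0)) :
    ¬ AllDouble (Submodule.span F {quad n₀ n₁ n₂ d₀ d₁ d₂, quad m₀ m₁ m₂ e₀ e₁ e₂}) := fun hd =>
  h (isDouble_quad.mp (hd _ (Submodule.mem_span_of_mem (Set.mem_insert _ _))))

theorem not_allDouble_right (h : ¬ (m₀ = 0 ∧ m₁ = 0 ∧ m₂ = 0)) :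
    ¬ AllDouble (Submodule.span F {quad n₀ n₁ n₂ d₀ d₁ d₂, quad m₀ m₁ m₂ e₀ e₁ e₂}) := fun hd =>
  h (isDouble_quad.mp (hd _ (Submodule.mem_span_of_mem (Set.mem_insert_of_mem _ rfl))))

theorem hasBasePoint_span {f g : Ternary F} (x y z : F) (h : ¬ (x = 0 ∧ y = 0 ∧ z = 0))
    (hf : f x y z = 0) (hg : g x y z = 0) : HasBasePoint (Submodule.span F {f, g}) :=
  ⟨![x, y, z], vec_ne_zero.mpr h, isBasePoint_span.mpr ⟨hf, hg⟩⟩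

theorem not_hasBasePoint_span {f g : Ternary F}
    (h : ∀ x y z, f x y z = 0 → g x y z = 0 → x = 0 ∧ y = 0 ∧ z = 0) :
    ¬ HasBasePoint (Submodule.span F {f, g}) := by
  rintro ⟨v, hv, hb⟩
  obtain ⟨hf, hg⟩ := isBasePoint_span.mp hb
  exact vec_ne_zero.mp hv (h _ _ _ hf hg)

theorem hasTwoBasePoints_span {f g : Ternary F} (x y z x' y' z' : F)
    (h : ¬ (y * z' = z * y' ∧ x * z' = z * x' ∧ x * y' = y * x'))
    (hf : f x y z = 0) (hg : g x y z = 0) (hf' : f x' y' z' = 0) (hg' : g x' y' z' = 0) :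
    HasTwoBasePoints (Submodule.span F {f, g}) :=
  ⟨![x, y, z], ![x', y', z'], linearIndependent_of_cross h, isBasePoint_span.mpr ⟨hf, hg⟩,
    isBasePoint_span.mpr ⟨hf', hg'⟩⟩

theorem not_hasTwoBasePoints_span {f g : Ternary F}
    (h : ∀ x y z x' y' z', f x y z = 0 → g x y z = 0 → f x' y' z' = 0 → g x' y' z' = 0 →
      y * z' = z * y' ∧ x * z' = z * x' ∧ x * y' = y * x') :
    ¬ HasTwoBasePoints (Submodule.span F {f, g}) := by
  rintro ⟨v, w, hvw, hv, hw⟩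
  obtain ⟨hf, hg⟩ := isBasePoint_span.mp hv
  obtain ⟨hf', hg'⟩ := isBasePoint_span.mp hw
  exact not_linearIndependent_of_cross (h _ _ _ _ _ _ hf hg hf' hg') hvw

theorem hasBaseLine_span {f g : Ternary F} (x y z x' y' z' : F)
    (h : ¬ (y * z' = z * y' ∧ x * z' = z * x' ∧ x * y' = y * x'))
    (hf : f x y z = 0) (hg : g x y z = 0) (hf' : f x' y' z' = 0) (hg' : g x' y' z' = 0)
    (hf'' : f (x + x') (y + y') (z + z') = 0) (hg'' : g (x + x') (y + y') (z + z') = 0) :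
    HasBaseLine (Submodule.span F {f, g}) :=
  ⟨![x, y, z], ![x', y', z'], linearIndependent_of_cross h, isBasePoint_span.mpr ⟨hf, hg⟩,
    isBasePoint_span.mpr ⟨hf', hg'⟩, isBasePoint_span.mpr ⟨hf'', hg''⟩⟩

theorem not_hasBaseLine_span {f g : Ternary F}
    (h : ∀ x y z x' y' z', f x y z = 0 → g x y z = 0 → f x' y' z' = 0 → g x' y' z' = 0 →
      f (x + x') (y + y') (z + z') = 0 → g (x + x') (y + y') (z + z') = 0 →
      y * z' = z * y' ∧ x * z' = z * x' ∧ x * y' = y * x') :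
    ¬ HasBaseLine (Submodule.span F {f, g}) := by
  rintro ⟨v, w, hvw, hv, hw, hvw'⟩
  obtain ⟨hf, hg⟩ := isBasePoint_span.mp hv
  obtain ⟨hf', hg'⟩ := isBasePoint_span.mp hw
  obtain ⟨hf'', hg''⟩ := isBasePoint_span.mp hvw'
  exact not_linearIndependent_of_cross (h _ _ _ _ _ _ hf hg hf' hg' hf'' hg'') hvw

theorem hasSingularBasePoint_span (s t x y z : F) (h : ¬ (x = 0 ∧ y = 0 ∧ z = 0))
    (hf : quad n₀ n₁ n₂ d₀ d₁ d₂ x y z = 0) (hg : quad m₀ m₁ m₂ e₀ e₁ e₂ x y z = 0)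
    (h0 : ¬ (s * n₀ + t * m₀ = 0 ∧ s * n₁ + t * m₁ = 0 ∧ s * n₂ + t * m₂ = 0))
    (hs : (s * n₁ + t * m₁) * z = (s * n₂ + t * m₂) * y ∧
      (s * n₀ + t * m₀) * z = (s * n₂ + t * m₂) * x ∧
      (s * n₀ + t * m₀) * y = (s * n₁ + t * m₁) * x) :
    HasSingularBasePoint (Submodule.span F {quad n₀ n₁ n₂ d₀ d₁ d₂, quad m₀ m₁ m₂ e₀ e₁ e₂}) := by
  refine ⟨![x, y, z], vec_ne_zero.mpr h, isBasePoint_span.mpr ⟨hf, hg⟩, _,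
    Submodule.mem_span_pair.mpr ⟨s, t, rfl⟩, ?_, ?_⟩
  · intro hz
    rw [quad_combination] at hz
    have := quad_eq_zero hz
    exact h0 ⟨this.1, this.2.1, this.2.2.1⟩
  · rw [quad_combination, isSingularPoint_quad, ← quad_combination]
    refine ⟨?_, hs⟩
    change s * quad n₀ n₁ n₂ d₀ d₁ d₂ x y z + t * quad m₀ m₁ m₂ e₀ e₁ e₂ x y z = 0
    rw [hf, hg, mul_zero, mul_zero, add_zero]

theorem not_hasSingularBasePoint (h : ∀ s t x y z, quad n₀ n₁ n₂ d₀ d₁ d₂ x y z = 0 →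
    quad m₀ m₁ m₂ e₀ e₁ e₂ x y z = 0 →
    (s * n₁ + t * m₁) * z = (s * n₂ + t * m₂) * y →
    (s * n₀ + t * m₀) * z = (s * n₂ + t * m₂) * x →
    (s * n₀ + t * m₀) * y = (s * n₁ + t * m₁) * x →
    (x = 0 ∧ y = 0 ∧ z = 0) ∨ (s = 0 ∧ t = 0)) :
    ¬ HasSingularBasePoint (Submodule.span F {quad n₀ n₁ n₂ d₀ d₁ d₂, quad m₀ m₁ m₂ e₀ e₁ e₂}) := by
  rintro ⟨v, hv, hb, f, hf, hf0, hs⟩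
  obtain ⟨s, t, rfl⟩ := Submodule.mem_span_pair.mp hf
  rw [isBasePoint_span] at hb
  rw [quad_combination, isSingularPoint_quad] at hs
  rcases h s t _ _ _ hb.1 hb.2 hs.2.1 hs.2.2.1 hs.2.2.2 with h' | ⟨rfl, rfl⟩
  · exact vec_ne_zero.mp hv h'
  · simp at hf0

theorem hasTwoSingularConics_span (s t x y z s' t' x' y' z' : F) (hd : s * t' ≠ t * s')
    (hli : ∀ a b, a * n₀ + b * m₀ = 0 → a * n₁ + b * m₁ = 0 → a * n₂ + b * m₂ = 0 →
      a * d₀ + b * e₀ = 0 → a * d₁ + b * e₁ = 0 → a * d₂ + b * e₂ = 0 → a = 0 ∧ b = 0)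
    (h : ¬ (x = 0 ∧ y = 0 ∧ z = 0)) (h' : ¬ (x' = 0 ∧ y' = 0 ∧ z' = 0))
    (hs : s * quad n₀ n₁ n₂ d₀ d₁ d₂ x y z + t * quad m₀ m₁ m₂ e₀ e₁ e₂ x y z = 0 ∧
      (s * n₁ + t * m₁) * z = (s * n₂ + t * m₂) * y ∧
      (s * n₀ + t * m₀) * z = (s * n₂ + t * m₂) * x ∧
      (s * n₀ + t * m₀) * y = (s * n₁ + t * m₁) * x)
    (hs' : s' * quad n₀ n₁ n₂ d₀ d₁ d₂ x' y' z' + t' * quad m₀ m₁ m₂ e₀ e₁ e₂ x' y' z' = 0 ∧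
      (s' * n₁ + t' * m₁) * z' = (s' * n₂ + t' * m₂) * y' ∧
      (s' * n₀ + t' * m₀) * z' = (s' * n₂ + t' * m₂) * x' ∧
      (s' * n₀ + t' * m₀) * y' = (s' * n₁ + t' * m₁) * x') :
    HasTwoSingularConics (Submodule.span F {quad n₀ n₁ n₂ d₀ d₁ d₂, quad m₀ m₁ m₂ e₀ e₁ e₂}) := by
  refine ⟨_, Submodule.mem_span_pair.mpr ⟨s, t, rfl⟩, _, Submodule.mem_span_pair.mpr ⟨s', t', rfl⟩,
    ?_, ⟨![x, y, z], vec_ne_zero.mpr h, ?_⟩, ![x', y', z'], vec_ne_zero.mpr h', ?_⟩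
  · rw [LinearIndependent.pair_iff]
    intro a b hab
    rw [show a • (s • quad n₀ n₁ n₂ d₀ d₁ d₂ + t • quad m₀ m₁ m₂ e₀ e₁ e₂) +
        b • (s' • quad n₀ n₁ n₂ d₀ d₁ d₂ + t' • quad m₀ m₁ m₂ e₀ e₁ e₂) =
        (a * s + b * s') • quad n₀ n₁ n₂ d₀ d₁ d₂ +
          (a * t + b * t') • quad m₀ m₁ m₂ e₀ e₁ e₂ by module, quad_combination] at hab
    obtain ⟨k0, k1, k2, k3, k4, k5⟩ := quad_eq_zero hab
    have := hli _ _ k0 k1 k2 k3 k4 k5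
    have hd' : s * t' - t * s' ≠ 0 := sub_ne_zero.mpr hd
    constructor <;> apply mul_right_cancel₀ hd'
    · linear_combination t' * this.1 - s' * this.2
    · linear_combination s * this.2 - t * this.1
  · rw [quad_combination, isSingularPoint_quad, ← quad_combination]
    exact hs
  · rw [quad_combination, isSingularPoint_quad, ← quad_combination]
    exact hs'

/-- It is enough that only multiples of the second generator are singular, since two such multiples
are dependent. -/
theorem not_hasTwoSingularConics (h : ∀ s t x y z,
    s * quad n₀ n₁ n₂ d₀ d₁ d₂ x y z + t * quad m₀ m₁ m₂ e₀ e₁ e₂ x y z = 0 →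
    (s * n₁ + t * m₁) * z = (s * n₂ + t * m₂) * y →
    (s * n₀ + t * m₀) * z = (s * n₂ + t * m₂) * x →
    (s * n₀ + t * m₀) * y = (s * n₁ + t * m₁) * x →
    (x = 0 ∧ y = 0 ∧ z = 0) ∨ s = 0) :
    ¬ HasTwoSingularConics (Submodule.span F {quad n₀ n₁ n₂ d₀ d₁ d₂, quad m₀ m₁ m₂ e₀ e₁ e₂}) := by
  rintro ⟨f, hf, g, hg, hfg, ⟨v, hv, hsv⟩, w, hw, hsw⟩
  obtain ⟨s, t, rfl⟩ := Submodule.mem_span_pair.mp hf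
  obtain ⟨s', t', rfl⟩ := Submodule.mem_span_pair.mp hg
  rw [quad_combination, isSingularPoint_quad, ← quad_combination] at hsv hsw
  have h1 : s = 0 := (h s t _ _ _ hsv.1 hsv.2.1 hsv.2.2.1 hsv.2.2.2).resolve_left
    (vec_ne_zero.mp hv)
  have h2 : s' = 0 := (h s' t' _ _ _ hsw.1 hsw.2.1 hsw.2.2.1 hsw.2.2.2).resolve_left
    (vec_ne_zero.mp hw)
  subst h1 h2
  have h0 := hfg.ne_zero 0
  rw [LinearIndependent.pair_iff] at hfg
  have := (hfg t' (-t) (by module)).1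
  subst this
  have := (hfg 0 1 (by module)).2
  exact one_ne_zero this

end QuadInvariants

/-! ### Invariants of the fifteen representatives. -/

section OrbitIndices

variable {F : Type*} [Field F] [CharP F 2]

theorem orbitIndex_one :
    orbitIndex (Submodule.span F {quad 0 0 0 0 1 1, quad 1 0 0 0 0 0}) = 0 := by
  have h1 : HasDoubleLine (Submodule.span F {quad 0 0 0 0 1 1, quad 1 0 0 0 0 0}) :=
    hasDoubleLine_left (by simp) _
  have h2 : ¬ AllDouble (Submodule.span F {quad (F := F) 0 0 0 0 1 1, quad 1 0 0 0 0 0}) :=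
    not_allDouble_right (by simp)
  have h5 : ¬ HasTwoBasePoints
      (Submodule.span F {quad (F := F) 0 0 0 0 1 1, quad 1 0 0 0 0 0}) :=
    not_hasTwoBasePoints_span (by simp [quad]; grind)
  have h3 : ¬ HasBaseLine (Submodule.span F {quad (F := F) 0 0 0 0 1 1, quad 1 0 0 0 0 0}) :=
    not_hasBaseLine_span (by simp [quad]; grind)
  have h4 : HasBasePoint (Submodule.span F {quad (F := F) 0 0 0 0 1 1, quad 1 0 0 0 0 0}) :=
    hasBasePoint_span 1 0 0 (by simp) (by simp [quad]) (by simp [quad])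
  have h7 : HasTwoSingularConics
      (Submodule.span F {quad (F := F) 0 0 0 0 1 1, quad 1 0 0 0 0 0}) :=
    hasTwoSingularConics_span 1 0 1 0 0 0 1 1 0 0 (by simp) (by simp) (by simp) (by simp)
      (by simp [quad]) (by simp [quad])
  simp [orbitIndex, h1, h2, h3, h4, h5, h7]

theorem orbitIndex_two :
    orbitIndex (Submodule.span F {quad 0 0 0 0 0 1, quad 1 0 0 0 0 0}) = 1 := by
  have h1 : HasDoubleLine (Submodule.span F {quad 0 0 0 0 0 1, quad 1 0 0 0 0 0}) :=
    hasDoubleLine_left (by simp) _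
  have h2 : ¬ AllDouble (Submodule.span F {quad (F := F) 0 0 0 0 0 1, quad 1 0 0 0 0 0}) :=
    not_allDouble_right (by simp)
  have h3 : HasBaseLine (Submodule.span F {quad (F := F) 0 0 0 0 0 1, quad 1 0 0 0 0 0}) :=
    hasBaseLine_span 1 0 0 0 1 0 (by simp) (by simp [quad]) (by simp [quad]) (by simp [quad])
      (by simp [quad]) (by simp [quad]) (by simp [quad])
  simp [orbitIndex, h1, h2, h3]

theorem orbitIndex_three :
    orbitIndex (Submodule.span F {quad 0 0 0 0 1 0, quad 0 0 0 0 0 1}) = 2 := by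
  have h1 : HasDoubleLine (Submodule.span F {quad 0 0 0 0 1 0, quad 0 0 0 0 0 1}) :=
    hasDoubleLine_left (by simp) _
  have h2 : AllDouble (Submodule.span F {quad (F := F) 0 0 0 0 1 0, quad 0 0 0 0 0 1}) :=
    allDouble_squares
  simp [orbitIndex, h1, h2]

theorem orbitIndex_four :
    orbitIndex (Submodule.span F {quad 0 0 1 0 0 0, quad 1 0 0 0 0 0}) = 3 := by
  have h1 : ¬ HasDoubleLine (Submodule.span F {quad (F := F) 0 0 1 0 0 0, quad 1 0 0 0 0 0}) :=
    not_hasDoubleLine (by simp)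
  have h3 : HasBaseLine (Submodule.span F {quad (F := F) 0 0 1 0 0 0, quad 1 0 0 0 0 0}) :=
    hasBaseLine_span 1 0 0 0 0 1 (by simp) (by simp [quad]) (by simp [quad]) (by simp [quad])
      (by simp [quad]) (by simp [quad]) (by simp [quad])
  simp [orbitIndex, h1, h3]

theorem orbitIndex_five :
    orbitIndex (Submodule.span F {quad 0 0 1 0 0 1, quad 0 0 0 1 0 0}) = 4 := by
  have h1 : HasDoubleLine (Submodule.span F {quad 0 0 1 0 0 1, quad 0 0 0 1 0 0}) :=
    hasDoubleLine_right (by simp) _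
  have h2 : ¬ AllDouble (Submodule.span F {quad (F := F) 0 0 1 0 0 1, quad 0 0 0 1 0 0}) :=
    not_allDouble_left (by simp)
  have h5 : ¬ HasTwoBasePoints
      (Submodule.span F {quad (F := F) 0 0 1 0 0 1, quad 0 0 0 1 0 0}) :=
    not_hasTwoBasePoints_span (by simp [quad]; grind)
  have h3 : ¬ HasBaseLine (Submodule.span F {quad (F := F) 0 0 1 0 0 1, quad 0 0 0 1 0 0}) :=
    not_hasBaseLine_span (by simp [quad]; grind)
  have h4 : HasBasePoint (Submodule.span F {quad (F := F) 0 0 1 0 0 1, quad 0 0 0 1 0 0}) :=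
    hasBasePoint_span 0 1 0 (by simp) (by simp [quad]) (by simp [quad])
  have h7 : ¬ HasTwoSingularConics
      (Submodule.span F {quad (F := F) 0 0 1 0 0 1, quad 0 0 0 1 0 0}) :=
    not_hasTwoSingularConics (by simp [quad]; grind)
  simp [orbitIndex, h1, h2, h3, h4, h5, h7]

theorem orbitIndex_six :
    orbitIndex (Submodule.span F {quad 0 0 1 0 0 1, quad 0 0 0 0 0 1}) = 5 := by
  have h1 : HasDoubleLine (Submodule.span F {quad 0 0 1 0 0 1, quad 0 0 0 0 0 1}) :=
    hasDoubleLine_right (by simp) _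
  have h2 : ¬ AllDouble (Submodule.span F {quad (F := F) 0 0 1 0 0 1, quad 0 0 0 0 0 1}) :=
    not_allDouble_left (by simp)
  have h3 : ¬ HasBaseLine (Submodule.span F {quad (F := F) 0 0 1 0 0 1, quad 0 0 0 0 0 1}) :=
    not_hasBaseLine_span (by simp [quad]; grind)
  have h5 : HasTwoBasePoints
      (Submodule.span F {quad (F := F) 0 0 1 0 0 1, quad 0 0 0 0 0 1}) :=
    hasTwoBasePoints_span 1 0 0 0 1 0 (by simp) (by simp [quad]) (by simp [quad])
      (by simp [quad]) (by simp [quad])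
  simp [orbitIndex, h1, h2, h3, h5]

theorem orbitIndex_seven {γ : F} (hγ : ∀ x y, x ^ 2 + γ * x * y + y ^ 2 = 0 → x = 0 ∧ y = 0) :
    orbitIndex (Submodule.span F {quad 0 0 1 0 0 1, quad 0 0 0 1 1 (γ ^ 2)}) = 6 := by
  have h1 : HasDoubleLine (Submodule.span F {quad 0 0 1 0 0 1, quad 0 0 0 1 1 (γ ^ 2)}) :=
    hasDoubleLine_right (by simp) _
  have h2 : ¬ AllDouble (Submodule.span F {quad (F := F) 0 0 1 0 0 1, quad 0 0 0 1 1 (γ ^ 2)}) :=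
    not_allDouble_left (by simp)
  have h4 : ¬ HasBasePoint
      (Submodule.span F {quad (F := F) 0 0 1 0 0 1, quad 0 0 0 1 1 (γ ^ 2)}) :=
    not_hasBasePoint_span (by
      intro x y z h h'
      simp only [quad] at h h'
      -- On the double line x = y + γz, the other conic restricts to an anisotropic binary form.
      have hl : x + y + γ * z = 0 := by
        rw [← sq_eq_zero_iff]
        grind
      have := hγ x z (by grind)
      grind)
  have h5 : ¬ HasTwoBasePoints
      (Submodule.span F {quad (F := F) 0 0 1 0 0 1, quad 0 0 0 1 1 (γ ^ 2)}) :=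
    fun ⟨v, w, hvw, hv, _⟩ => h4 ⟨v, hvw.ne_zero 0, hv⟩
  have h3 : ¬ HasBaseLine (Submodule.span F {quad (F := F) 0 0 1 0 0 1, quad 0 0 0 1 1 (γ ^ 2)}) :=
    fun ⟨v, w, hvw, hv, _⟩ => h4 ⟨v, hvw.ne_zero 0, hv⟩
  simp [orbitIndex, h1, h2, h3, h4, h5]

theorem orbitIndex_eight :
    orbitIndex (Submodule.span F {quad 0 0 1 0 0 1, quad 1 1 1 0 0 1}) = 7 := by
  have h1 : ¬ HasDoubleLine (Submodule.span F {quad (F := F) 0 0 1 0 0 1, quad 1 1 1 0 0 1}) :=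
    not_hasDoubleLine (by simp)
  have h3 : ¬ HasBaseLine (Submodule.span F {quad (F := F) 0 0 1 0 0 1, quad 1 1 1 0 0 1}) :=
    not_hasBaseLine_span (by simp [quad]; grind)
  have h5 : HasTwoBasePoints
      (Submodule.span F {quad (F := F) 0 0 1 0 0 1, quad 1 1 1 0 0 1}) :=
    hasTwoBasePoints_span 1 0 0 0 1 0 (by simp) (by simp [quad]) (by simp [quad])
      (by simp [quad]) (by simp [quad])
  have h6 : HasSingularBasePoint
      (Submodule.span F {quad (F := F) 0 0 1 0 0 1, quad 1 1 1 0 0 1}) :=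
    hasSingularBasePoint_span 0 1 1 1 1 (by simp) (by simp [quad]; grind) (by simp [quad]; grind)
      (by simp) (by simp)
  have h7 : HasTwoSingularConics
      (Submodule.span F {quad (F := F) 0 0 1 0 0 1, quad 1 1 1 0 0 1}) :=
    hasTwoSingularConics_span 1 1 1 1 0 0 1 1 1 1 (by simp) (by simp) (by simp) (by simp)
      (by simp [quad]; grind) (by simp [quad]; grind)
  simp [orbitIndex, h1, h3, h5, h6, h7]

theorem orbitIndex_nine :
    orbitIndex (Submodule.span F {quad 0 0 1 1 0 0, quad 1 0 0 0 0 1}) = 8 := by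
  have h1 : ¬ HasDoubleLine (Submodule.span F {quad (F := F) 0 0 1 1 0 0, quad 1 0 0 0 0 1}) :=
    not_hasDoubleLine (by simp)
  have h3 : ¬ HasBaseLine (Submodule.span F {quad (F := F) 0 0 1 1 0 0, quad 1 0 0 0 0 1}) :=
    not_hasBaseLine_span (by simp [quad]; grind)
  have h5 : HasTwoBasePoints
      (Submodule.span F {quad (F := F) 0 0 1 1 0 0, quad 1 0 0 0 0 1}) :=
    hasTwoBasePoints_span 0 1 0 0 1 1 (by simp) (by simp [quad]) (by simp [quad])
      (by simp [quad]) (by simp [quad]; grind)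
  have h6 : ¬ HasSingularBasePoint
      (Submodule.span F {quad (F := F) 0 0 1 1 0 0, quad 1 0 0 0 0 1}) :=
    not_hasSingularBasePoint (by simp [quad]; grind)
  have h7 : HasTwoSingularConics
      (Submodule.span F {quad (F := F) 0 0 1 1 0 0, quad 1 0 0 0 0 1}) :=
    hasTwoSingularConics_span 1 0 0 0 1 0 1 1 0 0 (by simp) (by simp) (by simp) (by simp)
      (by simp [quad]) (by simp [quad])
  simp [orbitIndex, h1, h3, h5, h6, h7]

theorem orbitIndex_ten {γ : F} (hγ : ∀ x y, x ^ 2 + γ * x * y + y ^ 2 = 0 → x = 0 ∧ y = 0) :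
    orbitIndex (Submodule.span F {quad 0 0 1 0 0 1, quad γ 0 1 0 1 0}) = 9 := by
  have h1 : ¬ HasDoubleLine (Submodule.span F {quad (F := F) 0 0 1 0 0 1, quad γ 0 1 0 1 0}) := by
    have : γ ≠ 0 := by
      rintro rfl
      exact one_ne_zero (hγ 1 1 (by grind)).1
    exact not_hasDoubleLine (by simp; grind)
  have hb : ∀ x y z : F, quad 0 0 1 0 0 1 x y z = 0 → quad γ 0 1 0 1 0 x y z = 0 →
      y = 0 ∧ z = 0 := by
    intro x y z h h'
    simp only [quad] at h h'
    -- The second generator is a product of two lines: the first meets xy + z² = 0 only at (1, 0,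
    -- 0), the second at no point over F.
    have hy : y * (x + y + γ * z) = 0 := by grind
    rcases mul_eq_zero.mp hy with hy | hy
    · subst hy
      simpa using h
    · exact hγ y z (by grind)
  have h5 : ¬ HasTwoBasePoints
      (Submodule.span F {quad (F := F) 0 0 1 0 0 1, quad γ 0 1 0 1 0}) :=
    not_hasTwoBasePoints_span (by
      intro x y z x' y' z' h h' k k'
      obtain ⟨rfl, rfl⟩ := hb _ _ _ h h'
      obtain ⟨rfl, rfl⟩ := hb _ _ _ k k'
      simp)
  have h3 : ¬ HasBaseLine (Submodule.span F {quad (F := F) 0 0 1 0 0 1, quad γ 0 1 0 1 0}) :=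
    fun ⟨v, w, hvw, hv, hw, _⟩ => h5 ⟨v, w, hvw, hv, hw⟩
  have h4 : HasBasePoint (Submodule.span F {quad (F := F) 0 0 1 0 0 1, quad γ 0 1 0 1 0}) :=
    hasBasePoint_span 1 0 0 (by simp) (by simp [quad]) (by simp [quad])
  have h6 : HasSingularBasePoint
      (Submodule.span F {quad (F := F) 0 0 1 0 0 1, quad γ 0 1 0 1 0}) := by
    have : γ ≠ 0 := by
      rintro rfl
      exact one_ne_zero (hγ 1 1 (by grind)).1
    exact hasSingularBasePoint_span 1 1 1 0 0 (by simp) (by simp [quad]) (by simp [quad])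
      (by simpa using fun h => absurd h this) (by simp; grind)
  simp [orbitIndex, h1, h3, h4, h5, h6]

theorem orbitIndex_eleven :
    orbitIndex (Submodule.span F {quad 0 0 1 0 0 1, quad 1 0 0 0 0 0}) = 10 := by
  have h1 : ¬ HasDoubleLine (Submodule.span F {quad (F := F) 0 0 1 0 0 1, quad 1 0 0 0 0 0}) :=
    not_hasDoubleLine (by simp)
  have h3 : ¬ HasBaseLine (Submodule.span F {quad (F := F) 0 0 1 0 0 1, quad 1 0 0 0 0 0}) :=
    not_hasBaseLine_span (by simp [quad]; grind)
  have h5 : HasTwoBasePoints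
      (Submodule.span F {quad (F := F) 0 0 1 0 0 1, quad 1 0 0 0 0 0}) :=
    hasTwoBasePoints_span 1 0 0 0 1 0 (by simp) (by simp [quad]) (by simp [quad])
      (by simp [quad]) (by simp [quad])
  have h6 : HasSingularBasePoint
      (Submodule.span F {quad (F := F) 0 0 1 0 0 1, quad 1 0 0 0 0 0}) :=
    hasSingularBasePoint_span 0 1 1 0 0 (by simp) (by simp [quad]) (by simp [quad])
      (by simp) (by simp)
  have h7 : ¬ HasTwoSingularConics
      (Submodule.span F {quad (F := F) 0 0 1 0 0 1, quad 1 0 0 0 0 0}) :=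
    not_hasTwoSingularConics (by simp [quad]; grind)
  simp [orbitIndex, h1, h3, h5, h6, h7]

theorem orbitIndex_twelve {γ : F} (hγ : ∀ x y, x ^ 2 + γ * x * y + y ^ 2 = 0 → x = 0 ∧ y = 0) :
    orbitIndex (Submodule.span F {quad 0 0 1 0 0 1, quad 1 1 0 0 0 γ}) = 11 := by
  have h1 : ¬ HasDoubleLine (Submodule.span F {quad (F := F) 0 0 1 0 0 1, quad 1 1 0 0 0 γ}) :=
    not_hasDoubleLine (by simp)
  have hb : ∀ x y z : F, quad 0 0 1 0 0 1 x y z = 0 → quad 1 1 0 0 0 γ x y z = 0 → z = 0 := by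
    intro x y z h h'
    simp only [quad] at h h'
    have hz : z * (x + y + γ * z) = 0 := by grind
    rcases mul_eq_zero.mp hz with hz | hz
    · exact hz
    · exact (hγ x z (by grind)).2
  have h3 : ¬ HasBaseLine (Submodule.span F {quad (F := F) 0 0 1 0 0 1, quad 1 1 0 0 0 γ}) :=
    not_hasBaseLine_span (by
      intro x y z x' y' z' h h' k k' l l'
      have h1 := hb _ _ _ h h'
      have h2 := hb _ _ _ k k'
      subst h1 h2
      simp [quad] at h k l ⊢
      grind)
  have h5 : HasTwoBasePoints
      (Submodule.span F {quad (F := F) 0 0 1 0 0 1, quad 1 1 0 0 0 γ}) :=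
    hasTwoBasePoints_span 1 0 0 0 1 0 (by simp) (by simp [quad]) (by simp [quad])
      (by simp [quad]) (by simp [quad])
  have h6 : ¬ HasSingularBasePoint
      (Submodule.span F {quad (F := F) 0 0 1 0 0 1, quad 1 1 0 0 0 γ}) :=
    not_hasSingularBasePoint (by
      intro s t x y z h h' k1 k2 k3
      have hz := hb _ _ _ h h'
      subst hz
      simp [quad] at h k1 k2 k3 ⊢
      grind)
  have h7 : ¬ HasTwoSingularConics
      (Submodule.span F {quad (F := F) 0 0 1 0 0 1, quad 1 1 0 0 0 γ}) :=
    not_hasTwoSingularConics (by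
      intro s t x y z h k1 k2 k3
      simp [quad] at h k1 k2 k3 ⊢
      -- The member with parameters (s, t) has nucleus (t, t, s), where its value is s(s² + γst +
      -- t²), so s = 0 gives its only zero over F.
      have hz : s * (z ^ 2 * (s ^ 2 + γ * s * t + t ^ 2)) = 0 := by grind
      rcases mul_eq_zero.mp hz with hs | hz
      · exact Or.inr hs
      · rcases mul_eq_zero.mp hz with hz | hst
        · have := pow_eq_zero_iff two_ne_zero |>.mp hz
          grind
        · exact Or.inr (hγ s t hst).1)
  simp [orbitIndex, h1, h3, h5, h6, h7]

theorem orbitIndex_thirteen {γ : F} (hγ : ∀ x y, γ * x ^ 2 + x * y + y ^ 2 = 0 → x = 0 ∧ y = 0) :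
    orbitIndex (Submodule.span F {quad 0 0 1 γ 1 0, quad 0 1 0 γ 0 1}) = 12 := by
  have h1 : ¬ HasDoubleLine (Submodule.span F {quad (F := F) 0 0 1 γ 1 0, quad 0 1 0 γ 0 1}) :=
    not_hasDoubleLine (by simp)
  have h4 : ¬ HasBasePoint
      (Submodule.span F {quad (F := F) 0 0 1 γ 1 0, quad 0 1 0 γ 0 1}) :=
    not_hasBasePoint_span (by
      intro x y z h h'
      simp [quad] at h h'
      have := hγ x y (by grind)
      have := hγ x z (by grind)
      grind)
  have h5 : ¬ HasTwoBasePoints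
      (Submodule.span F {quad (F := F) 0 0 1 γ 1 0, quad 0 1 0 γ 0 1}) :=
    fun ⟨v, w, hvw, hv, _⟩ => h4 ⟨v, hvw.ne_zero 0, hv⟩
  have h3 : ¬ HasBaseLine (Submodule.span F {quad (F := F) 0 0 1 γ 1 0, quad 0 1 0 γ 0 1}) :=
    fun ⟨v, w, hvw, hv, _⟩ => h4 ⟨v, hvw.ne_zero 0, hv⟩
  have h7 : HasTwoSingularConics
      (Submodule.span F {quad (F := F) 0 0 1 γ 1 0, quad 0 1 0 γ 0 1}) :=
    hasTwoSingularConics_span 1 0 0 0 1 0 1 0 1 0 (by simp) (by simp) (by simp) (by simp)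
      (by simp [quad]) (by simp [quad])
  simp [orbitIndex, h1, h3, h4, h5, h7]

theorem orbitIndex_fourteen {γ : F} (hγ : ∀ x y, γ * x ^ 2 + x * y + y ^ 2 = 0 → x = 0 ∧ y = 0) :
    orbitIndex (Submodule.span F {quad 0 1 0 0 1 γ, quad 0 0 1 γ 1 0}) = 13 := by
  have h1 : ¬ HasDoubleLine (Submodule.span F {quad (F := F) 0 1 0 0 1 γ, quad 0 0 1 γ 1 0}) :=
    not_hasDoubleLine (by simp)
  have hγ0 : γ ≠ 0 := by
    rintro rfl
    exact one_ne_zero (hγ 1 0 (by simp)).1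
  have h4 : ¬ HasBasePoint
      (Submodule.span F {quad (F := F) 0 1 0 0 1 γ, quad 0 0 1 γ 1 0}) :=
    not_hasBasePoint_span (by
      intro x y z h h'
      simp [quad] at h h'
      have := hγ x y (by grind)
      grind)
  have h5 : ¬ HasTwoBasePoints
      (Submodule.span F {quad (F := F) 0 1 0 0 1 γ, quad 0 0 1 γ 1 0}) :=
    fun ⟨v, w, hvw, hv, _⟩ => h4 ⟨v, hvw.ne_zero 0, hv⟩
  have h3 : ¬ HasBaseLine (Submodule.span F {quad (F := F) 0 1 0 0 1 γ, quad 0 0 1 γ 1 0}) :=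
    fun ⟨v, w, hvw, hv, _⟩ => h4 ⟨v, hvw.ne_zero 0, hv⟩
  have h7 : ¬ HasTwoSingularConics
      (Submodule.span F {quad (F := F) 0 1 0 0 1 γ, quad 0 0 1 γ 1 0}) :=
    not_hasTwoSingularConics (by
      intro s t x y z h k1 k2 k3
      simp [quad] at h k1 k2 k3 ⊢
      -- Here the nucleus is (0, s, t) and the value there is s(s² + st + γt²).
      have hy : s * (y ^ 2 * (γ * t ^ 2 + t * s + s ^ 2)) = 0 := by grind
      rcases mul_eq_zero.mp hy with hs | hy
      · exact Or.inr hs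
      · rcases mul_eq_zero.mp hy with hy | hst
        · have := pow_eq_zero_iff two_ne_zero |>.mp hy
          grind
        · exact Or.inr (hγ t s hst).2)
  simp [orbitIndex, h1, h3, h4, h5, h7]

theorem orbitIndex_fifteen {b c : F} (h : Rootless b 0 c 1) :
    orbitIndex (Submodule.span F {quad 0 0 1 0 0 1, quad 0 1 0 0 b c}) = 14 := by
  have h1 : ¬ HasDoubleLine (Submodule.span F {quad (F := F) 0 0 1 0 0 1, quad 0 1 0 0 b c}) :=
    not_hasDoubleLine (by simp)
  have hb : ∀ x y z : F, quad 0 0 1 0 0 1 x y z = 0 → quad 0 1 0 0 b c x y z = 0 →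
      y = 0 ∧ z = 0 := by
    intro x y z h' h''
    simp [quad] at h' h''
    -- Multiplying the second equation by y and replacing xy by z² eliminates x and leaves by³ +
    -- cyz² + z³ = 0.
    exact h y z (by grind)
  have h5 : ¬ HasTwoBasePoints
      (Submodule.span F {quad (F := F) 0 0 1 0 0 1, quad 0 1 0 0 b c}) :=
    not_hasTwoBasePoints_span (by
      intro x y z x' y' z' h h' k k'
      obtain ⟨rfl, rfl⟩ := hb _ _ _ h h'
      obtain ⟨rfl, rfl⟩ := hb _ _ _ k k'
      simp)
  have h3 : ¬ HasBaseLine (Submodule.span F {quad (F := F) 0 0 1 0 0 1, quad 0 1 0 0 b c}) :=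
    fun ⟨v, w, hvw, hv, hw, _⟩ => h5 ⟨v, w, hvw, hv, hw⟩
  have h4 : HasBasePoint (Submodule.span F {quad (F := F) 0 0 1 0 0 1, quad 0 1 0 0 b c}) :=
    hasBasePoint_span 1 0 0 (by simp) (by simp [quad]) (by simp [quad])
  have h6 : ¬ HasSingularBasePoint
      (Submodule.span F {quad (F := F) 0 0 1 0 0 1, quad 0 1 0 0 b c}) :=
    not_hasSingularBasePoint (by
      intro s t x y z h h' k1 k2 k3
      obtain ⟨rfl, rfl⟩ := hb _ _ _ h h'
      simp at k1 k2 k3 ⊢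
      grind)
  simp [orbitIndex, h1, h3, h4, h5, h6]

end OrbitIndices

/-! ### From polynomial pencils to function systems. -/

section Forms

variable {F : Type*} [Field F]

/-- The ternary function of a polynomial. -/
def toTernary : MvPolynomial (Fin 3) F →ₗ[F] Ternary F where
  toFun f x y z := eval ![x, y, z] f
  map_add' f g := by
    funext x y z
    simp
  map_smul' c f := by
    funext x y z
    simp

theorem toTernary_apply (f : MvPolynomial (Fin 3) F) (x y z : F) :
    toTernary f x y z = eval ![x, y, z] f := rfl

theorem toTernary_subst (A : Matrix (Fin 3) (Fin 3) F) (f : MvPolynomial (Fin 3) F) :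
    toTernary (subst A f) = precomp A (toTernary f) := by
  funext x y z
  rw [precomp_apply, toTernary_apply, toTernary_apply, subst, AlgHom.toLinearMap_apply,
    ← MvPolynomial.aeval_eq_eval, MvPolynomial.aeval_bind₁, MvPolynomial.aeval_eq_eval]
  congr 2
  funext i
  rw [MvPolynomial.aeval_eq_eval, Matrix.toMvPolynomial_eval_eq_apply]
  fin_cases i <;> simp [Matrix.mulVec, dotProduct, Fin.sum_univ_three]

/-- The quadratic form with given coefficients. -/
def conicForm : (Fin 6 → F) →ₗ[F] MvPolynomial (Fin 3) F where
  toFun c := c 0 • (X 0 * X 0) + c 1 • (X 0 * X 1) + c 2 • (X 0 * X 2) + c 3 • (X 1 * X 1) +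
    c 4 • (X 1 * X 2) + c 5 • (X 2 * X 2)
  map_add' c d := by
    simp only [Pi.add_apply]
    module
  map_smul' r c := by
    simp only [Pi.smul_apply, smul_eq_mul, RingHom.id_apply]
    module

theorem conicForm_isHomogeneous (c : Fin 6 → F) : (conicForm c).IsHomogeneous 2 := by
  have h : ∀ (r : F) (i j : Fin 3), r • (X i * X j : MvPolynomial (Fin 3) F) ∈
      homogeneousSubmodule (Fin 3) F 2 := fun r i j =>
    Submodule.smul_mem _ r ((isHomogeneous_X F i).mul (isHomogeneous_X F j))
  change conicForm c ∈ homogeneousSubmodule (Fin 3) F 2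
  exact add_mem (add_mem (add_mem (add_mem (add_mem (h _ _ _) (h _ _ _)) (h _ _ _)) (h _ _ _))
    (h _ _ _)) (h _ _ _)

theorem coeff_X_mul_X_pair (i j : Fin 3) (d : Fin 3 →₀ ℕ) :
    coeff d (X i * X j : MvPolynomial (Fin 3) F) =
      if Finsupp.single i 1 + Finsupp.single j 1 = d then 1 else 0 := by
  rw [X, X, monomial_mul, coeff_monomial, one_mul]

theorem conicCoeffs_conicForm (c : Fin 6 → F) : conicCoeffs (conicForm c) = c := by
  have key : ∀ i j k l : Fin 3,
      (Finsupp.single i 1 + Finsupp.single j 1 : Fin 3 →₀ ℕ) =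
        Finsupp.single k 1 + Finsupp.single l 1 ↔ (i = k ∧ j = l) ∨ (i = l ∧ j = k) := by
    intro i j k l
    rw [Finsupp.ext_iff]
    simp only [Finsupp.add_apply, Finsupp.single_apply, Fin.forall_fin_succ, Fin.forall_fin_zero]
    revert i j k l
    decide
  funext k
  fin_cases k <;>
  simp [conicCoeffs, conicForm, coeff_X_mul_X_pair, key]

theorem conicForm_conicCoeffs {f : MvPolynomial (Fin 3) F} (hf : f.IsHomogeneous 2) :
    conicForm (conicCoeffs f) = f := by
  refine sub_eq_zero.mp (conicCoeffs_eq_zero ((conicForm_isHomogeneous _).sub hf) ?_)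
  rw [map_sub, conicCoeffs_conicForm, sub_self]

theorem toTernary_eq_quad {f : MvPolynomial (Fin 3) F} (hf : f.IsHomogeneous 2) :
    toTernary f = quad (conicCoeffs f 4) (conicCoeffs f 2) (conicCoeffs f 1) (conicCoeffs f 0)
      (conicCoeffs f 3) (conicCoeffs f 5) := by
  conv_lhs => rw [← conicForm_conicCoeffs hf]
  funext x y z
  simp [toTernary_apply, conicForm, quad]
  ring

theorem eq_of_toTernary_eq [CharP F 2] {f g : MvPolynomial (Fin 3) F} (hf : f.IsHomogeneous 2)
    (hg : g.IsHomogeneous 2) (h : toTernary f = toTernary g) : f = g := by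
  have hfg := hf.sub hg
  have h0 : toTernary (f - g) = 0 := by rw [map_sub, h, sub_self]
  rw [toTernary_eq_quad hfg] at h0
  obtain ⟨h4, h2, h1, h0, h3, h5⟩ := quad_eq_zero h0
  refine sub_eq_zero.mp (conicCoeffs_eq_zero hfg ?_)
  funext k
  fin_cases k
  exacts [h0, h1, h2, h3, h4, h5]

/-- The linear system of functions of a pencil. -/
def functionSystem (P : Pencil F) : Submodule F (Ternary F) := P.1.map toTernary

theorem functionSystem_smul (A : GL (Fin 3) F) (P : Pencil F) :
    functionSystem (A • P) = (functionSystem P).map (precomp (A⁻¹).1) := by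
  unfold functionSystem
  rw [Pencil.smul_val, ← Submodule.map_comp, ← Submodule.map_comp]
  congr 1
  exact LinearMap.ext fun f => toTernary_subst _ f

theorem functionSystem_injective [CharP F 2] :
    Function.Injective (functionSystem : Pencil F → Submodule F (Ternary F)) := by
  have key : ∀ P Q : Pencil F, functionSystem P = functionSystem Q → P.1 ≤ Q.1 := by
    intro P Q h f hf
    have : toTernary f ∈ functionSystem Q := h ▸ Submodule.mem_map_of_mem hf
    obtain ⟨g, hg, hfg⟩ := this
    rwa [← eq_of_toTernary_eq (Q.2.1 hg) (P.2.1 hf) hfg]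
  intro P Q h
  exact Subtype.ext (le_antisymm (key P Q h) (key Q P h.symm))

theorem mem_orbit_iff_equivalent [CharP F 2] (P Q : Pencil F) :
    Q ∈ MulAction.orbit (PGL 3 F) P ↔ Equivalent (functionSystem P) (functionSystem Q) := by
  constructor
  · rintro ⟨g, rfl⟩
    obtain ⟨A, rfl⟩ := QuotientGroup.mk_surjective g
    exact ⟨A⁻¹, functionSystem_smul A P⟩
  · rintro ⟨M, hM⟩
    -- The group acts by substituting the inverse matrix, so the substitution M is the action of
    -- M⁻¹.
    refine ⟨(QuotientGroup.mk M⁻¹ : PGL 3 F), functionSystem_injective ?_⟩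
    change functionSystem (M⁻¹ • P) = _
    rw [functionSystem_smul, inv_inv, hM]

theorem exists_generators (P : Pencil F) : ∃ f g, P.1 = Submodule.span F {f, g} ∧
    f.IsHomogeneous 2 ∧ g.IsHomogeneous 2 ∧ ∀ s t : F, s • f + t • g = 0 → s = 0 ∧ t = 0 := by
  have : Module.Finite F P.1 := Module.finite_of_finrank_eq_succ P.2.2
  let b := Module.finBasisOfFinrankEq F P.1 P.2.2
  refine ⟨(b 0).1, (b 1).1, ?_, P.2.1 (b 0).2, P.2.1 (b 1).2, ?_⟩
  · have h1 : Submodule.span F (Set.range b) = ⊤ := b.span_eq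
    have h2 := congrArg (Submodule.map P.1.subtype) h1
    rw [Submodule.map_span, Submodule.map_top, Submodule.range_subtype, ← Set.range_comp] at h2
    refine h2.symm.trans ?_
    congr 1
    ext f
    simp [Fin.exists_fin_two, eq_comm]
  · intro s t h
    have hli := b.linearIndependent
    rw [Fintype.linearIndependent_iff] at hli
    have := hli ![s, t] (by
      rw [Fin.sum_univ_two]
      exact Subtype.ext h)
    exact ⟨this 0, this 1⟩

theorem exists_normal_form [Finite F] [CharP F 2] {δ k₀ k₁ k₂ k₃ : F} (hδ : ∀ a, a + a ^ 2 ≠ δ)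
    (hk : Rootless k₀ k₁ k₂ k₃) (P : Pencil F) :
    ∃ j, Equivalent (functionSystem P) (Submodule.span F
      {(normalPair δ k₀ k₁ k₂ k₃ j).1, (normalPair δ k₀ k₁ k₂ k₃ j).2}) := by
  obtain ⟨f, g, hP, hf, hg, hfg⟩ := exists_generators P
  have hW : functionSystem P = Submodule.span F {toTernary f, toTernary g} := by
    rw [functionSystem, hP, Submodule.map_span, Set.image_pair]
  rw [hW]
  have hf' := toTernary_eq_quad hf
  have hg' := toTernary_eq_quad hg
  rw [hf', hg']
  refine hasNormalForm_quad hδ hk fun s t hst => hfg s t ?_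
  rw [← hf', ← hg'] at hst
  refine eq_of_toTernary_eq ?_ (isHomogeneous_zero _ _ _) ?_
  · exact add_mem (Submodule.smul_mem (homogeneousSubmodule (Fin 3) F 2) s hf)
      (Submodule.smul_mem (homogeneousSubmodule (Fin 3) F 2) t hg)
  · funext x y z
    rw [map_add, map_smul, map_smul, map_zero]
    exact hst x y z

end Forms

/-! ### The fifteen orbits of pencils. -/

section Classification

variable {F : Type*} [Field F] [Finite F] [CharP F 2]

theorem ne_zero_of_absTrace {γ : F} (h : absTrace γ = 1) : γ ≠ 0 := by
  rintro rfl
  exact add_sq_ne_of_absTrace h 0 (by simp)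

theorem elliptic_of_absTrace {γ : F} (h : absTrace γ = 1) (x y : F)
    (hxy : γ * x ^ 2 + x * y + y ^ 2 = 0) : x = 0 ∧ y = 0 := by
  by_cases hx : x = 0
  · subst hx
    simpa using hxy
  · exfalso
    apply add_sq_ne_of_absTrace h (y / x)
    field_simp
    grind

/-- The form is γ⁻²(γy)² + (γy)x + x², and γ⁻² has the same trace as γ⁻¹. -/
theorem elliptic_of_absTrace_inv {γ : F} (h : absTrace γ⁻¹ = 1) (x y : F)
    (hxy : x ^ 2 + γ * x * y + y ^ 2 = 0) : x = 0 ∧ y = 0 := by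
  have hγ : γ ≠ 0 := fun h0 => ne_zero_of_absTrace h (by rw [h0, _root_.inv_zero])
  rw [← absTrace_sq] at h
  have := elliptic_of_absTrace h (γ * y) x (by
    field_simp
    linear_combination hxy)
  simpa [hγ, and_comm] using this

theorem Parameters.rootless (p : Parameters F) : Rootless p.b 0 p.c 1 := by
  apply rootless_of_irreducible p.b_ne_zero
  have := p.irreducible_cubic
  simpa [cubicPoly] using this

theorem functionSystem_pencilRep (p : Parameters F) (i : Fin 15) :
    functionSystem (pencilRep p i) = Submodule.span F
      {toTernary (generatingConics p i).1, toTernary (generatingConics p i).2} := by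
  rw [functionSystem, pencilRep, Submodule.map_span, Set.image_pair]

theorem toTernary_generatingConics (p : Parameters F) (i : Fin 15) :
    (toTernary (generatingConics p i).1, toTernary (generatingConics p i).2) =
    (![(quad 0 0 0 0 1 1, quad 1 0 0 0 0 0),
      (quad 0 0 0 0 0 1, quad 1 0 0 0 0 0),
      (quad 0 0 0 0 1 0, quad 0 0 0 0 0 1),
      (quad 0 0 1 0 0 0, quad 1 0 0 0 0 0),
      (quad 0 0 1 0 0 1, quad 0 0 0 1 0 0),
      (quad 0 0 1 0 0 1, quad 0 0 0 0 0 1),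
      (quad 0 0 1 0 0 1, quad 0 0 0 1 1 (p.γ₇ ^ 2)),
      (quad 0 0 1 0 0 1, quad 1 1 1 0 0 1),
      (quad 0 0 1 1 0 0, quad 1 0 0 0 0 1),
      (quad 0 0 1 0 0 1, quad p.γ₁₀ 0 1 0 1 0),
      (quad 0 0 1 0 0 1, quad 1 0 0 0 0 0),
      (quad 0 0 1 0 0 1, quad 1 1 0 0 0 p.γ₁₂),
      (quad 0 0 1 p.γ₁₃ 1 0, quad 0 1 0 p.γ₁₃ 0 1),
      (quad 0 1 0 0 1 p.γ₁₄, quad 0 0 1 p.γ₁₄ 1 0),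
      (quad 0 0 1 0 0 1, quad 0 1 0 0 p.b p.c)] : Fin 15 → Ternary F × Ternary F) i := by
  refine Prod.ext ?_ ?_ <;> funext x y z <;> fin_cases i <;>
    simp [toTernary_apply, generatingConics, quad] <;> grind

theorem orbitIndex_pencilRep (p : Parameters F) (i : Fin 15) :
    orbitIndex (functionSystem (pencilRep p i)) = i := by
  have h := toTernary_generatingConics p i
  have h₁ : toTernary (generatingConics p i).1 = _ := congrArg Prod.fst h
  have h₂ : toTernary (generatingConics p i).2 = _ := congrArg Prod.snd h
  rw [functionSystem_pencilRep, h₁, h₂]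
  fin_cases i
  exacts [orbitIndex_one, orbitIndex_two, orbitIndex_three, orbitIndex_four, orbitIndex_five,
    orbitIndex_six, orbitIndex_seven (elliptic_of_absTrace_inv p.trace_γ₇), orbitIndex_eight,
    orbitIndex_nine, orbitIndex_ten (elliptic_of_absTrace_inv p.trace_γ₁₀), orbitIndex_eleven,
    orbitIndex_twelve (elliptic_of_absTrace_inv p.trace_γ₁₂),
    orbitIndex_thirteen (elliptic_of_absTrace p.trace_γ₁₃),
    orbitIndex_fourteen (elliptic_of_absTrace p.trace_γ₁₄),
    orbitIndex_fifteen (Parameters.rootless p)]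

/-- Since there are as many normal forms as pairwise inequivalent representatives, every pencil
is equivalent to a representative. -/
theorem existsUnique_pencilRep (p : Parameters F) (P : Pencil F) :
    ∃! i : Fin 15, P ∈ MulAction.orbit (PGL 3 F) (pencilRep p i) := by
  obtain ⟨δ, hδ⟩ := exists_artinSchreier_ne F
  choose j hj using exists_normal_form hδ (Parameters.rootless p)
  -- Representatives with a common normal form are equivalent, so they have the same `orbitIndex`.
  -- Both index sets have fifteen elements, so this injection is onto.
  have hinj : Function.Injective fun i => j (pencilRep p i) := by
    intro i i' h
    have h' : j (pencilRep p i) = j (pencilRep p i') := h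
    have e := (hj (pencilRep p i)).trans (h' ▸ (hj (pencilRep p i')).symm)
    rw [← orbitIndex_pencilRep p i, ← orbitIndex_pencilRep p i', e.orbitIndex_eq]
  obtain ⟨i, hi⟩ := Finite.surjective_of_injective hinj (j P)
  have hi' : j (pencilRep p i) = j P := hi
  refine ⟨i, (mem_orbit_iff_equivalent _ _).mpr
    ((hj (pencilRep p i)).trans (hi' ▸ (hj P).symm)), fun i' h' => ?_⟩
  replace h' := (mem_orbit_iff_equivalent _ _).mp h'
  rw [← orbitIndex_pencilRep p i', h'.orbitIndex_eq,
    ← orbitIndex_pencilRep p i]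
  exact ((hj P).trans (hi' ▸ (hj (pencilRep p i)).symm)).orbitIndex_eq

theorem exists_parameters (F : Type*) [Field F] [Finite F] [CharP F 2] :
    Nonempty (Parameters F) := by
  obtain ⟨γ, hγ⟩ := exists_absTrace_eq_one F
  obtain ⟨b, c, h⟩ := exists_rootless_depressed F
  have hγ' : absTrace (γ⁻¹)⁻¹ = 1 := by rwa [inv_inv]
  exact ⟨⟨γ⁻¹, γ⁻¹, γ⁻¹, γ, γ, b, c, hγ', hγ', hγ', hγ, hγ, h.leading_ne_zero,
    by simpa [cubicPoly] using h.irreducible⟩⟩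

theorem card_orbitRel_quotient {G X : Type*} [Group G] [MulAction G X] {n : ℕ} (r : Fin n → X)
    (h : ∀ x, ∃! i, x ∈ MulAction.orbit G (r i)) :
    Nat.card (MulAction.orbitRel.Quotient G X) = n := by
  have hbij : Function.Bijective
      (fun i => (Quotient.mk'' (r i) : MulAction.orbitRel.Quotient G X)) := by
    constructor
    · intro i i' hii
      have : r i ∈ MulAction.orbit G (r i') :=
        MulAction.orbitRel_apply.mp (Quotient.exact' hii)
      exact (h (r i)).unique (MulAction.mem_orbit_self _) this
    · intro q
      induction q using Quotient.inductionOn' with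
      | h x =>
        obtain ⟨i, hi, -⟩ := h x
        exact ⟨i, (Quotient.sound' (MulAction.orbitRel_apply.mpr hi)).symm⟩
  rw [← Nat.card_eq_of_bijective _ hbij, Nat.card_fin]

end Classification

/-! ### Duality and the transfer to solids. -/

section Solids

variable {F : Type*} [Field F]

/-- If A M Aᵀ = cM for all symmetric M, the diagonal matrix units force the off-diagonal entries of
A to vanish, and the symmetric sums of two off-diagonal units force its diagonal entries to be
equal. -/
theorem veroneseLift_injective : Function.Injective (veroneseLift F) := by
  rw [injective_iff_map_eq_one]
  intro g hg
  obtain ⟨A, rfl⟩ := QuotientGroup.mk_surjective g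
  have h1 : (QuotientGroup.mk (Units.map (veroneseMatrix (F := F)) A) : PGL 6 F) = 1 := hg
  rw [QuotientGroup.eq_one_iff, Matrix.GeneralLinearGroup.mem_center_iff_val_mem_range_scalar]
    at h1
  obtain ⟨c, hc⟩ := h1
  rw [Units.coe_map] at hc
  have key : ∀ y : Fin 6 → F, A.1 * symMatrix y * (A.1)ᵀ = c • symMatrix y := by
    intro y
    rw [← symMatrix_veroneseLin, ← veroneseMatrix_mulVec]
    have hc' : veroneseMatrix A.1 = Matrix.scalar (Fin 6) c := hc.symm
    rw [hc']
    ext i j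
    fin_cases i <;> fin_cases j <;> simp [symMatrix, Matrix.mulVec_diagonal]
  have hc0 : c ≠ 0 := by
    rintro rfl
    have h := key ![1, 0, 0, 1, 0, 1]
    have h1 : symMatrix (![1, 0, 0, 1, 0, 1] : Fin 6 → F) = 1 := by
      ext i j
      fin_cases i <;> fin_cases j <;> rfl
    rw [h1, Matrix.mul_one, zero_smul] at h
    have hdet := congrArg Matrix.det h
    rw [Matrix.det_mul, Matrix.det_transpose, Matrix.det_zero, mul_self_eq_zero] at hdet
    exact A.isUnit.map Matrix.detMonoidHom |>.ne_zero hdet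
  rw [QuotientGroup.eq_one_iff, Matrix.GeneralLinearGroup.mem_center_iff_val_mem_range_scalar]
  refine ⟨A.1 0 0, ?_⟩
  have e : ∀ (y : Fin 6 → F) (i j : Fin 3),
      (A.1 * symMatrix y * (A.1)ᵀ) i j = c * symMatrix y i j := fun y i j => by
    rw [key]; rfl
  have a00 := e ![1, 0, 0, 0, 0, 0] 0 0
  have a11 := e ![1, 0, 0, 0, 0, 0] 1 1
  have a22 := e ![1, 0, 0, 0, 0, 0] 2 2
  have b00 := e ![0, 0, 0, 1, 0, 0] 0 0
  have b11 := e ![0, 0, 0, 1, 0, 0] 1 1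
  have b22 := e ![0, 0, 0, 1, 0, 0] 2 2
  have c00 := e ![0, 0, 0, 0, 0, 1] 0 0
  have c11 := e ![0, 0, 0, 0, 0, 1] 1 1
  have c22 := e ![0, 0, 0, 0, 0, 1] 2 2
  have d01 := e ![0, 1, 0, 0, 0, 0] 0 1
  have d02 := e ![0, 0, 1, 0, 0, 0] 0 2
  simp [Matrix.mul_apply, Fin.sum_univ_three, symMatrix]
    at a00 a11 a22 b00 b11 b22 c00 c11 c22 d01 d02
  simp [b00, c00, a11, a22] at d01 d02
  have h00 : A.1 0 0 ≠ 0 := by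
    intro h
    rw [h] at a00
    simp at a00
    exact hc0 a00.symm
  have h11 : A.1 1 1 = A.1 0 0 := mul_left_cancel₀ h00 (by rw [d01, a00])
  have h22 : A.1 2 2 = A.1 0 0 := mul_left_cancel₀ h00 (by rw [d02, a00])
  ext i j
  fin_cases i <;> fin_cases j <;> simp [h11, h22, a11, a22, b00, b22, c00, c11]

/-- Paired with the rank one matrix v vᵀ, a form f gives f(v), and A(v vᵀ)Aᵀ = (Av)(Av)ᵀ; such
matrices span the symmetric ones. The six evaluation points used here correspond to a basis of this
kind. -/
theorem dotProduct_conicCoeffs_subst [CharP F 2] (A : Matrix (Fin 3) (Fin 3) F)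
    {f : MvPolynomial (Fin 3) F} (hf : f.IsHomogeneous 2) (y : Fin 6 → F) :
    conicCoeffs (subst A f) ⬝ᵥ y = conicCoeffs f ⬝ᵥ veroneseLin A y := by
  have h : ∀ u v w, toTernary (subst A f) u v w = precomp A (toTernary f) u v w := by
    intro u v w
    rw [toTernary_subst]
  rw [toTernary_eq_quad (subst_homogeneous A hf), toTernary_eq_quad hf] at h
  generalize conicCoeffs (subst A f) = c' at *
  generalize conicCoeffs f = c at *
  have h1 := h 1 0 0
  have h2 := h 0 1 0
  have h3 := h 0 0 1
  have h4 := h 1 1 0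
  have h5 := h 1 0 1
  have h6 := h 0 1 1
  simp [precomp_apply, quad] at h1 h2 h3 h4 h5 h6
  simp [veroneseLin, coords, symMatrix, dotProduct, Fin.sum_univ_six, Matrix.mul_apply,
    Fin.sum_univ_three]
  clear h
  rw [h1, h2, h3] at *
  grind

theorem toSolid_smul [CharP F 2] (g : PGL 3 F) (P : Pencil F) :
    (g • P).toSolid = veroneseLift F g • P.toSolid := by
  obtain ⟨A, rfl⟩ := QuotientGroup.mk_surjective g
  change (A • P).toSolid = (Units.map (veroneseMatrix (F := F)) A) • P.toSolid
  have hinv : ∀ B : GL (Fin 3) F, ∀ y, veroneseLin B.1 (veroneseLin (B⁻¹).1 y) = y := by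
    intro B y
    rw [← veroneseMatrix_mulVec, ← veroneseMatrix_mulVec, mulVec_mulVec, ← map_mul,
      ← Units.val_mul, mul_inv_cancel, Units.val_one, map_one, one_mulVec]
  refine Subtype.ext ?_
  rw [Solid.smul_val]
  ext y
  constructor
  · intro hy
    refine ⟨veroneseLin (A⁻¹).1 y, fun f hf => ?_, ?_⟩
    · rw [← dotProduct_conicCoeffs_subst _ (P.2.1 hf)]
      exact hy _ ⟨f, hf, rfl⟩
    · rw [mulVecLin_apply, Units.coe_map]
      exact (veroneseMatrix_mulVec _ _).trans (hinv A y)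
  · rintro ⟨w, hw, rfl⟩
    rintro _ ⟨f, hf, rfl⟩
    rw [dotProduct_conicCoeffs_subst _ (P.2.1 hf), mulVecLin_apply, Units.coe_map]
    have : veroneseLin (A⁻¹).1 (veroneseMatrix A.1 *ᵥ w) = w := by
      rw [veroneseMatrix_mulVec]
      simpa using hinv A⁻¹ w
    exact (congrArg _ this).trans (hw f hf)

/-- The coefficient map as a map to linear functionals. -/
def conicFunctional : MvPolynomial (Fin 3) F →ₗ[F] Module.Dual F (Fin 6 → F) :=
  (dotProductEquiv F (Fin 6)).toLinearMap ∘ₗ conicCoeffs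

theorem toSolid_eq_dualCoannihilator (P : Pencil F) :
    P.toSolid.1 = (P.1.map conicFunctional).dualCoannihilator := by
  ext y
  rw [Submodule.mem_dualCoannihilator]
  constructor
  · rintro h _ ⟨f, hf, rfl⟩
    exact h f hf
  · intro h f hf
    exact h _ ⟨f, hf, rfl⟩

theorem conicFunctional_injOn {f g : MvPolynomial (Fin 3) F} (hf : f.IsHomogeneous 2)
    (hg : g.IsHomogeneous 2) (h : conicFunctional f = conicFunctional g) : f = g := by
  have := (dotProductEquiv F (Fin 6)).injective h
  rw [← conicForm_conicCoeffs hf, ← conicForm_conicCoeffs hg, this]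

/-- Coefficients identify quadratic forms with linear functionals on F⁶. In finite dimension, taking
common kernels and taking annihilators are mutually inverse. -/
theorem toSolid_bijective : Function.Bijective (Pencil.toSolid : Pencil F → Solid F) := by
  constructor
  · have key : ∀ P Q : Pencil F, P.1.map conicFunctional = Q.1.map conicFunctional → P.1 ≤ Q.1 := by
      intro P Q h f hf
      have : conicFunctional f ∈ Q.1.map conicFunctional := h ▸ Submodule.mem_map_of_mem hf
      obtain ⟨g, hg, hfg⟩ := this
      rwa [← conicFunctional_injOn (Q.2.1 hg) (P.2.1 hf) hfg]
    intro P Q h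
    have h' := congrArg (fun S : Solid F => S.1.dualAnnihilator) h
    simp only [toSolid_eq_dualCoannihilator, Subspace.dualCoannihilator_dualAnnihilator_eq] at h'
    exact Subtype.ext (le_antisymm (key P Q h') (key Q P h'.symm))
  · intro S
    let Φ := conicForm (F := F) ∘ₗ (dotProductEquiv F (Fin 6)).symm.toLinearMap
    have hΦ : ∀ φ, conicFunctional (Φ φ) = φ := by
      intro φ
      change dotProductEquiv F (Fin 6)
        (conicCoeffs (conicForm ((dotProductEquiv F (Fin 6)).symm φ))) = φ
      rw [conicCoeffs_conicForm, LinearEquiv.apply_symm_apply]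
    have hinj : Function.Injective Φ := Function.LeftInverse.injective hΦ
    have hdim : Module.finrank F (S.1.dualAnnihilator.map Φ) = 2 := by
      rw [← (Submodule.equivMapOfInjective Φ hinj S.1.dualAnnihilator).finrank_eq]
      have := Subspace.finrank_add_finrank_dualAnnihilator_eq S.1
      rw [S.2, Module.finrank_fin_fun] at this
      omega
    have hhom : S.1.dualAnnihilator.map Φ ≤ homogeneousSubmodule (Fin 3) F 2 := by
      rintro _ ⟨φ, -, rfl⟩
      exact conicForm_isHomogeneous _
    let P : Pencil F := ⟨S.1.dualAnnihilator.map Φ, hhom, hdim⟩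
    refine ⟨P, Subtype.ext ?_⟩
    · refine (toSolid_eq_dualCoannihilator P).trans ?_
      change ((S.1.dualAnnihilator.map Φ).map conicFunctional).dualCoannihilator = S.1
      rw [← Submodule.map_comp, show conicFunctional ∘ₗ Φ = LinearMap.id from LinearMap.ext hΦ,
        Submodule.map_id, Subspace.dualAnnihilator_dualCoannihilator_eq]

theorem toSolid_mem_orbit_iff [CharP F 2] (P Q : Pencil F) :
    P.toSolid ∈ MulAction.orbit (veroneseGroup F) Q.toSolid ↔ P ∈ MulAction.orbit (PGL 3 F) Q := by
  constructor
  · rintro ⟨⟨_, g, rfl⟩, h⟩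
    refine ⟨g, toSolid_bijective.1 ?_⟩
    change (g • Q).toSolid = _
    rw [toSolid_smul]
    exact h
  · rintro ⟨g, rfl⟩
    exact ⟨⟨_, g, rfl⟩, (toSolid_smul g Q).symm⟩

theorem conicCoeffs_dotProduct [CharP F 2] {f : MvPolynomial (Fin 3) F} (hf : f.IsHomogeneous 2)
    {n₀ n₁ n₂ d₀ d₁ d₂ : F} (h : toTernary f = quad n₀ n₁ n₂ d₀ d₁ d₂) (y : Fin 6 → F) :
    conicCoeffs f ⬝ᵥ y =
      d₀ * y 0 + n₂ * y 1 + n₁ * y 2 + d₁ * y 3 + n₀ * y 4 + d₂ * y 5 := by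
  rw [toTernary_eq_quad hf] at h
  have h0 : (1 : F) • quad (conicCoeffs f 4) (conicCoeffs f 2) (conicCoeffs f 1) (conicCoeffs f 0)
      (conicCoeffs f 3) (conicCoeffs f 5) + (-1 : F) • quad n₀ n₁ n₂ d₀ d₁ d₂ = 0 := by
    rw [h]
    module
  rw [quad_combination] at h0
  obtain ⟨h4, h2, h1, h0, h3, h5⟩ := quad_eq_zero h0
  rw [dotProduct, Fin.sum_univ_six]
  linear_combination y 0 * h0 + y 1 * h1 + y 2 * h2 + y 3 * h3 + y 4 * h4 + y 5 * h5

/-- The parameter `γ₇` enters the solid of the seventh orbit where its square enters the pencil. -/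
theorem toSolid_pencilRep [Finite F] [CharP F 2] (p p' : Parameters F)
    (h₇ : p'.γ₇ ^ 2 = p.γ₇) (h₁₀ : p'.γ₁₀ = p.γ₁₀) (h₁₂ : p'.γ₁₂ = p.γ₁₂) (h₁₃ : p'.γ₁₃ = p.γ₁₃)
    (h₁₄ : p'.γ₁₄ = p.γ₁₄) (hb : p'.b = p.b) (hc : p'.c = p.c) (i : Fin 15) :
    (pencilRep p' i).toSolid = solidRep p i := by
  -- Both spaces have dimension four, so one inclusion suffices, and it only needs to be checked on
  -- the two generators.
  have hle : (solidRep p i).1 ≤ (pencilRep p' i).toSolid.1 := by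
    rintro v ⟨x, y, z, t, hv⟩ f hf
    obtain ⟨r, s, rfl⟩ := Submodule.mem_span_pair.mp hf
    have hv' : v = coords (solidMatrix p i x y z t) := by rw [← hv, coords_symMatrix]
    have h := toTernary_generatingConics p' i
    have hom := generatingConics_homogeneous p' i
    rw [map_add, map_smul, map_smul, add_dotProduct, smul_dotProduct, smul_dotProduct]
    suffices h : conicCoeffs (generatingConics p' i).1 ⬝ᵥ v = 0 ∧
        conicCoeffs (generatingConics p' i).2 ⬝ᵥ v = 0 by
      rw [h.1, h.2, smul_zero, smul_zero, add_zero]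
    subst hv'
    clear hv hf
    fin_cases i <;>
      (refine ⟨(conicCoeffs_dotProduct hom.1 (congrArg Prod.fst h) _).trans ?_,
        (conicCoeffs_dotProduct hom.2 (congrArg Prod.snd h) _).trans ?_⟩ <;>
      simp [coords, solidMatrix, h₇, h₁₀, h₁₂, h₁₃, h₁₄, hb, hc] <;> grind)
  exact Subtype.ext (Submodule.eq_of_le_of_finrank_eq hle
    ((solidRep p i).2.trans (pencilRep p' i).toSolid.2.symm)).symm

/-- Squaring X₀ + X₁ + γX₂ produces γ², so the seventh solid belongs to the pencil whose parameter
is the square root of γ₇. The trace condition survives because the trace is invariant under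
squaring. -/
theorem exists_solidRep_eq [Finite F] [CharP F 2] (p : Parameters F) :
    ∃ p' : Parameters F, ∀ i, (pencilRep p' i).toSolid = solidRep p i := by
  obtain ⟨γ, hγ⟩ := exists_sq_eq p.γ₇
  have htrace : absTrace γ⁻¹ = 1 := by
    have := p.trace_γ₇
    rwa [← hγ, ← inv_pow, absTrace_sq] at this
  let p' : Parameters F := { p with γ₇ := γ, trace_γ₇ := htrace }
  exact ⟨p', toSolid_pencilRep p p' hγ rfl rfl rfl rfl rfl rfl⟩

theorem existsUnique_solidRep [Finite F] [CharP F 2] (p : Parameters F) (S : Solid F) :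
    ∃! i : Fin 15, S ∈ MulAction.orbit (veroneseGroup F) (solidRep p i) := by
  obtain ⟨p', hp'⟩ := exists_solidRep_eq p
  obtain ⟨P, rfl⟩ := toSolid_bijective.2 S
  simp only [← hp', toSolid_mem_orbit_iff]
  exact existsUnique_pencilRep p' P

theorem orbitIndex_eq_of_mem_orbit [Finite F] [CharP F 2] {P : Pencil F} {p : Parameters F}
    {i : Fin 15} (h : P ∈ MulAction.orbit (PGL 3 F) (pencilRep p i)) :
    orbitIndex (functionSystem P) = i := by
  rw [← orbitIndex_pencilRep p i, ((mem_orbit_iff_equivalent _ _).mp h).orbitIndex_eq]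

/-- The listed pencil and the one that δ sends exactly to the listed solid may have different
parameters. They still share an orbit, because the invariant of the i-th pencil is i for every
admissible choice. -/
theorem toSolid_pencilRep_mem_orbit [Finite F] [CharP F 2] (p : Parameters F) (i : Fin 15) :
    (pencilRep p i).toSolid ∈ MulAction.orbit (veroneseGroup F) (solidRep p i) := by
  obtain ⟨p', hp'⟩ := exists_solidRep_eq p
  rw [← hp', toSolid_mem_orbit_iff]
  obtain ⟨j, hj, -⟩ := existsUnique_pencilRep p' (pencilRep p i)
  have : i = j := by
    rw [← orbitIndex_pencilRep p i]
    exact orbitIndex_eq_of_mem_orbit hj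
  rwa [this] at hj ⊢

end Solids

end ConicPencil

end

theorem theorem1 {F : Type*} [Field F] [Finite F] [CharP F 2] :
    Nat.card (MulAction.orbitRel.Quotient (PGL 3 F) (Pencil F)) = 15 ∧
    Nat.card (MulAction.orbitRel.Quotient (veroneseGroup F) (Solid F)) = 15 ∧
    Function.Injective (veroneseLift F) ∧
    Function.Bijective (Pencil.toSolid : Pencil F → Solid F) ∧
    (∀ (g : PGL 3 F) (P : Pencil F), (g • P).toSolid = veroneseLift F g • P.toSolid) ∧
    Nonempty (Parameters F) ∧
    ∀ p : Parameters F,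
      (∀ P : Pencil F, ∃! i : Fin 15, P ∈ MulAction.orbit (PGL 3 F) (pencilRep p i)) ∧
      (∀ S : Solid F, ∃! i : Fin 15, S ∈ MulAction.orbit (veroneseGroup F) (solidRep p i)) ∧
      (∀ i : Fin 15, (pencilRep p i).toSolid ∈
        MulAction.orbit (veroneseGroup F) (solidRep p i)) := by
  obtain ⟨p⟩ := ConicPencil.exists_parameters F
  exact ⟨ConicPencil.card_orbitRel_quotient _ (ConicPencil.existsUnique_pencilRep p),
    ConicPencil.card_orbitRel_quotient _ (ConicPencil.existsUnique_solidRep p),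
    ConicPencil.veroneseLift_injective, ConicPencil.toSolid_bijective, ConicPencil.toSolid_smul,
    ⟨p⟩, fun p => ⟨ConicPencil.existsUnique_pencilRep p, ConicPencil.existsUnique_solidRep p,
      ConicPencil.toSolid_pencilRep_mem_orbit p⟩⟩
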